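/- **Setting.** For $\kappa>0$ let $\ell(j)=1$ for $|j|\le 1$ and $\ell(j)=|j|\log^{1+\kappa}|j|$ for $|j|>1$ ($j\in\mathbb Z$), and let $V(g)$ denote the total variation of $g$ on its interval of definition. A *Gaussian locally stationary process with constants $\kappa, K$* is a triangular array $X_{t,n}$, $1\le t\le n$, of random variables such that each row $(X_{1,n},\dots,X_{n,n})$ is a Gaussian vector and $X_{t,n}=\sum_{j\in\mathbb Z}a_{t,n}(j)\varepsilon_{t-j}$, where the $\varepsilon_t$ $(t\in\mathbb Z)$ are identically distributed with $\mathbf E\varepsilon_t=0$, $\mathbf E\varepsilon_t^2=1$, $\mathbf E\varepsilon_s\varepsilon_t=0$ for $s\ne t$, where $|a_{t,n}(j)|\le K/\ell(j)$ for all $t,n,j$, and where there are functions $a(\cdot,j):(0,1]\to\mathbb R$ with $\sup_u|a(u,j)|\le K/\ell(j)$, $V(a(\cdot,j))\le K/\ell(j)$ for all $j$ and $\sup_j\sum_{t=1}^n|a_{t,n}(j)-a(t/n,j)|\le K$ for all $n$. For a measurable $\phi:[0,1]\times[-\pi,\pi]\to\mathbb R$ with $\phi(u,\cdot)$ integrable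 for every $u$ put $\hat\phi(u,j)=\int_{-\pi}^{\pi}\phi(u,\lambda)e^{i\lambda j}\,d\lambda$ and $$\rho_\infty(\phi)=\sum_{j}\sup_u|\hat\phi(u,j)|,\quad \tilde v(\phi)=\sup_jV(\hat\phi(\cdot,j)),\quad v_\Sigma(\phi)=\sum_jV(\hat\phi(\cdot,j)),$$ $$\rho_2(\phi)=\Big(\int_0^1\!\!\int_{-\pi}^{\pi}\phi(u,\lambda)^2d\lambda\,du\Big)^{1/2},\qquad \rho_{2,n}(\phi)=\Big(\frac1n\sum_{t=1}^n\int_{-\pi}^{\pi}\phi(\tfrac tn,\lambda)^2d\lambda\Big)^{1/2}.$$ With $[\cdot]$ the integer part, let $$J_n(\tfrac tn,\lambda)=\frac1{2\pi}\sum_{k:\,1\le[t+1/2\pm k/2]\le n}X_{[t+1/2+k/2],n}X_{[t+1/2-k/2],n}e^{-i\lambda k},$$ $$F_n(\phi)=\frac1n\sum_{t=1}^n\int_{-\pi}^{\pi}\phi(\tfrac tn,\lambda)J_n(\tfrac tn,\lambda)\,d\lambda,\qquad \tilde E_n(\phi)=\sqrt n\,(F_n(\phi)-\mathbf EF_n(\phi)).$$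 For a class $\Phi$ of such functions, $N(\epsilon,\Phi,\rho_2)$ is the least $m\ge1$ for which there are $\phi_1,\dots,\phi_m\in\Phi$ such that every $\phi\in\Phi$ satisfies $\rho_2(\phi-\phi_i)<\epsilon$ for some $i$ ($\infty$ if there is none). **Theorem 4.4 ("Infinite-dimensional" index class).** Let $\kappa,K>0$. (A) There are constants $c_1,c_2>0$, depending only on $\kappa$ and $K$, such that for every Gaussian locally stationary process with constants $\kappa,K$ $$P(|\tilde E_n(\phi)|\ge\eta)\le c_1\exp\Big(-c_2\frac{\eta}{\rho_{2,n}(\phi)}\Big)\tag{37}$$ for all $n\ge1$, all $\eta>0$ and all $\phi$ with $\rho_\infty(\phi)<\infty$ and $\tilde v(\phi)<\infty$. (B) There is a constant $L\ge1$, depending only on $\kappa$ and $K$, such that every Gaussian locally stationary process $X_{t,n}$ with constants $\kappa,K$ admits events $B_n$ with $\lim_{n\to\infty}P(B_n)=1$ and the following property. Let $c_1,c_2>0$ be any constants for which (37) holds for this process (for all $n,\eta,\phi$ as in (A)), let $n\ge2$, and let $\Phi$ be a class of measurable functions $\phi:[0,1]\times[-\pi,\pi]\to\mathbb R$ for which there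 are $0<M_*\le1\le M^*<\infty$ with $M_*\le|\phi(u,\lambda)|<M^*$ for all $u,\lambda$ and $\phi\in\Phi$, and finite constants $\rho_\infty,\tilde v,v_\Sigma$ with $\sup_{\Phi}\rho_\infty(\phi)\le\rho_\infty$, $\sup_\Phi\tilde v(\phi)<\tilde v$, $\sup_\Phi v_\Sigma(\phi)\le v_\Sigma$. Suppose that $\sup_{\phi\in\Phi}\rho_2(\phi)\le\tau_2$ with $0<\tau_2<\infty$, and let $\tilde H_\Phi:(0,\infty)\to\mathbb R$ be continuous and monotonically decreasing with $\log N(\epsilon,\Phi,\rho_2)\le\tilde H_\Phi(\epsilon)$ for all $\epsilon>0$. Then $$P\Big(\sup_{\phi\in\Phi}|\tilde E_n(\phi)|>\eta,\;B_n\Big)\le3c_1\exp\Big\{-\frac{c_2}8\frac\eta{\tau_2}\Big\}\tag{45}$$ for all $\eta>0$ satisfying the following conditions: with $\alpha=\tilde H_\Phi^{-1}\big(\frac{c_2}8\frac\eta{\tau_2}\big)$, that is, $\alpha>0$ and $\tilde H_\Phi(\alpha)=\frac{c_2}8\frac\eta{\tau_2}$, $$\eta\ge2^6L\max(\rho_\infty,v_\Sigma,1)\,n^{-1/2}\log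 n,\tag{46}$$ and either $\dfrac{\eta}{16Ln\log n}>\alpha$, or both $$\eta\ge2\,\frac{\log2}{c_2}\,\tau_2\tag{47}$$ and $$\eta\ge\frac{192}{c_2}\int_{\eta/(2^6Ln\log n)}^{\alpha}\tilde H_\Phi(u)\,du.\tag{48}$$ -/

import Mathlib

open MeasureTheory ProbabilityTheory Set Filter Topology
open scoped ENNReal NNReal

universe u

noncomputable section

namespace EmpSpectral

/-! ### Locally stationary processes -/

/-- The weight `ℓ(j)`: it is `1` for `|j| ≤ 1` and `|j| (log |j|)^(1+κ)` for `|j| > 1`. -/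
def ell (κ : ℝ) (j : ℤ) : ℝ :=
  if |j| ≤ 1 then 1 else |(j : ℝ)| * Real.log |(j : ℝ)| ^ (1 + κ)

/-- The data `ε_t`, `a_{t,n}(j)` (written `A n t j`) and `a(u, j)` (written `a u j`, with
`u ∈ (0, 1]`) represent the triangular array `X_{t,n}`, `1 ≤ t ≤ n` (written `X n t`), as a
locally stationary process with constants `κ` and `K`. The bound on `A` makes the
moving-average series converge absolutely almost surely (and in mean square). -/
structure IsLocallyStationaryRepr {Ω : Type*} [MeasurableSpace Ω] (P : Measure Ω) (κ K : ℝ)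
    (X : ℕ → ℤ → Ω → ℝ) (ε : ℤ → Ω → ℝ) (A : ℕ → ℤ → ℤ → ℝ) (a : ℝ → ℤ → ℝ) : Prop where
  measurable_noise : ∀ t, Measurable (ε t)
  identDistrib_noise : ∀ s t, IdentDistrib (ε s) (ε t) P P
  memLp_noise : ∀ t, MemLp (ε t) 2 P
  mean_noise : ∀ t, ∫ ω, ε t ω ∂P = 0
  uncorrelated_noise : ∀ s t, s ≠ t → ∫ ω, ε s ω * ε t ω ∂P = 0
  variance_noise : ∀ t, ∫ ω, ε t ω ^ 2 ∂P = 1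
  series : ∀ (n : ℕ) (t : ℤ), 1 ≤ t → t ≤ n →
    ∀ᵐ ω ∂P, HasSum (fun j : ℤ => A n t j * ε (t - j) ω) (X n t ω)
  coeff_bound : ∀ (n : ℕ) (t j : ℤ), 1 ≤ t → t ≤ n → |A n t j| ≤ K / ell κ j
  curve_bound : ∀ (j : ℤ), ∀ u ∈ Ioc (0 : ℝ) 1, |a u j| ≤ K / ell κ j
  coeff_approx : ∀ (n : ℕ) (j : ℤ),
    ∑ t ∈ Finset.Icc (1 : ℤ) n, |A n t j - a ((t : ℝ) / n) j| ≤ K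
  curve_variation : ∀ j : ℤ,
    eVariationOn (fun u => a u j) (Ioc (0 : ℝ) 1) ≤ ENNReal.ofReal (K / ell κ j)

/-- A Gaussian locally stationary process with constants `κ` and `K`: it has a representation
as above and every row `(X_{1,n}, …, X_{n,n})` is a (possibly degenerate) Gaussian vector. -/
structure IsGaussianLocallyStationary {Ω : Type*} [MeasurableSpace Ω] (P : Measure Ω)
    (κ K : ℝ) (X : ℕ → ℤ → Ω → ℝ) : Prop where
  measurable : ∀ n t, Measurable (X n t)
  gaussian : ∀ n : ℕ,
    HasGaussianLaw (fun ω => fun t : Finset.Icc (1 : ℤ) n => X n t.1 ω) P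
  exists_repr : ∃ ε A a, IsLocallyStationaryRepr P κ K X ε A a

/-! ### Index functions

An index function `φ : [0, 1] × [-π, π] → ℝ` is a map `ℝ → ℝ → ℝ`, of which only the values on
`[0, 1] × [-π, π]` are ever used. -/

/-- Borel measurability on `[0, 1] × [-π, π]`. -/
def IsIndexFunction (φ : ℝ → ℝ → ℝ) : Prop :=
  Measurable ((Icc (0 : ℝ) 1 ×ˢ Icc (-Real.pi) Real.pi).domRestrict (Function.uncurry φ))

/-- The Fourier coefficient `∫_{-π}^{π} φ(u, x) exp(i x j) dx`. -/
def fourierCoef (φ : ℝ → ℝ → ℝ) (u : ℝ) (j : ℤ) : ℂ :=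
  ∫ x in (-Real.pi)..Real.pi, (φ u x : ℂ) * Complex.exp (Complex.I * x * j)

/-- The norm `ρ_∞(φ) = ∑_j sup_u |φ̂(u, j)|`. -/
def rhoInf (φ : ℝ → ℝ → ℝ) : ℝ≥0∞ :=
  ∑' j : ℤ, ⨆ u ∈ Icc (0 : ℝ) 1, ‖fourierCoef φ u j‖ₑ

/-- The quantity `ṽ(φ) = sup_j V(φ̂(·, j))`. -/
def vTilde (φ : ℝ → ℝ → ℝ) : ℝ≥0∞ :=
  ⨆ j : ℤ, eVariationOn (fun u => fourierCoef φ u j) (Icc (0 : ℝ) 1)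

/-- The quantity `v_Σ(φ) = ∑_j V(φ̂(·, j))`. -/
def vSigma (φ : ℝ → ℝ → ℝ) : ℝ≥0∞ :=
  ∑' j : ℤ, eVariationOn (fun u => fourierCoef φ u j) (Icc (0 : ℝ) 1)

/-- The `L²`-norm `ρ₂` on `[0, 1] × [-π, π]`. -/
def rho2 (φ : ℝ → ℝ → ℝ) : ℝ :=
  Real.sqrt (∫ u in (0 : ℝ)..1, ∫ x in (-Real.pi)..Real.pi, φ u x ^ 2)

/-- The discretised `L²`-norm `ρ_{2,n}`. -/
def rho2n (n : ℕ) (φ : ℝ → ℝ → ℝ) : ℝ :=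
  Real.sqrt ((1 / (n : ℝ)) *
    ∑ t ∈ Finset.Icc (1 : ℤ) n, ∫ x in (-Real.pi)..Real.pi, φ ((t : ℝ) / n) x ^ 2)

/-- The covering number: the least `m ≥ 1` such that `m` open `ρ₂`-balls of radius `r` with
centres in `Φ` cover `Φ` (it is `⊤` if there is no such `m`). -/
def coveringNumber (r : ℝ) (Φ : Set (ℝ → ℝ → ℝ)) : ℕ∞ :=
  ⨅ m ∈ {m : ℕ | 1 ≤ m ∧ ∃ c : Fin m → ℝ → ℝ → ℝ,
    (∀ i, c i ∈ Φ) ∧ ∀ φ ∈ Φ, ∃ i, rho2 (φ - c i) < r}, (m : ℕ∞)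

/-- The metric entropy `H(r, Φ, ρ₂) = log N(r, Φ, ρ₂)`, with `log ⊤ = ⊤`. -/
def metricEntropy (r : ℝ) (Φ : Set (ℝ → ℝ → ℝ)) : EReal :=
  ENNReal.log ((coveringNumber r Φ : ℕ∞) : ℝ≥0∞)

/-- The function `H` is a continuous, monotonically decreasing majorant, on `(0, ∞)`, of the
metric entropy of `Φ`. -/
structure IsEntropyMajorant (H : ℝ → ℝ) (Φ : Set (ℝ → ℝ → ℝ)) : Prop where
  continuousOn : ContinuousOn H (Ioi 0)
  antitoneOn : AntitoneOn H (Ioi 0)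
  entropy_le : ∀ r : ℝ, 0 < r → metricEntropy r Φ ≤ (H r : EReal)

/-- Uniform boundedness of a class `Φ` of index functions: `φ` is bounded away from zero and
infinity, and the norms `ρ_∞`, `ṽ`, `v_Σ` are bounded by `ρI`, `vT`, `vS` on `Φ`. -/
structure IsBoundedClass (Φ : Set (ℝ → ℝ → ℝ)) (ρI vT vS : ℝ≥0) : Prop where
  measurable : ∀ φ ∈ Φ, IsIndexFunction φ
  bounds : ∃ m M : ℝ, 0 < m ∧ m ≤ 1 ∧ 1 ≤ M ∧ ∀ φ ∈ Φ, ∀ u ∈ Icc (0 : ℝ) 1,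
    ∀ x ∈ Icc (-Real.pi) Real.pi, m ≤ |φ u x| ∧ |φ u x| < M
  rhoInf_le : ⨆ φ ∈ Φ, rhoInf φ ≤ ρI
  vTilde_lt : ⨆ φ ∈ Φ, vTilde φ < vT
  vSigma_le : ⨆ φ ∈ Φ, vSigma φ ≤ vS

/-! ### The empirical spectral process -/

/-- The integer `[t + 1/2 + k/2]`. -/
def idx (t k : ℤ) : ℤ := ⌊(t : ℝ) + 1 / 2 + (k : ℝ) / 2⌋

/-- The set of all `k` with `1 ≤ [t + 1/2 ± k/2] ≤ n`; see `mem_lags`. -/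
def lags (n : ℕ) (t : ℤ) : Finset ℤ :=
  (Finset.Icc (-(n : ℤ)) n).filter fun k =>
    (1 ≤ idx t k ∧ idx t k ≤ n) ∧ (1 ≤ idx t (-k) ∧ idx t (-k) ≤ n)

theorem idx_eq (t k : ℤ) : idx t k = (2 * t + 1 + k) / 2 := by
  have h : (t : ℝ) + 1 / 2 + (k : ℝ) / 2 = (((2 * t + 1 + k : ℤ) : ℝ)) / ((2 : ℕ) : ℝ) := by
    push_cast; ring
  rw [idx, h, Int.floor_div_natCast, Int.floor_intCast]
  rfl

theorem mem_lags {n : ℕ} {t k : ℤ} :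
    k ∈ lags n t ↔ (1 ≤ idx t k ∧ idx t k ≤ n) ∧ (1 ≤ idx t (-k) ∧ idx t (-k) ≤ n) := by
  simp only [lags, Finset.mem_filter, Finset.mem_Icc, idx_eq]
  omega

/-- The pre-periodogram `J_n(t/n, x)` of the row `Y = (X_{1,n}, …, X_{n,n})`. -/
def prePeriodogram (n : ℕ) (Y : ℤ → ℝ) (t : ℤ) (x : ℝ) : ℂ :=
  1 / (2 * Real.pi) *
    ∑ k ∈ lags n t, (Y (idx t k) : ℂ) * (Y (idx t (-k)) : ℂ) * Complex.exp (-(Complex.I * x * k))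

/-- The empirical spectral functional `F_n(φ)` of the row `Y`. Its value is a real number,
stored as a complex one. -/
def Fn (n : ℕ) (Y : ℤ → ℝ) (φ : ℝ → ℝ → ℝ) : ℂ :=
  1 / (n : ℂ) * ∑ t ∈ Finset.Icc (1 : ℤ) n,
    ∫ x in (-Real.pi)..Real.pi, (φ ((t : ℝ) / n) x : ℂ) * prePeriodogram n Y t x

/-- The centred empirical spectral process `Ẽ_n(φ) = √n (F_n(φ) - E F_n(φ))`. -/
def En {Ω : Type*} [MeasurableSpace Ω] (P : Measure Ω) (X : ℕ → ℤ → Ω → ℝ) (n : ℕ)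
    (φ : ℝ → ℝ → ℝ) (ω : Ω) : ℂ :=
  (Real.sqrt n : ℂ) *
    (Fn n (fun t => X n t ω) φ - ∫ ω', Fn n (fun t => X n t ω') φ ∂P)

/-- The constants `c₁, c₂` satisfy the exponential inequality
`P(|Ẽ_n(φ)| ≥ η) ≤ c₁ exp(-c₂ η / ρ_{2,n}(φ))` for all `n`, all `η > 0` and all single index
functions `φ` with `ρ_∞(φ) < ∞` and `ṽ(φ) < ∞`. -/
def ExpInequality {Ω : Type*} [MeasurableSpace Ω] (P : Measure Ω) (X : ℕ → ℤ → Ω → ℝ)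
    (c₁ c₂ : ℝ) : Prop :=
  ∀ (n : ℕ) (φ : ℝ → ℝ → ℝ) (η : ℝ), 1 ≤ n → IsIndexFunction φ →
    (∀ u ∈ Icc (0 : ℝ) 1, IntervalIntegrable (φ u) volume (-Real.pi) Real.pi) →
    rhoInf φ < ⊤ → vTilde φ < ⊤ → 0 < η →
    P.real {ω | η ≤ ‖En P X n φ ω‖} ≤ c₁ * Real.exp (-(c₂ * (η / rho2n n φ)))

end EmpSpectral

end

/-! For part (A), `En P X n φ` is `1 / (2π√n)` times a centred quadratic form in the Gaussian row.
The pairs (t, k) in the pre-periodogram enumerate every (i, j) in {1, …, n}² exactly once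
(`sum_lags`), so by Parseval the matrix of the form has squared Frobenius norm at most 2πn
ρ_{2,n}(φ)². The covariance operator of the row has norm at most σ² with σ = K ∑ 1/ℓ(j)
(`integral_sq_sum_le`). Simultaneous diagonalisation turns the form into ∑ d_i (w_i² - 1) with
independent standard normal w_i and ∑ d_i² at most σ⁴ times the squared Frobenius norm. Chernoff's
bound then gives the exponential tail (`measureReal_abs_gaussian_quadratic_ge_le`).

Part (B) is a chaining argument with two obstacles: the exponential inequality involves ρ_{2,n}
whereas the entropy is that of ρ₂, and c₁, c₂ are arbitrary constants for which the inequality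
happens to hold. Both are met by replacing φ̂(t/n, ·) with its average over the cell ((t-1)/n, t/n].
The resulting process `avgSeries` has the following properties.

It is additive under differences of bounded index functions, and the ℓ²-norm of its coefficients is
controlled by ρ₂ (Cauchy-Schwarz in time, Bessel in frequency: `sum_sq_norm_avgCoef_le`). It equals
`En` at a genuine index function, a step function in time (`En_stepIndex`), so the assumed
inequality applies to it and to its increments, with ρ₂ in place of ρ_{2,n}. On the event that all
|X_{t,n}| are below 2σ√(log n), it differs from `En` by a constant times v_Σ log n / √n
(`norm_En_sub_avgSeries_le`), because replacing endpoint values by averages costs at most the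
variation over each cell. On the same event it is Lipschitz in ρ₂ with constant L n log n
(`norm_avgSeries_le`), which allows chaining to stop at a mesh of order η / (L n log n).

Chaining along the dyadic meshes α/2^j (`measureReal_exists_large_le`) then gives the bound. The
choice of α makes 2H(α) the exponent available at the first net: one H(α) pays for the cardinality
of that net, and the other is the exponent in the conclusion. -/

noncomputable section

namespace EmpSpectral

/-! ### Quadratic forms in Gaussian vectors -/

section Gaussian

open Matrix
open scoped MatrixOrder

theorem integral_exp_mul_sq_sub_one {a : ℝ} (ha : a < 1 / 2) :
    ∫ x, Real.exp (a * (x ^ 2 - 1)) ∂(gaussianReal 0 1)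
      = Real.exp (-a) * (Real.sqrt (1 - 2 * a))⁻¹ := by
  rw [integral_gaussianReal_eq_integral_smul one_ne_zero]
  have h : ∀ x : ℝ, gaussianPDFReal 0 1 x • Real.exp (a * (x ^ 2 - 1))
      = ((Real.sqrt (2 * Real.pi))⁻¹ * Real.exp (-a)) * Real.exp (-(1 / 2 - a) * x ^ 2) := by
    intro x
    rw [gaussianPDFReal_def]
    simp only [smul_eq_mul, NNReal.coe_one, mul_one, sub_zero]
    rw [mul_assoc, mul_assoc, ← Real.exp_add, ← Real.exp_add]
    congr 2
    ring
  simp_rw [h]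
  rw [integral_const_mul, integral_gaussian]
  have h2 : Real.pi / (1 / 2 - a) = (2 * Real.pi) * (1 - 2 * a)⁻¹ := by
    have : 1 - 2 * a ≠ 0 := by linarith
    have : 1 / 2 - a ≠ 0 := by linarith
    field_simp
  rw [h2, Real.sqrt_mul (x := 2 * Real.pi) (by positivity), Real.sqrt_inv]
  have : Real.sqrt (2 * Real.pi) ≠ 0 := by positivity
  field_simp

/-- By the exact value of the integral, the claim amounts to 1 ≤ (1 - 2a) exp(2a + 4a²). For a < 0
the bound 1 + x ≤ exp x suffices, since (1 - 2a)(1 + 2a + 4a²) = 1 - 8a³. For a ≥ 0 the quadratic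
term of the exponential is needed, and the restriction a ≤ 1/4 enters as a factor 1/4 - a. -/
theorem integral_exp_mul_sq_sub_one_le {a : ℝ} (ha : |a| ≤ 1 / 4) :
    ∫ x, Real.exp (a * (x ^ 2 - 1)) ∂(gaussianReal 0 1) ≤ Real.exp (2 * a ^ 2) := by
  obtain ⟨h1, h2⟩ := abs_le.1 ha
  rw [integral_exp_mul_sq_sub_one (by linarith), ← div_eq_mul_inv,
    div_le_iff₀ (Real.sqrt_pos.2 (by linarith))]
  have key : 1 ≤ (1 - 2 * a) * Real.exp (2 * a + 4 * a ^ 2) := by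
    rcases le_or_gt 0 a with h | h
    · have := Real.quadratic_le_exp_of_nonneg (x := 2 * a + 4 * a ^ 2) (by positivity)
      have h3 : 1 + 2 * a + 6 * a ^ 2 + 8 * a ^ 3 ≤ Real.exp (2 * a + 4 * a ^ 2) := by
        nlinarith [pow_nonneg h 4]
      have h4 : 1 ≤ (1 - 2 * a) * (1 + 2 * a + 6 * a ^ 2 + 8 * a ^ 3) := by
        have : (1 - 2 * a) * (1 + 2 * a + 6 * a ^ 2 + 8 * a ^ 3)
          = 1 + 2 * a ^ 2 * ((1 / 4 - a) * (4 + 8 * a)) := by ring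
        rw [this]
        have : 0 ≤ 2 * a ^ 2 * ((1 / 4 - a) * (4 + 8 * a)) :=
          mul_nonneg (by positivity) (mul_nonneg (by linarith) (by linarith))
        linarith
      exact h4.trans (mul_le_mul_of_nonneg_left h3 (by linarith))
    · have := Real.add_one_le_exp (2 * a + 4 * a ^ 2)
      have h4 : 1 ≤ (1 - 2 * a) * (2 * a + 4 * a ^ 2 + 1) := by
        nlinarith [mul_pos (mul_pos (neg_pos.2 h) (neg_pos.2 h)) (neg_pos.2 h)]
      exact h4.trans (mul_le_mul_of_nonneg_left this (by linarith))
  have h5 : Real.exp (2 * a ^ 2) = Real.exp (-a) * Real.sqrt (Real.exp (2 * a + 4 * a ^ 2)) := by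
    rw [← Real.exp_half, ← Real.exp_add]
    congr 1
    ring
  rw [h5, mul_assoc, ← Real.sqrt_mul (Real.exp_pos _).le, mul_comm (Real.exp (2 * a + _))]
  nth_rewrite 1 [← mul_one (Real.exp (-a))]
  gcongr
  exact Real.one_le_sqrt.2 key

variable {ι : Type*} [Fintype ι]

theorem measureReal_sum_sq_sub_one_ge_le (d : ι → ℝ) {R : ℝ} (hR : 0 < R)
    (hd : ∑ i, d i ^ 2 ≤ R ^ 2) (η : ℝ) :
    (Measure.pi fun _ : ι => gaussianReal 0 1).real {w | η ≤ ∑ i, d i * (w i ^ 2 - 1)}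
      ≤ Real.exp (1 / 8) * Real.exp (-(η / (4 * R))) := by
  set μ := Measure.pi fun _ : ι => gaussianReal 0 1
  -- The Chernoff parameter: since |d i| ≤ R, it keeps every |s * d i| ≤ 1/4, and the moment
  -- generating function is then at most exp(2 s² R²) = exp(1/8).
  set s : ℝ := 1 / (4 * R) with hs
  have hdi : ∀ i, |s * d i| ≤ 1 / 4 := by
    intro i
    have h1 : d i ^ 2 ≤ R ^ 2 :=
      (Finset.single_le_sum (fun j _ => sq_nonneg (d j)) (Finset.mem_univ i)).trans hd
    have h2 : |d i| ≤ R := abs_le_of_sq_le_sq h1 hR.le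
    rw [abs_mul, hs, abs_of_pos (by positivity), div_mul_eq_mul_div, one_mul,
      div_le_iff₀ (by positivity)]
    linarith
  have hmgf : mgf (fun w : ι → ℝ => ∑ i, d i * (w i ^ 2 - 1)) μ s
      = ∏ i, ∫ x, Real.exp ((s * d i) * (x ^ 2 - 1)) ∂(gaussianReal 0 1) := by
    rw [mgf, ← integral_fintype_prod_eq_prod]
    refine integral_congr_ae (ae_of_all _ fun w => ?_)
    simp only
    rw [← Real.exp_sum, Finset.mul_sum]
    congr 1
    exact Finset.sum_congr rfl fun i _ => by ring
  have hpos : 0 < mgf (fun w : ι → ℝ => ∑ i, d i * (w i ^ 2 - 1)) μ s := by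
    rw [hmgf]
    refine Finset.prod_pos fun i _ => ?_
    have := (abs_le.1 (hdi i)).2
    rw [integral_exp_mul_sq_sub_one (by linarith)]
    have : 0 < Real.sqrt (1 - 2 * (s * d i)) := Real.sqrt_pos.2 (by linarith)
    positivity
  -- The Bochner integral of a non-integrable function is 0, so positivity of the moment generating
  -- function already implies integrability.
  have hint : Integrable (fun w : ι → ℝ => Real.exp (s * ∑ i, d i * (w i ^ 2 - 1))) μ := by
    by_contra h
    rw [mgf, integral_undef h] at hpos
    exact lt_irrefl _ hpos
  refine (measure_ge_le_exp_mul_mgf η (by positivity) hint).trans ?_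
  rw [mul_comm]
  have hexp : Real.exp (-s * η) = Real.exp (-(η / (4 * R))) := by
    rw [hs]; congr 1; ring
  rw [hexp]
  gcongr
  rw [hmgf]
  refine (Finset.prod_le_prod (fun i _ => integral_nonneg fun x => (Real.exp_pos _).le)
    fun i _ => integral_exp_mul_sq_sub_one_le (hdi i)).trans ?_
  rw [← Real.exp_sum, Real.exp_le_exp]
  have : ∑ i, 2 * (s * d i) ^ 2 = 2 * s ^ 2 * ∑ i, d i ^ 2 := by
    rw [Finset.mul_sum]; exact Finset.sum_congr rfl fun i _ => by ring
  rw [this]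
  calc 2 * s ^ 2 * ∑ i, d i ^ 2 ≤ 2 * s ^ 2 * R ^ 2 := by gcongr
    _ = 1 / 8 := by rw [hs]; field_simp; norm_num

theorem measureReal_abs_sum_sq_sub_one_ge_le (d : ι → ℝ) {R : ℝ} (hR : 0 < R)
    (hd : ∑ i, d i ^ 2 ≤ R ^ 2) (η : ℝ) :
    (Measure.pi fun _ : ι => gaussianReal 0 1).real {w | η ≤ |∑ i, d i * (w i ^ 2 - 1)|}
      ≤ 3 * Real.exp (-(η / (4 * R))) := by
  have h1 := measureReal_sum_sq_sub_one_ge_le d hR hd η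
  have h2 := measureReal_sum_sq_sub_one_ge_le (fun i => -d i) hR (by simpa using hd) η
  have hsub : {w : ι → ℝ | η ≤ |∑ i, d i * (w i ^ 2 - 1)|}
      ⊆ {w | η ≤ ∑ i, d i * (w i ^ 2 - 1)} ∪ {w | η ≤ ∑ i, -d i * (w i ^ 2 - 1)} := by
    intro w hw
    rcases le_abs.1 (show η ≤ |_| from hw) with h | h
    · exact Or.inl h
    · refine Or.inr ?_
      simpa only [mem_ofPred_eq, neg_mul, Finset.sum_neg_distrib] using h
  have h3 := (measureReal_mono (μ := Measure.pi fun _ : ι => gaussianReal 0 1) hsub).trans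
    (measureReal_union_le _ _)
  have h4 : Real.exp (1 / 8) ≤ 3 / 2 := by
    have := Real.exp_bound_div_one_sub_of_interval (x := 1 / 8) (by norm_num) (by norm_num)
    linarith
  have h5 := Real.exp_pos (-(η / (4 * R)))
  nlinarith

/-- Both laws have characteristic function v ↦ exp(-|Tᵀv|²/2). `T` may be singular, so degenerate
Gaussian vectors are covered. -/
theorem map_eq_map_pi_gaussianReal {Ω : Type*} [MeasurableSpace Ω] {P : Measure Ω}
    {Y : Ω → ι → ℝ} (hY : HasGaussianLaw Y P) (hmean : ∀ i, ∫ ω, Y ω i ∂P = 0)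
    {T : Matrix ι ι ℝ} (hT : ∀ i j, (T * Tᵀ) i j = ∫ ω, Y ω i * Y ω j ∂P) :
    P.map Y = (Measure.pi fun _ : ι => gaussianReal 0 1).map fun w => T *ᵥ w := by
  classical
  have := hY.isProbabilityMeasure
  have hmem : ∀ i, MemLp (fun ω => Y ω i) 2 P := fun i => (hY.eval i).memLp_two
  have hmT : Measurable fun w : ι → ℝ => T *ᵥ w := by
    refine measurable_pi_lambda _ fun i => ?_
    simp only [mulVec, dotProduct]
    fun_prop
  have : IsProbabilityMeasure (P.map Y) := Measure.isProbabilityMeasure_map hY.aemeasurable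
  have : IsProbabilityMeasure ((Measure.pi fun _ : ι => gaussianReal 0 1).map fun w => T *ᵥ w) :=
    Measure.isProbabilityMeasure_map hmT.aemeasurable
  refine Measure.ext_of_charFunDual ?_
  ext L
  set v : ι → ℝ := fun i => L (Pi.single i 1) with hv
  have hL : ∀ y : ι → ℝ, L y = ∑ i, v i * y i := by
    intro y
    conv_lhs => rw [← Finset.univ_sum_single y]
    rw [map_sum]
    refine Finset.sum_congr rfl fun i _ => ?_
    rw [hv, mul_comm, ← smul_eq_mul, ← map_smul, ← Pi.single_smul, smul_eq_mul, mul_one]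
  rw [hY.charFunDual_map_eq_fun L]
  have hmeanL : ∫ ω, L (Y ω) ∂P = 0 := by
    simp_rw [hL]
    rw [integral_finsetSum _ fun i _ => ((hmem i).integrable (by norm_num)).const_mul _]
    simp [integral_const_mul, hmean]
  have hvar : Var[fun ω => L (Y ω); P] = ∑ i, (Tᵀ *ᵥ v) i ^ 2 := by
    have hae : AEMeasurable (fun ω => L (Y ω)) P := (hY.map_fun L).aemeasurable
    rw [variance_eq_integral hae, hmeanL]
    simp only [sub_zero]
    have h1 : ∀ ω, L (Y ω) ^ 2 = ∑ i, ∑ j, v i * v j * (Y ω i * Y ω j) := by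
      intro ω
      rw [hL, sq, Finset.sum_mul_sum]
      exact Finset.sum_congr rfl fun i _ => Finset.sum_congr rfl fun j _ => by ring
    simp_rw [h1]
    have hi : ∀ i j, Integrable (fun ω => v i * v j * (Y ω i * Y ω j)) P := fun i j =>
      ((hmem i).integrable_mul (hmem j)).const_mul _
    rw [integral_finsetSum _ fun i _ => integrable_finsetSum _ fun j _ => hi i j]
    simp_rw [integral_finsetSum _ fun j _ => hi _ j, integral_const_mul, ← hT]
    have h2 : ∑ i, (Tᵀ *ᵥ v) i ^ 2 = v ⬝ᵥ ((T * Tᵀ) *ᵥ v) := by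
      rw [← mulVec_mulVec, dotProduct_mulVec, ← mulVec_transpose]
      simp [dotProduct, sq]
    rw [h2]
    simp only [dotProduct, mulVec, Finset.mul_sum]
    exact Finset.sum_congr rfl fun i _ => Finset.sum_congr rfl fun j _ => by ring
  rw [hmeanL, hvar, charFunDual_apply,
    integral_map hmT.aemeasurable (by fun_prop)]
  have h3 : ∀ w : ι → ℝ, L (T *ᵥ w) = ∑ i, (Tᵀ *ᵥ v) i * w i := by
    intro w
    rw [hL]
    change v ⬝ᵥ (T *ᵥ w) = (Tᵀ *ᵥ v) ⬝ᵥ w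
    rw [dotProduct_mulVec, mulVec_transpose]
  simp_rw [h3, Complex.ofReal_sum, Finset.sum_mul, Complex.exp_sum]
  rw [integral_fintype_prod_eq_prod
    (f := fun i (x : ℝ) => Complex.exp ((((Tᵀ *ᵥ v) i * x : ℝ) : ℂ) * Complex.I))]
  have h4 : ∀ i, ∫ x : ℝ, Complex.exp ((((Tᵀ *ᵥ v) i * x : ℝ) : ℂ) * Complex.I) ∂gaussianReal 0 1
      = Complex.exp (-((Tᵀ *ᵥ v) i : ℂ) ^ 2 / 2) := by
    intro i
    have := charFun_gaussianReal (μ := 0) (v := 1) ((Tᵀ *ᵥ v) i)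
    rw [charFun_apply_real] at this
    push_cast
    rw [this]
    congr 1
    push_cast
    ring
  simp_rw [h4]
  rw [← Complex.exp_sum]
  congr 1
  push_cast
  rw [← Finset.sum_div, Finset.sum_neg_distrib]
  ring

theorem trace_mul_transpose_self (M : Matrix ι ι ℝ) : (M * Mᵀ).trace = ∑ i, ∑ j, M i j ^ 2 := by
  simp [trace, mul_apply, sq]

theorem sum_sq_mul_le {B M : Matrix ι ι ℝ} {σ : ℝ}
    (hB : ∀ v : ι → ℝ, ∑ i, (B *ᵥ v) i ^ 2 ≤ σ ^ 2 * ∑ i, v i ^ 2) :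
    ∑ i, ∑ j, (B * M) i j ^ 2 ≤ σ ^ 2 * ∑ i, ∑ j, M i j ^ 2 := by
  rw [Finset.sum_comm, Finset.sum_comm (f := fun i j => M i j ^ 2), Finset.mul_sum]
  exact Finset.sum_le_sum fun j _ => hB fun i => M i j

theorem exists_orthogonal_diagonalization [DecidableEq ι] {A : Matrix ι ι ℝ} (hA : A.IsHermitian) :
    ∃ (U : Matrix ι ι ℝ) (d : ι → ℝ), U * Uᵀ = 1 ∧ Uᵀ * U = 1 ∧ A = U * diagonal d * Uᵀ := by
  refine ⟨hA.eigenvectorUnitary.1, hA.eigenvalues, ?_, ?_, ?_⟩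
  · have := mem_unitaryGroup_iff.1 hA.eigenvectorUnitary.2
    rwa [star_eq_conjTranspose, conjTranspose_eq_transpose_of_trivial] at this
  · have := mem_unitaryGroup_iff'.1 hA.eigenvectorUnitary.2
    rwa [star_eq_conjTranspose, conjTranspose_eq_transpose_of_trivial] at this
  · have := hA.spectral_theorem
    rw [Unitary.conjStarAlgAut_apply] at this
    rw [← conjTranspose_eq_transpose_of_trivial]
    exact this

/-- Write S = BᵀB and let U diagonalise B M Bᵀ orthogonally; then T = BᵀU works, without inverting
S. The numbers `d` are the eigenvalues of B M Bᵀ, so ∑ d² is its squared Frobenius norm. The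
operator norm of B is at most σ, and each of the two multiplications by B costs a factor σ². -/
theorem exists_diagonalizing_factor [DecidableEq ι] {S M : Matrix ι ι ℝ} (hS : S.PosSemidef)
    (hM : M.IsHermitian) {σ : ℝ}
    (hσ : ∀ v : ι → ℝ, v ⬝ᵥ (S *ᵥ v) ≤ σ ^ 2 * ∑ i, v i ^ 2) :
    ∃ (T : Matrix ι ι ℝ) (d : ι → ℝ), T * Tᵀ = S ∧ Tᵀ * M * T = diagonal d ∧
      ∑ i, d i ^ 2 ≤ σ ^ 4 * ∑ i, ∑ j, M i j ^ 2 := by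
  obtain ⟨B, hB⟩ := CStarAlgebra.nonneg_iff_eq_star_mul_self.mp hS.nonneg
  rw [star_eq_conjTranspose, conjTranspose_eq_transpose_of_trivial] at hB
  have hA : (B * M * Bᵀ).IsHermitian := by
    rw [IsHermitian, conjTranspose_eq_transpose_of_trivial] at *
    rw [transpose_mul, transpose_mul, transpose_transpose, hM, Matrix.mul_assoc]
  obtain ⟨U, e, hU1, hU2, hspec⟩ := exists_orthogonal_diagonalization hA
  have hD : Uᵀ * (B * M * Bᵀ) * U = diagonal e := by
    rw [hspec]
    calc Uᵀ * (U * diagonal e * Uᵀ) * U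
        = (Uᵀ * U) * diagonal e * (Uᵀ * U) := by simp only [Matrix.mul_assoc]
      _ = _ := by rw [hU2]; simp
  refine ⟨Bᵀ * U, e, ?_, ?_, ?_⟩
  · rw [transpose_mul, transpose_transpose, hB]
    calc Bᵀ * U * (Uᵀ * B) = Bᵀ * (U * Uᵀ) * B := by simp only [Matrix.mul_assoc]
      _ = _ := by rw [hU1]; simp
  · rw [transpose_mul, transpose_transpose, ← hD]
    simp only [Matrix.mul_assoc]
  · have hBv : ∀ v : ι → ℝ, ∑ i, (B *ᵥ v) i ^ 2 ≤ σ ^ 2 * ∑ i, v i ^ 2 := by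
      intro v
      refine le_trans (le_of_eq ?_) (hσ v)
      rw [hB, ← mulVec_mulVec, dotProduct_mulVec, vecMul_transpose]
      simp [dotProduct, sq]
    have h1 : ∑ i, e i ^ 2 = ∑ i, ∑ j, (B * M * Bᵀ) i j ^ 2 := by
      rw [← trace_mul_transpose_self, hspec, transpose_mul, transpose_mul, transpose_transpose,
        diagonal_transpose]
      have : U * diagonal e * Uᵀ * (U * (diagonal e * Uᵀ))
          = U * (diagonal e * (Uᵀ * U) * diagonal e) * Uᵀ := by
        simp only [Matrix.mul_assoc]
      rw [this, hU2, Matrix.mul_one, trace_mul_comm, ← Matrix.mul_assoc, hU2, Matrix.one_mul,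
        diagonal_mul_diagonal, trace_diagonal]
      simp [sq]
    have h2 : ∑ i, ∑ j, (B * M * Bᵀ) i j ^ 2 = ∑ i, ∑ j, (B * (M * Bᵀ)) i j ^ 2 := by
      rw [Matrix.mul_assoc]
    have h3 : ∑ i, ∑ j, (M * Bᵀ) i j ^ 2 = ∑ i, ∑ j, (B * Mᵀ) i j ^ 2 := by
      rw [Finset.sum_comm]
      have : B * Mᵀ = (M * Bᵀ)ᵀ := by rw [transpose_mul, transpose_transpose]
      rw [this]
      rfl
    have h4 : ∑ i, ∑ j, Mᵀ i j ^ 2 = ∑ i, ∑ j, M i j ^ 2 := by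
      rw [Finset.sum_comm]; rfl
    rw [h1, h2]
    refine (sum_sq_mul_le hBv).trans ?_
    rw [h3]
    have := sum_sq_mul_le (M := Mᵀ) hBv
    rw [h4] at this
    calc _ ≤ σ ^ 2 * (σ ^ 2 * ∑ i, ∑ j, M i j ^ 2) := by gcongr
      _ = _ := by ring

theorem measureReal_abs_gaussian_quadratic_ge_le {Ω : Type*} [MeasurableSpace Ω] {P : Measure Ω}
    {Y : Ω → ι → ℝ} (hY : HasGaussianLaw Y P) (hmean : ∀ i, ∫ ω, Y ω i ∂P = 0)
    {σ : ℝ} (hσ0 : 0 < σ)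
    (hσ : ∀ v : ι → ℝ, ∫ ω, (∑ i, v i * Y ω i) ^ 2 ∂P ≤ σ ^ 2 * ∑ i, v i ^ 2)
    {M : Matrix ι ι ℝ} (hM : ∀ i j, M i j = M j i) {R : ℝ} (hR : 0 < R)
    (hMR : ∑ i, ∑ j, M i j ^ 2 ≤ R ^ 2) (η : ℝ) :
    P.real {ω | η ≤ |∑ i, ∑ j, M i j * (Y ω i * Y ω j - ∫ ω', Y ω' i * Y ω' j ∂P)|}
      ≤ 3 * Real.exp (-(η / (4 * (σ ^ 2 * R)))) := by
  classical
  have := hY.isProbabilityMeasure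
  have hmem : ∀ i, MemLp (fun ω => Y ω i) 2 P := fun i => (hY.eval i).memLp_two
  set S : Matrix ι ι ℝ := Matrix.of fun i j => ∫ ω, Y ω i * Y ω j ∂P with hSdef
  have hSv : ∀ v : ι → ℝ, v ⬝ᵥ (S *ᵥ v) = ∫ ω, (∑ i, v i * Y ω i) ^ 2 ∂P := by
    intro v
    have h1 : ∀ ω, (∑ i, v i * Y ω i) ^ 2 = ∑ i, ∑ j, v i * v j * (Y ω i * Y ω j) := by
      intro ω
      rw [sq, Finset.sum_mul_sum]
      exact Finset.sum_congr rfl fun i _ => Finset.sum_congr rfl fun j _ => by ring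
    simp_rw [h1]
    have hi : ∀ i j, Integrable (fun ω => v i * v j * (Y ω i * Y ω j)) P := fun i j =>
      ((hmem i).integrable_mul (hmem j)).const_mul _
    rw [integral_finsetSum _ fun i _ => integrable_finsetSum _ fun j _ => hi i j]
    simp_rw [integral_finsetSum _ fun j _ => hi _ j, integral_const_mul]
    simp only [dotProduct, mulVec, Finset.mul_sum, hSdef, Matrix.of_apply]
    exact Finset.sum_congr rfl fun i _ => Finset.sum_congr rfl fun j _ => by ring
  have hS : S.PosSemidef := by
    refine PosSemidef.of_dotProduct_mulVec_nonneg ?_ ?_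
    · ext i j
      simp [hSdef, mul_comm]
    · intro v
      rw [star_trivial, hSv]
      exact integral_nonneg fun ω => sq_nonneg _
  obtain ⟨T, d, hT, hd, hd2⟩ := exists_diagonalizing_factor hS
    (M := M) (by ext i j; simp [hM i j]) (σ := σ) (fun v => by rw [hSv]; exact hσ v)
  have hmap := map_eq_map_pi_gaussianReal hY hmean (T := T) (fun i j => by rw [hT]; rfl)
  -- The mean of the form is tr(MS) = tr(TᵀMT) = ∑ d_i, so that centring replaces w_i² by w_i² - 1.
  have htr : ∑ i, ∑ j, M i j * ∫ ω', Y ω' i * Y ω' j ∂P = ∑ i, d i := by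
    have h1 : ∑ i, d i = (Tᵀ * M * T).trace := by rw [hd, trace_diagonal]
    rw [h1, Matrix.mul_assoc, trace_mul_comm, Matrix.mul_assoc, hT]
    simp only [trace, mul_apply, diag_apply]
    refine Finset.sum_congr rfl fun i _ => Finset.sum_congr rfl fun j _ => ?_
    simp [hSdef, mul_comm]
  have hquad : ∀ w : ι → ℝ, ∑ i, ∑ j, M i j * ((T *ᵥ w) i * (T *ᵥ w) j) = ∑ i, d i * w i ^ 2 := by
    intro w
    have h1 : ∑ i, ∑ j, M i j * ((T *ᵥ w) i * (T *ᵥ w) j) = (T *ᵥ w) ⬝ᵥ (M *ᵥ (T *ᵥ w)) := by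
      simp only [dotProduct]
      refine Finset.sum_congr rfl fun i _ => ?_
      rw [mulVec.eq_1 M, dotProduct, Finset.mul_sum]
      exact Finset.sum_congr rfl fun j _ => by ring
    rw [h1, mulVec_mulVec, dotProduct_mulVec, ← mulVec_transpose, mulVec_mulVec,
      transpose_mul, ← dotProduct_comm]
    have h2 : Mᵀ = M := by ext i j; simp [hM i j]
    rw [h2, hd]
    simp [dotProduct, mulVec_diagonal]
    exact Finset.sum_congr rfl fun i _ => by ring
  set A : Set (ι → ℝ) := {y | η ≤ |∑ i, ∑ j, M i j * (y i * y j - ∫ ω', Y ω' i * Y ω' j ∂P)|}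
  have hA : MeasurableSet A := by
    refine measurableSet_le measurable_const ?_
    fun_prop
  have h1 : P.real {ω | η ≤ |∑ i, ∑ j, M i j * (Y ω i * Y ω j - ∫ ω', Y ω' i * Y ω' j ∂P)|}
      = (P.map Y).real A := by
    rw [measureReal_def, measureReal_def, Measure.map_apply_of_aemeasurable hY.aemeasurable hA]
    rfl
  have hmT : Measurable fun w : ι → ℝ => T *ᵥ w := by
    refine measurable_pi_lambda _ fun i => ?_
    simp only [mulVec, dotProduct]
    fun_prop
  rw [h1, hmap, measureReal_def, Measure.map_apply hmT hA, ← measureReal_def]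
  have h2 : (fun w : ι → ℝ => T *ᵥ w) ⁻¹' A = {w | η ≤ |∑ i, d i * (w i ^ 2 - 1)|} := by
    ext w
    simp only [A, mem_preimage, mem_ofPred_eq]
    have : ∑ i, ∑ j, M i j * ((T *ᵥ w) i * (T *ᵥ w) j - ∫ ω', Y ω' i * Y ω' j ∂P)
        = ∑ i, d i * (w i ^ 2 - 1) := by
      simp_rw [mul_sub, Finset.sum_sub_distrib]
      rw [hquad, htr]
      simp
    rw [this]
  rw [h2]
  refine measureReal_abs_sum_sq_sub_one_ge_le d (by positivity) (hd2.trans ?_) η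
  calc σ ^ 4 * ∑ i, ∑ j, M i j ^ 2 ≤ σ ^ 4 * R ^ 2 := by gcongr
    _ = _ := by ring

end Gaussian

end EmpSpectral

end

noncomputable section

namespace EmpSpectral

/-! ### Second moments of locally stationary processes -/

theorem ell_pos (κ : ℝ) (j : ℤ) : 0 < ell κ j := by
  unfold ell
  split_ifs with h
  · exact one_pos
  · have h1 : (1 : ℝ) < |(j : ℝ)| := by exact_mod_cast not_le.1 h
    have := Real.log_pos h1
    positivity

theorem summable_inv_mul_log_rpow {κ : ℝ} (hκ : 0 < κ) :
    Summable fun n : ℕ => 1 / ((n : ℝ) * Real.log n ^ (1 + κ)) := by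
  set g : ℕ → ℝ := fun n => 1 / ((n : ℝ) * Real.log n ^ (1 + κ)) with hg
  have hg0 : ∀ n, 0 ≤ g n := fun n => by
    have := Real.log_natCast_nonneg n
    positivity
  have hpos : ∀ n : ℕ, 2 ≤ n → 0 < (n : ℝ) * Real.log n ^ (1 + κ) := fun n hn => by
    have h1 : (1 : ℝ) < n := by exact_mod_cast hn
    have := Real.log_pos h1
    positivity
  -- Cauchy condensation needs a monotone sequence. At n = 0 and n = 1 the quotient is 1 / 0 = 0, so
  -- `g` decreases only from 2 on; replacing n by `max n 2` repairs this and changes two terms only.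
  have hmono : ∀ ⦃m n : ℕ⦄, 0 < m → m ≤ n → g (max n 2) ≤ g (max m 2) := by
    intro m n _ hmn
    have h2 : (2 : ℕ) ≤ max m 2 := le_max_right _ _
    have h3 : ((max m 2 : ℕ) : ℝ) ≤ ((max n 2 : ℕ) : ℝ) := by
      exact_mod_cast max_le_max_right 2 hmn
    have h4 : (1 : ℝ) ≤ ((max m 2 : ℕ) : ℝ) := by exact_mod_cast (by omega : 1 ≤ max m 2)
    have h5 := Real.log_nonneg h4
    refine one_div_le_one_div_of_le (hpos _ h2) ?_
    gcongr
  have hcond := (summable_condensed_iff_of_nonneg (f := fun n => g (max n 2))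
    (fun n => hg0 _) hmono).1 ?_
  · refine hcond.congr_cofinite ?_
    filter_upwards [(Finset.finite_toSet (Finset.range 2)).compl_mem_cofinite] with n hn
    have : 2 ≤ n := by simpa using hn
    simp [max_eq_left this, hg]
  · have hp : Summable fun k : ℕ => (Real.log 2 ^ (1 + κ))⁻¹ * (1 / (k : ℝ) ^ (1 + κ)) :=
      (Real.summable_one_div_nat_rpow.2 (by linarith)).mul_left _
    refine hp.congr_cofinite ?_
    filter_upwards [(Finset.finite_toSet (Finset.range 1)).compl_mem_cofinite] with k hk
    have hk1 : 1 ≤ k := by simpa [Nat.one_le_iff_ne_zero] using hk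
    have h2k : 2 ≤ 2 ^ k := by simpa using Nat.pow_le_pow_right (n := 2) (by norm_num) hk1
    simp only [max_eq_left h2k, hg]
    push_cast
    rw [Real.log_pow, Real.mul_rpow (by positivity) (Real.log_nonneg (by norm_num))]
    have : Real.log 2 ≠ 0 := (Real.log_pos (by norm_num)).ne'
    field_simp

theorem summable_one_div_ell {κ : ℝ} (hκ : 0 < κ) : Summable fun j : ℤ => 1 / ell κ j := by
  have key : ∀ f : ℕ → ℤ, (∀ n, |f n| = n) → Summable fun n : ℕ => 1 / ell κ (f n) := by
    intro f hf
    refine (summable_inv_mul_log_rpow hκ).congr_cofinite ?_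
    filter_upwards [(Finset.finite_toSet (Finset.range 2)).compl_mem_cofinite] with n hn
    have h2 : 2 ≤ n := by simpa using hn
    have h3 : |((f n : ℤ) : ℝ)| = n := by exact_mod_cast congrArg (fun z : ℤ => (z : ℝ)) (hf n)
    rw [ell, if_neg (by rw [hf]; omega), h3]
  exact Summable.of_nat_of_neg (key (fun n => n) fun n => by simp)
    (key (fun n => -n) fun n => by simp)

/-- The sum of the weights `1 / ℓ(j)`. -/
def ellSum (κ : ℝ) : ℝ := ∑' j : ℤ, 1 / ell κ j

theorem ellSum_pos {κ : ℝ} (hκ : 0 < κ) : 0 < ellSum κ :=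
  (summable_one_div_ell hκ).tsum_pos (fun j => (one_div_pos.2 (ell_pos κ j)).le) 0
    (one_div_pos.2 (ell_pos κ 0))

section Moments

variable {Ω : Type*} [MeasurableSpace Ω] {P : Measure Ω} {κ K : ℝ}
  {X : ℕ → ℤ → Ω → ℝ} {ε : ℤ → Ω → ℝ} {A : ℕ → ℤ → ℤ → ℝ} {a : ℝ → ℤ → ℝ}

theorem IsLocallyStationaryRepr.integral_sq_sum_noise (h : IsLocallyStationaryRepr P κ K X ε A a)
    {ι : Type*} (s : Finset ι) (r : ι → ℤ) (hr : Function.Injective r) (w : ι → ℝ) :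
    ∫ ω, (∑ i ∈ s, w i * ε (r i) ω) ^ 2 ∂P = ∑ i ∈ s, w i ^ 2 := by
  have hi : ∀ i j, Integrable (fun ω => w i * w j * (ε (r i) ω * ε (r j) ω)) P := fun i j =>
    ((h.memLp_noise _).integrable_mul (h.memLp_noise _)).const_mul _
  have h1 : ∀ ω, (∑ i ∈ s, w i * ε (r i) ω) ^ 2
      = ∑ i ∈ s, ∑ j ∈ s, w i * w j * (ε (r i) ω * ε (r j) ω) := by
    intro ω
    rw [sq, Finset.sum_mul_sum]
    exact Finset.sum_congr rfl fun i _ => Finset.sum_congr rfl fun j _ => by ring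
  simp_rw [h1]
  rw [integral_finsetSum _ fun i _ => integrable_finsetSum _ fun j _ => hi i j]
  refine Finset.sum_congr rfl fun i his => ?_
  rw [integral_finsetSum _ fun j _ => hi i j, Finset.sum_eq_single_of_mem i his]
  · rw [integral_const_mul]
    simp_rw [← sq]
    rw [h.variance_noise, mul_one]
  · intro j _ hji
    rw [integral_const_mul, h.uncorrelated_noise _ _ fun e => hji (hr e).symm, mul_zero]

/-- The sum is grouped by the lag j. For fixed j the variables ε_{t-j} are orthonormal in t, which
gives a second moment of at most (K/ℓ(j))² |v|². Cauchy-Schwarz over j with weights 1/ℓ(j) and ℓ(j)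
then produces two factors ∑ 1/ℓ. -/
theorem IsLocallyStationaryRepr.integral_sq_partial_sum_le
    (h : IsLocallyStationaryRepr P κ K X ε A a) (hκ : 0 < κ) (n : ℕ)
    (v : Finset.Icc (1 : ℤ) n → ℝ) (s : Finset ℤ) :
    Integrable (fun ω => (∑ t, v t * ∑ j ∈ s, A n t j * ε (t - j) ω) ^ 2) P ∧
    ∫ ω, (∑ t, v t * ∑ j ∈ s, A n t j * ε (t - j) ω) ^ 2 ∂P
      ≤ (K * ellSum κ) ^ 2 * ∑ t, v t ^ 2 := by
  have hmem : MemLp (fun ω => ∑ t, v t * ∑ j ∈ s, A n t j * ε (t - j) ω) 2 P :=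
    memLp_finsetSum _ fun t _ => (memLp_finsetSum _ fun j _ =>
      (h.memLp_noise _).const_mul _).const_mul _
  refine ⟨hmem.integrable_sq, ?_⟩
  set S := ellSum κ
  have hS : ∑ j ∈ s, 1 / ell κ j ≤ S :=
    (summable_one_div_ell hκ).sum_le_tsum _ fun j _ => (one_div_pos.2 (ell_pos κ j)).le
  set D : ℤ → Ω → ℝ := fun j ω => ∑ t, (v t * A n t j) * ε (t - j) ω with hD
  have hDmem : ∀ j, MemLp (D j) 2 P := fun j =>
    memLp_finsetSum _ fun t _ => (h.memLp_noise _).const_mul _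
  have hpt : ∀ ω, (∑ t, v t * ∑ j ∈ s, A n t j * ε (t - j) ω) ^ 2
      ≤ S * ∑ j ∈ s, ell κ j * D j ω ^ 2 := by
    intro ω
    have h1 : ∑ t, v t * ∑ j ∈ s, A n t j * ε (t - j) ω = ∑ j ∈ s, D j ω := by
      simp_rw [Finset.mul_sum, hD]
      rw [Finset.sum_comm]
      simp_rw [mul_assoc]
    rw [h1]
    refine (Finset.sum_sq_le_sum_mul_sum_of_sq_le_mul s (f := fun j => 1 / ell κ j)
      (g := fun j => ell κ j * D j ω ^ 2) (fun j _ => (one_div_pos.2 (ell_pos κ j)).le)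
      (fun j _ => mul_nonneg (ell_pos κ j).le (sq_nonneg _)) fun j _ => ?_).trans ?_
    · have := (ell_pos κ j).ne'
      refine le_of_eq ?_
      field_simp
    · refine mul_le_mul_of_nonneg_right hS ?_
      exact Finset.sum_nonneg fun j _ => mul_nonneg (ell_pos κ j).le (sq_nonneg _)
  have hint : ∀ j, Integrable (fun ω => ell κ j * D j ω ^ 2) P := fun j =>
    (hDmem j).integrable_sq.const_mul _
  refine (integral_mono hmem.integrable_sq
    ((integrable_finsetSum s fun j _ => hint j).const_mul S) hpt).trans ?_
  rw [integral_const_mul, integral_finsetSum _ fun j _ => hint j]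
  simp_rw [integral_const_mul]
  have hDj : ∀ j, ell κ j * ∫ ω, D j ω ^ 2 ∂P ≤ 1 / ell κ j * (K ^ 2 * ∑ t, v t ^ 2) := by
    intro j
    rw [hD]
    simp only
    rw [h.integral_sq_sum_noise Finset.univ
      (fun t : Finset.Icc (1 : ℤ) n => (t : ℤ) - j) (fun x y hxy => Subtype.ext (by simpa using hxy))]
    have h1 : ∀ t : Finset.Icc (1 : ℤ) n, (v t * A n t j) ^ 2 ≤ (K / ell κ j) ^ 2 * v t ^ 2 := by
      intro t
      have ht := Finset.mem_Icc.1 t.2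
      rw [mul_pow, mul_comm]
      refine mul_le_mul_of_nonneg_right ?_ (sq_nonneg _)
      exact sq_le_sq' (by linarith [abs_le.1 (h.coeff_bound n t j ht.1 ht.2)])
        (abs_le.1 (h.coeff_bound n t j ht.1 ht.2)).2
    have h2 : ∑ t, (v t * A n t j) ^ 2 ≤ (K / ell κ j) ^ 2 * ∑ t, v t ^ 2 := by
      rw [Finset.mul_sum]
      exact Finset.sum_le_sum fun t _ => h1 t
    have hp := ell_pos κ j
    calc _ ≤ ell κ j * ((K / ell κ j) ^ 2 * ∑ t, v t ^ 2) := by gcongr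
      _ = _ := by field_simp
  have hSpos := ellSum_pos hκ
  calc S * ∑ j ∈ s, ell κ j * ∫ ω, D j ω ^ 2 ∂P
      ≤ S * ∑ j ∈ s, 1 / ell κ j * (K ^ 2 * ∑ t, v t ^ 2) := by
        exact mul_le_mul_of_nonneg_left (Finset.sum_le_sum fun j _ => hDj j) hSpos.le
    _ = S * ((∑ j ∈ s, 1 / ell κ j) * (K ^ 2 * ∑ t, v t ^ 2)) := by rw [← Finset.sum_mul]
    _ ≤ S * (S * (K ^ 2 * ∑ t, v t ^ 2)) := by gcongr
    _ = _ := by ring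

/-- This bounds the operator norm of the covariance matrix of a row. The series converges only
almost surely by definition, so the bound passes from the partial sums to the limit by Fatou's
lemma. -/
theorem IsGaussianLocallyStationary.integral_sq_sum_le
    (h : IsGaussianLocallyStationary P κ K X) (hκ : 0 < κ) (n : ℕ)
    (v : Finset.Icc (1 : ℤ) n → ℝ) :
    ∫ ω, (∑ t, v t * X n t ω) ^ 2 ∂P ≤ (K * ellSum κ) ^ 2 * ∑ t, v t ^ 2 := by
  obtain ⟨ε, A, a, hr⟩ := h.exists_repr
  set F : ℕ → Ω → ℝ := fun N ω =>
    ∑ t, v t * ∑ j ∈ Finset.Icc (-(N : ℤ)) N, A n t j * ε (t - j) ω with hF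
  have hFm : ∀ N, Measurable (F N) := fun N => by
    have := hr.measurable_noise
    fun_prop
  have hC : 0 ≤ (K * ellSum κ) ^ 2 * ∑ t, v t ^ 2 :=
    mul_nonneg (sq_nonneg _) (Finset.sum_nonneg fun t _ => sq_nonneg _)
  have hlim : ∀ᵐ ω ∂P, Tendsto (fun N => ENNReal.ofReal (F N ω ^ 2)) atTop
      (𝓝 (ENNReal.ofReal ((∑ t, v t * X n t ω) ^ 2))) := by
    have h1 : ∀ᵐ ω ∂P, ∀ t : Finset.Icc (1 : ℤ) n,
        HasSum (fun j : ℤ => A n t j * ε (t - j) ω) (X n t ω) := by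
      rw [ae_all_iff]
      intro t
      have ht := Finset.mem_Icc.1 t.2
      exact hr.series n t ht.1 ht.2
    filter_upwards [h1] with ω hω
    refine ENNReal.tendsto_ofReal (Tendsto.pow ?_ 2)
    refine tendsto_finsetSum _ fun t _ => Tendsto.const_mul _ ?_
    exact (hω t).comp Finset.tendsto_Icc_neg
  have hle : ∫⁻ ω, ENNReal.ofReal ((∑ t, v t * X n t ω) ^ 2) ∂P
      ≤ ENNReal.ofReal ((K * ellSum κ) ^ 2 * ∑ t, v t ^ 2) := by
    calc _ = ∫⁻ ω, liminf (fun N => ENNReal.ofReal (F N ω ^ 2)) atTop ∂P :=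
          lintegral_congr_ae (hlim.mono fun ω hω => hω.liminf_eq.symm)
      _ ≤ liminf (fun N => ∫⁻ ω, ENNReal.ofReal (F N ω ^ 2) ∂P) atTop :=
          lintegral_liminf_le fun N => by have := hFm N; fun_prop
      _ ≤ _ := by
          refine liminf_le_of_frequently_le' (Eventually.of_forall fun N => ?_).frequently
          obtain ⟨hi, hb⟩ := hr.integral_sq_partial_sum_le hκ n v (Finset.Icc (-(N : ℤ)) N)
          rw [← ofReal_integral_eq_lintegral_ofReal hi (ae_of_all _ fun ω => sq_nonneg _)]
          exact ENNReal.ofReal_le_ofReal hb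
  have hXm : Measurable fun ω => (∑ t : Finset.Icc (1 : ℤ) n, v t * X n t ω) ^ 2 := by
    have := h.measurable n
    fun_prop
  rw [integral_eq_lintegral_of_nonneg_ae (ae_of_all _ fun ω => sq_nonneg _)
    hXm.aestronglyMeasurable]
  exact ENNReal.toReal_le_of_le_ofReal hC hle

/-- The noise is identically distributed, so E|ε_s| does not depend on s and the series of
E|a_{t,n}(j) ε_{t-j}| is dominated by ∑ 1/ℓ(j). Hence expectation and series may be interchanged. -/
theorem IsGaussianLocallyStationary.integral_eq_zero
    (h : IsGaussianLocallyStationary P κ K X) (hκ : 0 < κ) {n : ℕ} {t : ℤ}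
    (h1 : 1 ≤ t) (hn : t ≤ n) : ∫ ω, X n t ω ∂P = 0 := by
  have := (h.gaussian n).isProbabilityMeasure
  obtain ⟨ε, A, a, hr⟩ := h.exists_repr
  have hint : ∀ s, Integrable (ε s) P := fun s => (hr.memLp_noise s).integrable (by norm_num)
  have hnorm : ∀ s, ∫ ω, ‖ε s ω‖ ∂P = ∫ ω, ‖ε 0 ω‖ ∂P := fun s =>
    ((hr.identDistrib_noise s 0).norm).integral_eq
  have hsum : Summable fun j : ℤ => ∫ ω, ‖A n t j * ε (t - j) ω‖ ∂P := by
    refine Summable.of_nonneg_of_le (fun j => integral_nonneg fun ω => norm_nonneg _) (fun j => ?_)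
      ((summable_one_div_ell hκ).mul_left (K * ∫ ω, ‖ε 0 ω‖ ∂P))
    simp_rw [norm_mul]
    rw [integral_const_mul, hnorm]
    have h2 := hr.coeff_bound n t j h1 hn
    calc ‖A n t j‖ * ∫ ω, ‖ε 0 ω‖ ∂P ≤ K / ell κ j * ∫ ω, ‖ε 0 ω‖ ∂P :=
          mul_le_mul_of_nonneg_right h2 (integral_nonneg fun ω => norm_nonneg _)
      _ = _ := by ring
  have h3 := hasSum_integral_of_summable_integral_norm (fun j => (hint (t - j)).const_mul (A n t j))
    hsum
  simp_rw [integral_const_mul, hr.mean_noise, mul_zero] at h3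
  have h4 : ∫ ω, X n t ω ∂P = ∫ ω, ∑' j : ℤ, A n t j * ε (t - j) ω ∂P :=
    integral_congr_ae ((hr.series n t h1 hn).mono fun ω hω => hω.tsum_eq.symm)
  rw [h4]
  exact h3.unique hasSum_zero

theorem IsGaussianLocallyStationary.hasGaussianLaw_apply
    (h : IsGaussianLocallyStationary P κ K X) {n : ℕ} {t : ℤ}
    (h1 : 1 ≤ t) (hn : t ≤ n) : HasGaussianLaw (X n t) P :=
  (h.gaussian n).eval (⟨t, Finset.mem_Icc.2 ⟨h1, hn⟩⟩ : Finset.Icc (1 : ℤ) n)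

theorem IsGaussianLocallyStationary.memLp
    (h : IsGaussianLocallyStationary P κ K X) {n : ℕ} {t : ℤ}
    (h1 : 1 ≤ t) (hn : t ≤ n) : MemLp (X n t) 2 P :=
  (h.hasGaussianLaw_apply h1 hn).memLp_two

theorem IsGaussianLocallyStationary.integral_sq_le
    (h : IsGaussianLocallyStationary P κ K X) (hκ : 0 < κ) {n : ℕ} {t : ℤ}
    (h1 : 1 ≤ t) (hn : t ≤ n) : ∫ ω, X n t ω ^ 2 ∂P ≤ (K * ellSum κ) ^ 2 := by
  have := h.integral_sq_sum_le hκ n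
    (Pi.single (⟨t, Finset.mem_Icc.2 ⟨h1, hn⟩⟩ : Finset.Icc (1 : ℤ) n) 1)
  simpa [Pi.single_apply] using this

theorem IsGaussianLocallyStationary.abs_integral_mul_le
    (h : IsGaussianLocallyStationary P κ K X) (hκ : 0 < κ) {n : ℕ} {s t : ℤ}
    (hs1 : 1 ≤ s) (hsn : s ≤ n) (h1 : 1 ≤ t) (hn : t ≤ n) :
    |∫ ω, X n s ω * X n t ω ∂P| ≤ (K * ellSum κ) ^ 2 := by
  have hi := (h.memLp hs1 hsn).integrable_sq
  have hj := (h.memLp h1 hn).integrable_sq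
  calc |∫ ω, X n s ω * X n t ω ∂P| ≤ ∫ ω, |X n s ω * X n t ω| ∂P := abs_integral_le_integral_abs
    _ ≤ ∫ ω, (1 / 2 * X n s ω ^ 2 + 1 / 2 * X n t ω ^ 2) ∂P := by
        refine integral_mono ((h.memLp hs1 hsn).integrable_mul (h.memLp h1 hn)).abs
          ((hi.const_mul _).add (hj.const_mul _)) fun ω => ?_
        simp only [abs_mul]
        nlinarith [sq_nonneg (|X n s ω| - |X n t ω|), sq_abs (X n s ω), sq_abs (X n t ω)]
    _ = 1 / 2 * ∫ ω, X n s ω ^ 2 ∂P + 1 / 2 * ∫ ω, X n t ω ^ 2 ∂P := by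
        rw [integral_add (hi.const_mul _) (hj.const_mul _), integral_const_mul, integral_const_mul]
    _ ≤ _ := by linarith [h.integral_sq_le hκ hs1 hsn, h.integral_sq_le hκ h1 hn]

/-- Gaussian tail bound for a single coordinate. -/
theorem IsGaussianLocallyStationary.measureReal_abs_ge_le
    (h : IsGaussianLocallyStationary P κ K X) (hκ : 0 < κ) (hK : 0 < K) {n : ℕ} {t : ℤ}
    (h1 : 1 ≤ t) (hn : t ≤ n) {x : ℝ} (hx : 0 ≤ x) :
    P.real {ω | x ≤ |X n t ω|} ≤ 2 * Real.exp (-(x ^ 2 / (2 * (K * ellSum κ) ^ 2))) := by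
  have hG := h.hasGaussianLaw_apply h1 hn
  have := hG.isProbabilityMeasure
  have hσ : 0 < K * ellSum κ := mul_pos hK (ellSum_pos hκ)
  set σ := K * ellSum κ
  have hmap := hG.map_eq_gaussianReal
  rw [h.integral_eq_zero hκ h1 hn] at hmap
  have hvar : Var[X n t; P] ≤ σ ^ 2 := by
    rw [variance_eq_integral (h.measurable n t).aemeasurable, h.integral_eq_zero hκ h1 hn]
    simpa using h.integral_sq_le hκ h1 hn
  have hmgf : ∀ s : ℝ, mgf (X n t) P s ≤ Real.exp (σ ^ 2 * s ^ 2 / 2) := by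
    intro s
    rw [mgf_gaussianReal hmap, Real.exp_le_exp, Real.coe_toNNReal _ (variance_nonneg _ _)]
    have := mul_le_mul_of_nonneg_right hvar (sq_nonneg s)
    linarith
  have hint : ∀ s : ℝ, Integrable (fun ω => Real.exp (s * X n t ω)) P := by
    intro s
    by_contra hni
    have h2 := mgf_gaussianReal hmap s
    rw [mgf, integral_undef hni] at h2
    exact (Real.exp_pos _).ne h2
  set s : ℝ := x / σ ^ 2
  have hs : 0 ≤ s := by positivity
  have hval : -s * x + σ ^ 2 * s ^ 2 / 2 = -(x ^ 2 / (2 * σ ^ 2)) := by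
    simp only [s]; field_simp; ring
  have hup : P.real {ω | x ≤ X n t ω} ≤ Real.exp (-(x ^ 2 / (2 * σ ^ 2))) := by
    refine (measure_ge_le_exp_mul_mgf x hs (hint s)).trans ?_
    rw [← hval, Real.exp_add]
    gcongr
    exact hmgf s
  have hlow : P.real {ω | X n t ω ≤ -x} ≤ Real.exp (-(x ^ 2 / (2 * σ ^ 2))) := by
    refine (measure_le_le_exp_mul_mgf (-x) (neg_nonpos.2 hs) (hint (-s))).trans ?_
    rw [← hval, Real.exp_add]
    have := hmgf (-s)
    rw [neg_sq] at this
    rw [neg_neg, mul_neg, ← neg_mul]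
    gcongr
  have hsub : {ω | x ≤ |X n t ω|} ⊆ {ω | x ≤ X n t ω} ∪ {ω | X n t ω ≤ -x} := by
    intro ω hω
    rcases le_abs.1 (show x ≤ |X n t ω| from hω) with h | h
    · exact Or.inl h
    · exact Or.inr (show X n t ω ≤ -x by linarith)
  have := (measureReal_mono (μ := P) hsub).trans (measureReal_union_le _ _)
  linarith

end Moments

end EmpSpectral

end

noncomputable section

namespace EmpSpectral

/-! ### Fourier analysis on `[-π, π]` -/

theorem neg_pi_lt_pi : -Real.pi < Real.pi := by linarith [Real.pi_pos]

theorem norm_exp_I_mul_intCast (x : ℝ) (j : ℤ) : ‖Complex.exp (Complex.I * x * j)‖ = 1 := by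
  have : Complex.I * x * j = ((x * j : ℝ) : ℂ) * Complex.I := by push_cast; ring
  rw [this, Complex.norm_exp_ofReal_mul_I]

theorem integral_exp_I_mul_intCast (m : ℤ) :
    ∫ x in (-Real.pi)..Real.pi, Complex.exp (Complex.I * x * m)
      = if m = 0 then (2 * Real.pi : ℂ) else 0 := by
  split_ifs with h
  · subst h
    simp
    ring
  · have hc : Complex.I * (m : ℂ) ≠ 0 := mul_ne_zero Complex.I_ne_zero (by exact_mod_cast h)
    have h1 : ∀ x : ℝ, Complex.exp (Complex.I * x * m) = Complex.exp (Complex.I * m * x) :=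
      fun x => by ring_nf
    simp_rw [h1]
    rw [integral_exp_mul_complex hc]
    have h2 : Complex.exp (Complex.I * m * (Real.pi : ℂ))
        = Complex.exp (Complex.I * m * ((-Real.pi : ℝ) : ℂ)) := by
      rw [Complex.exp_eq_exp_iff_exists_int]
      exact ⟨m, by push_cast; ring⟩
    rw [h2, sub_self, zero_div]

theorem hasSum_sq_norm_integral_exp {f : ℝ → ℂ}
    (hf : MemLp f 2 (volume.restrict (Ioc (-Real.pi) Real.pi))) :
    HasSum (fun j : ℤ => ‖∫ x in (-Real.pi)..Real.pi, f x * Complex.exp (Complex.I * x * j)‖ ^ 2)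
      (2 * Real.pi * ∫ x in (-Real.pi)..Real.pi, ‖f x‖ ^ 2) := by
  have h1 := (hasSum_sq_fourierCoeffOn neg_pi_lt_pi hf).mul_left ((2 * Real.pi) ^ 2)
  have h2 : (2 * Real.pi) ^ 2 * ((Real.pi - -Real.pi)⁻¹ • ∫ x in (-Real.pi)..Real.pi, ‖f x‖ ^ 2)
      = 2 * Real.pi * ∫ x in (-Real.pi)..Real.pi, ‖f x‖ ^ 2 := by
    rw [smul_eq_mul, sub_neg_eq_add, ← two_mul]
    have := Real.pi_ne_zero
    field_simp
  rw [h2] at h1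
  have h3 : ∀ j : ℤ, (2 * Real.pi) ^ 2 * ‖fourierCoeffOn neg_pi_lt_pi f (-j)‖ ^ 2
      = ‖∫ x in (-Real.pi)..Real.pi, f x * Complex.exp (Complex.I * x * j)‖ ^ 2 := by
    intro j
    rw [fourierCoeffOn_eq_integral, norm_smul, mul_pow ‖_‖, ← mul_assoc]
    have h4 : (2 * Real.pi) ^ 2 * ‖1 / (Real.pi - -Real.pi)‖ ^ 2 = 1 := by
      rw [sub_neg_eq_add, ← two_mul, Real.norm_eq_abs, sq_abs]
      have := Real.pi_ne_zero
      field_simp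
    rw [h4, one_mul]
    congr 3
    ext x
    rw [neg_neg, fourier_coe_apply, smul_eq_mul, mul_comm]
    congr 2
    have : (Real.pi : ℂ) ≠ 0 := by exact_mod_cast Real.pi_ne_zero
    push_cast
    rw [sub_neg_eq_add, ← two_mul]
    field_simp
  have h5 := (Equiv.neg ℤ).hasSum_iff.2 h1
  have h6 := funext h3
  rw [← h6]
  exact h5

theorem intervalIntegrable_mul_exp {f : ℝ → ℂ}
    (hf : IntervalIntegrable f volume (-Real.pi) Real.pi) (j : ℤ) :
    IntervalIntegrable (fun x => f x * Complex.exp (Complex.I * x * j)) volume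
      (-Real.pi) Real.pi :=
  hf.mul_continuousOn (by fun_prop)

/-- An integrable function on `[-π, π]` with vanishing Fourier coefficients vanishes. -/
theorem ae_eq_zero_of_integral_exp_eq_zero {h : ℝ → ℂ}
    (hint : IntervalIntegrable h volume (-Real.pi) Real.pi)
    (h0 : ∀ j : ℤ, ∫ x in (-Real.pi)..Real.pi, h x * Complex.exp (Complex.I * x * j) = 0) :
    ∀ᵐ x, x ∈ Ioo (-Real.pi) Real.pi → h x = 0 := by
  have hT : Fact (0 < 2 * Real.pi) := ⟨by positivity⟩
  have hcont : ∀ p : C(AddCircle (2 * Real.pi), ℂ), Continuous fun x : ℝ => p (x : AddCircle _) :=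
    fun p => p.continuous.comp (AddCircle.continuous_mk' _)
  have hi : ∀ p : C(AddCircle (2 * Real.pi), ℂ),
      IntervalIntegrable (fun x : ℝ => h x * p (x : AddCircle _)) volume (-Real.pi) Real.pi :=
    fun p => hint.mul_continuousOn (hcont p).continuousOn
  have hspan : ∀ p ∈ Submodule.span ℂ (range (@fourier (2 * Real.pi))),
      ∫ x in (-Real.pi)..Real.pi, h x * p (x : AddCircle _) = 0 := by
    intro p hp
    induction hp using Submodule.span_induction with
    | mem p hp =>
      obtain ⟨j, rfl⟩ := hp
      rw [← h0 j]
      congr 1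
      ext x
      rw [fourier_coe_apply]
      congr 2
      have : (Real.pi : ℂ) ≠ 0 := by exact_mod_cast Real.pi_ne_zero
      push_cast
      field_simp
    | zero => simp
    | add p q _ _ h1 h2 =>
      simp only [ContinuousMap.add_apply, mul_add]
      rw [intervalIntegral.integral_add (hi p) (hi q), h1, h2, add_zero]
    | smul c p _ h1 =>
      simp only [ContinuousMap.smul_apply, smul_eq_mul, mul_left_comm _ c]
      rw [intervalIntegral.integral_const_mul, h1, mul_zero]
  -- Trigonometric polynomials are uniformly dense in the continuous functions on the circle, so h
  -- annihilates every continuous periodic function.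
  have hall : ∀ p : C(AddCircle (2 * Real.pi), ℂ),
      ∫ x in (-Real.pi)..Real.pi, h x * p (x : AddCircle _) = 0 := by
    intro p
    have hp : p ∈ closure (Submodule.span ℂ (range (@fourier (2 * Real.pi))) :
        Set C(AddCircle (2 * Real.pi), ℂ)) := by
      rw [← Submodule.topologicalClosure_coe, span_fourier_closure_eq_top]
      trivial
    rw [← norm_eq_zero]
    refine le_antisymm (le_of_forall_pos_le_add fun δ hδ => ?_) (norm_nonneg _)
    set I := ∫ x in (-Real.pi)..Real.pi, ‖h x‖
    have hI : 0 ≤ I := intervalIntegral.integral_nonneg neg_pi_lt_pi.le fun x _ => norm_nonneg _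
    obtain ⟨q, hq, hpq⟩ := Metric.mem_closure_iff.1 hp (δ / (I + 1)) (by positivity)
    have h1 : ∫ x in (-Real.pi)..Real.pi, h x * p (x : AddCircle _)
        = ∫ x in (-Real.pi)..Real.pi, h x * (p - q) (x : AddCircle _) := by
      simp only [ContinuousMap.sub_apply, mul_sub]
      rw [intervalIntegral.integral_sub (hi p) (hi q), hspan q hq, sub_zero]
    rw [h1, zero_add]
    calc _ ≤ ∫ x in (-Real.pi)..Real.pi, ‖h x * (p - q) (x : AddCircle _)‖ :=
          intervalIntegral.norm_integral_le_integral_norm neg_pi_lt_pi.le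
      _ ≤ ∫ x in (-Real.pi)..Real.pi, ‖h x‖ * (δ / (I + 1)) := by
          refine intervalIntegral.integral_mono_on neg_pi_lt_pi.le (hi (p - q)).norm
            (hint.norm.mul_const _) fun x _ => ?_
          rw [norm_mul]
          refine mul_le_mul_of_nonneg_left ?_ (norm_nonneg _)
          refine ((p - q).norm_coe_le_norm _).trans ?_
          rw [← dist_eq_norm]
          exact hpq.le
      _ = I * (δ / (I + 1)) := by rw [intervalIntegral.integral_mul_const]
      _ ≤ δ := by
          rw [mul_div_assoc', div_le_iff₀ (by positivity)]
          nlinarith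
  -- A test function supported in the open interval vanishes at both endpoints, and so descends to a
  -- continuous function on the circle.
  refine isOpen_Ioo.ae_eq_zero_of_integral_contDiff_smul_eq_zero ?_ ?_
  · have := (intervalIntegrable_iff_integrableOn_Ioo_of_le neg_pi_lt_pi.le).1 hint
    exact this.locallyIntegrableOn
  · intro g hg _ hsupp
    have hgz : ∀ x, x ∉ Ioo (-Real.pi) Real.pi → g x = 0 := fun x hx =>
      image_eq_zero_of_notMem_tsupport fun hx' => hx (hsupp hx')
    have hend : -Real.pi + 2 * Real.pi = Real.pi := by ring
    set p : C(AddCircle (2 * Real.pi), ℂ) :=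
      ⟨AddCircle.liftIoc (2 * Real.pi) (-Real.pi) fun x => (g x : ℂ),
        AddCircle.liftIoc_continuous (by
          rw [hend, hgz _ (fun h => lt_irrefl _ h.1), hgz _ (fun h => lt_irrefl _ h.2)])
          (Complex.continuous_ofReal.comp hg.continuous).continuousOn⟩ with hp
    rw [← hall p, intervalIntegral.integral_of_le neg_pi_lt_pi.le,
      ← setIntegral_eq_integral_of_forall_compl_eq_zero (s := Ioc (-Real.pi) Real.pi)]
    · refine setIntegral_congr_fun measurableSet_Ioc fun x hx => ?_
      have : p (x : AddCircle (2 * Real.pi)) = g x :=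
        AddCircle.liftIoc_coe_apply (f := fun x => (g x : ℂ)) (by rwa [hend])
      simp only [this, Complex.real_smul]
      ring
    · intro x hx
      rw [hgz x fun h => hx (Ioo_subset_Ioc_self h), zero_smul]

/-- An integrable function on `[-π, π]` with absolutely summable Fourier coefficients is square
integrable. -/
theorem memLp_two_of_summable_integral_exp {f : ℝ → ℂ}
    (hf : IntervalIntegrable f volume (-Real.pi) Real.pi)
    (hs : Summable fun j : ℤ =>
      ‖∫ x in (-Real.pi)..Real.pi, f x * Complex.exp (Complex.I * x * j)‖) :
    MemLp f 2 (volume.restrict (Ioc (-Real.pi) Real.pi)) := by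
  set c : ℤ → ℂ := fun j => ∫ x in (-Real.pi)..Real.pi, f x * Complex.exp (Complex.I * x * j)
    with hc
  set F : ℤ → ℝ → ℂ := fun j x => (2 * Real.pi : ℂ)⁻¹ * c j * Complex.exp (-(Complex.I * x * j))
    with hF
  have hexp : ∀ (x : ℝ) (j : ℤ), ‖Complex.exp (-(Complex.I * x * j))‖ = 1 := fun x j => by
    have := norm_exp_I_mul_intCast x (-j)
    rwa [Int.cast_neg, mul_neg] at this
  have hFn : ∀ j x, ‖F j x‖ = (2 * Real.pi)⁻¹ * ‖c j‖ := by
    intro j x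
    rw [hF]
    simp only [norm_mul, hexp, mul_one, norm_inv]
    congr 2
    simp [abs_of_pos Real.pi_pos]
  have hFs : Summable fun j => (2 * Real.pi)⁻¹ * ‖c j‖ := hs.mul_left _
  -- The Fourier series of f converges uniformly to a bounded continuous function with the same
  -- coefficients; by uniqueness f agrees with it almost everywhere and is therefore essentially
  -- bounded.
  set g : ℝ → ℂ := fun x => ∑' j, F j x with hg
  have hgc : Continuous g := continuous_tsum (fun j => by fun_prop) hFs fun j x => (hFn j x).le
  have hgb : ∀ x, ‖g x‖ ≤ ∑' j, (2 * Real.pi)⁻¹ * ‖c j‖ := fun x =>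
    tsum_of_norm_bounded hFs.hasSum fun j => (hFn j x).le
  have hgk : ∀ k : ℤ, ∫ x in (-Real.pi)..Real.pi, g x * Complex.exp (Complex.I * x * k) = c k := by
    intro k
    have h1 : HasSum
        (fun j => ∫ x in (-Real.pi)..Real.pi, F j x * Complex.exp (Complex.I * x * k))
        (∫ x in (-Real.pi)..Real.pi, g x * Complex.exp (Complex.I * x * k)) := by
      refine intervalIntegral.hasSum_integral_of_dominated_convergence
        (fun j _ => (2 * Real.pi)⁻¹ * ‖c j‖) (fun j => ?_) (fun j => ?_) ?_ ?_ ?_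
      · refine Continuous.aestronglyMeasurable ?_
        fun_prop
      · refine ae_of_all _ fun x _ => ?_
        rw [norm_mul, hFn, norm_exp_I_mul_intCast, mul_one]
      · exact ae_of_all _ fun x _ => hFs
      · exact intervalIntegrable_const
      · refine ae_of_all _ fun x _ => HasSum.mul_right _ ?_
        exact (Summable.of_norm (by simpa only [hFn] using hFs)).hasSum
    refine h1.unique ?_
    have h2 : ∀ j, ∫ x in (-Real.pi)..Real.pi, F j x * Complex.exp (Complex.I * x * k)
        = if j = k then c k else 0 := by
      intro j
      have h3 : ∀ x : ℝ, F j x * Complex.exp (Complex.I * x * k)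
          = (2 * Real.pi : ℂ)⁻¹ * c j * Complex.exp (Complex.I * x * ((k - j : ℤ) : ℂ)) := by
        intro x
        rw [hF]
        simp only
        rw [mul_assoc, ← Complex.exp_add]
        congr 2
        push_cast
        ring
      simp_rw [h3]
      rw [intervalIntegral.integral_const_mul, integral_exp_I_mul_intCast]
      by_cases hjk : j = k
      · subst hjk
        have : (Real.pi : ℂ) ≠ 0 := by exact_mod_cast Real.pi_ne_zero
        simp
        field_simp
      · rw [if_neg hjk, if_neg (by omega), mul_zero]
    simp_rw [h2]
    exact hasSum_ite_eq k (c k)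
  have hgi : IntervalIntegrable g volume (-Real.pi) Real.pi := hgc.intervalIntegrable _ _
  have hz := ae_eq_zero_of_integral_exp_eq_zero (hf.sub hgi) (fun j => by
    simp only [sub_mul]
    rw [intervalIntegral.integral_sub (intervalIntegrable_mul_exp hf j)
      (intervalIntegrable_mul_exp hgi j), hgk, sub_self])
  have hfi := (intervalIntegrable_iff_integrableOn_Ioo_of_le neg_pi_lt_pi.le).1 hf
  have hIoo : MemLp f 2 (volume.restrict (Ioo (-Real.pi) Real.pi)) := by
    refine MemLp.of_bound hfi.aestronglyMeasurable (∑' j, (2 * Real.pi)⁻¹ * ‖c j‖) ?_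
    rw [ae_restrict_iff' measurableSet_Ioo]
    filter_upwards [hz] with x hx hxI
    have : f x = g x := sub_eq_zero.1 (hx hxI)
    rw [this]
    exact hgb x
  rwa [restrict_Ioo_eq_restrict_Ioc] at hIoo

theorem fourierCoef_neg (φ : ℝ → ℝ → ℝ) (u : ℝ) (j : ℤ) :
    fourierCoef φ u (-j) = starRingEnd ℂ (fourierCoef φ u j) := by
  rw [fourierCoef, fourierCoef, intervalIntegral.integral_of_le neg_pi_lt_pi.le,
    intervalIntegral.integral_of_le neg_pi_lt_pi.le, ← integral_conj]
  congr 1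
  ext x
  rw [map_mul, ← Complex.exp_conj, Complex.conj_ofReal]
  congr 2
  simp

end EmpSpectral

end

noncomputable section

namespace EmpSpectral

/-! ### The empirical spectral process as a quadratic form -/

/-- The map (t, k) ↦ ([t + 1/2 + k/2], [t + 1/2 - k/2]) is a bijection onto {1, …, n}² with inverse
(i, j) ↦ (⌊(i + j)/2⌋, i - j): the sum of the two indices is 2t or 2t + 1 according to the parity of
k. No product X_i X_j is repeated, hence coefficient arrays and matrices have the same ℓ²-norm. -/
theorem sum_lags {M : Type*} [AddCommMonoid M] (n : ℕ) (f : ℤ → ℤ → M) :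
    ∑ t ∈ Finset.Icc (1 : ℤ) n, ∑ k ∈ lags n t, f t k
      = ∑ i ∈ Finset.Icc (1 : ℤ) n, ∑ j ∈ Finset.Icc (1 : ℤ) n, f ((i + j) / 2) (i - j) := by
  rw [Finset.sum_sigma', Finset.sum_sigma']
  refine Finset.sum_bij' (fun p _ => ⟨idx p.1 p.2, idx p.1 (-p.2)⟩)
    (fun p _ => ⟨(p.1 + p.2) / 2, p.1 - p.2⟩) ?_ ?_ ?_ ?_ ?_
  · rintro ⟨t, k⟩ h
    simp only [Finset.mem_sigma, Finset.mem_Icc, mem_lags] at h ⊢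
    exact h.2
  · rintro ⟨i, j⟩ h
    simp only [Finset.mem_sigma, Finset.mem_Icc, mem_lags, idx_eq] at h ⊢
    omega
  · rintro ⟨t, k⟩ _
    simp only [idx_eq, Sigma.mk.injEq, heq_eq_eq]
    omega
  · rintro ⟨i, j⟩ _
    simp only [idx_eq, Sigma.mk.injEq, heq_eq_eq]
    omega
  · rintro ⟨t, k⟩ _
    simp only [idx_eq]
    congr 1 <;> omega

/-- The quadratic form `∑_t ∑_k Z([t + 1/2 + k/2], [t + 1/2 - k/2]) c(t, k)`. -/
def lagForm (n : ℕ) (Z : ℤ → ℤ → ℝ) (c : ℤ → ℤ → ℂ) : ℂ :=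
  ∑ t ∈ Finset.Icc (1 : ℤ) n, ∑ k ∈ lags n t, (Z (idx t k) (idx t (-k)) : ℂ) * c t k

theorem lagForm_sub (n : ℕ) (Z : ℤ → ℤ → ℝ) (c d : ℤ → ℤ → ℂ) :
    lagForm n Z (fun t k => c t k - d t k) = lagForm n Z c - lagForm n Z d := by
  simp only [lagForm, mul_sub, Finset.sum_sub_distrib]

theorem lagForm_congr {n : ℕ} (Z : ℤ → ℤ → ℝ) {c d : ℤ → ℤ → ℂ}
    (h : ∀ t ∈ Finset.Icc (1 : ℤ) n, ∀ k ∈ lags n t, c t k = d t k) :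
    lagForm n Z c = lagForm n Z d :=
  Finset.sum_congr rfl fun t ht => Finset.sum_congr rfl fun k hk => by rw [h t ht k hk]

theorem norm_lagForm_le {n : ℕ} {Z : ℤ → ℤ → ℝ} {b : ℝ}
    (hZ : ∀ i j : ℤ, 1 ≤ i → i ≤ n → 1 ≤ j → j ≤ n → |Z i j| ≤ b) (c : ℤ → ℤ → ℂ) :
    ‖lagForm n Z c‖ ≤ b * ∑ t ∈ Finset.Icc (1 : ℤ) n, ∑ k ∈ lags n t, ‖c t k‖ := by
  rw [lagForm, Finset.mul_sum]
  refine norm_sum_le_of_le _ fun t _ => ?_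
  rw [Finset.mul_sum]
  refine norm_sum_le_of_le _ fun k hk => ?_
  obtain ⟨⟨h1, h2⟩, h3, h4⟩ := mem_lags.1 hk
  rw [norm_mul, Complex.norm_real]
  exact mul_le_mul_of_nonneg_right (hZ _ _ h1 h2 h3 h4) (norm_nonneg _)

theorem lagForm_eq_sum (n : ℕ) (Z : ℤ → ℤ → ℝ) (c : ℤ → ℤ → ℂ) :
    lagForm n Z c = ∑ i ∈ Finset.Icc (1 : ℤ) n, ∑ j ∈ Finset.Icc (1 : ℤ) n,
      (Z i j : ℂ) * c ((i + j) / 2) (i - j) := by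
  rw [lagForm, sum_lags n fun t k => (Z (idx t k) (idx t (-k)) : ℂ) * c t k]
  refine Finset.sum_congr rfl fun i _ => Finset.sum_congr rfl fun j _ => ?_
  have h1 : idx ((i + j) / 2) (i - j) = i := by rw [idx_eq]; omega
  have h2 : idx ((i + j) / 2) (-(i - j)) = j := by rw [idx_eq]; omega
  rw [h1, h2]

theorem lagForm_eq_ofReal (n : ℕ) {Z : ℤ → ℤ → ℝ} (hZ : ∀ i j, Z i j = Z j i) {c : ℤ → ℤ → ℂ}
    (hc : ∀ t k, c t (-k) = starRingEnd ℂ (c t k)) :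
    lagForm n Z c = ((∑ i ∈ Finset.Icc (1 : ℤ) n, ∑ j ∈ Finset.Icc (1 : ℤ) n,
      (c ((i + j) / 2) (i - j)).re * Z i j : ℝ) : ℂ) := by
  have him : starRingEnd ℂ (lagForm n Z c) = lagForm n Z c := by
    rw [lagForm_eq_sum]
    simp_rw [map_sum, map_mul, Complex.conj_ofReal, ← hc]
    rw [Finset.sum_comm]
    refine Finset.sum_congr rfl fun i _ => Finset.sum_congr rfl fun j _ => ?_
    rw [hZ, add_comm, neg_sub]
  rw [← Complex.conj_eq_iff_re.1 him, lagForm_eq_sum]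
  congr 1
  simp only [Complex.re_sum, Complex.re_ofReal_mul]
  simp_rw [mul_comm]

theorem Fn_eq_lagForm {n : ℕ} (Y : ℤ → ℝ) {φ : ℝ → ℝ → ℝ}
    (hφ : ∀ t ∈ Finset.Icc (1 : ℤ) n,
      IntervalIntegrable (φ ((t : ℝ) / n)) volume (-Real.pi) Real.pi) :
    Fn n Y φ = 1 / (n : ℂ) * (1 / (2 * Real.pi) *
      lagForm n (fun i j => Y i * Y j) fun t k => fourierCoef φ ((t : ℝ) / n) (-k)) := by
  rw [Fn, lagForm]
  congr 1
  rw [Finset.mul_sum]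
  refine Finset.sum_congr rfl fun t ht => ?_
  have hi : IntervalIntegrable (fun x => (φ ((t : ℝ) / n) x : ℂ)) volume (-Real.pi) Real.pi :=
    ⟨(hφ t ht).1.ofReal, (hφ t ht).2.ofReal⟩
  have h1 : ∀ x : ℝ, (φ ((t : ℝ) / n) x : ℂ) * prePeriodogram n Y t x
      = 1 / (2 * Real.pi) * ∑ k ∈ lags n t, (Y (idx t k) * Y (idx t (-k)) : ℂ) *
        ((φ ((t : ℝ) / n) x : ℂ) * Complex.exp (Complex.I * x * ((-k : ℤ) : ℂ))) := by
    intro x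
    rw [prePeriodogram, mul_left_comm, Finset.mul_sum]
    congr 1
    refine Finset.sum_congr rfl fun k _ => ?_
    rw [mul_left_comm]
    push_cast
    rw [mul_neg]
  simp_rw [h1]
  rw [intervalIntegral.integral_const_mul, intervalIntegral.integral_finsetSum fun k _ =>
    (intervalIntegrable_mul_exp hi (-k)).const_mul _]
  congr 1
  refine Finset.sum_congr rfl fun k _ => ?_
  rw [intervalIntegral.integral_const_mul, fourierCoef]
  push_cast
  rfl

section Stationary

variable {Ω : Type*} [MeasurableSpace Ω] {P : Measure Ω} {κ K : ℝ} {X : ℕ → ℤ → Ω → ℝ}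

/-- The centred products `X_i X_j - E X_i X_j`. -/
def centredProd (P : Measure Ω) (X : ℕ → ℤ → Ω → ℝ) (n : ℕ) (ω : Ω) (i j : ℤ) : ℝ :=
  X n i ω * X n j ω - ∫ ω', X n i ω' * X n j ω' ∂P

theorem centredProd_comm (n : ℕ) (ω : Ω) (i j : ℤ) :
    centredProd P X n ω i j = centredProd P X n ω j i := by
  simp only [centredProd, mul_comm]

theorem En_eq_lagForm {n : ℕ} (hn : 1 ≤ n)
    (hX : ∀ i j : ℤ, 1 ≤ i → i ≤ n → 1 ≤ j → j ≤ n →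
      Integrable (fun ω => X n i ω * X n j ω) P)
    {φ : ℝ → ℝ → ℝ}
    (hφ : ∀ t ∈ Finset.Icc (1 : ℤ) n,
      IntervalIntegrable (φ ((t : ℝ) / n)) volume (-Real.pi) Real.pi) (ω : Ω) :
    En P X n φ ω = ((1 / (2 * Real.pi * Real.sqrt n) : ℝ) : ℂ) *
      lagForm n (centredProd P X n ω) fun t k => fourierCoef φ ((t : ℝ) / n) (-k) := by
  rw [En]
  simp_rw [Fn_eq_lagForm _ hφ]
  rw [integral_const_mul, integral_const_mul, ← mul_sub, ← mul_sub, ← mul_assoc, ← mul_assoc]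
  congr 1
  · have h1 : (0 : ℝ) < n := by exact_mod_cast hn
    have h2 : (Real.sqrt n : ℂ) ≠ 0 := by exact_mod_cast (Real.sqrt_pos.2 h1).ne'
    have h3 : (n : ℂ) = (Real.sqrt n : ℂ) * Real.sqrt n := by
      rw [← Complex.ofReal_mul, Real.mul_self_sqrt h1.le]; simp
    have h4 : (Real.pi : ℂ) ≠ 0 := by exact_mod_cast Real.pi_ne_zero
    rw [h3]
    push_cast
    field_simp
  · simp only [lagForm]
    have hi : ∀ t ∈ Finset.Icc (1 : ℤ) n, ∀ k ∈ lags n t, Integrable (fun ω' =>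
        ((X n (idx t k) ω' * X n (idx t (-k)) ω' : ℝ) : ℂ) *
          fourierCoef φ ((t : ℝ) / n) (-k)) P := by
      intro t _ k hk
      obtain ⟨⟨h1, h2⟩, h3, h4⟩ := mem_lags.1 hk
      exact (hX _ _ h1 h2 h3 h4).ofReal.mul_const _
    rw [integral_finsetSum _ fun t ht => integrable_finsetSum _ fun k hk => hi t ht k hk,
      ← Finset.sum_sub_distrib]
    refine Finset.sum_congr rfl fun t ht => ?_
    rw [integral_finsetSum _ fun k hk => hi t ht k hk, ← Finset.sum_sub_distrib]
    refine Finset.sum_congr rfl fun k _ => ?_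
    rw [integral_mul_const, integral_complex_ofReal, ← sub_mul, centredProd, Complex.ofReal_sub]

theorem sum_sq_norm_fourierCoef_le {f : ℝ → ℝ → ℝ} {u : ℝ}
    (hf : MemLp (fun x => (f u x : ℂ)) 2 (volume.restrict (Ioc (-Real.pi) Real.pi)))
    (s : Finset ℤ) :
    ∑ k ∈ s, ‖fourierCoef f u (-k)‖ ^ 2
      ≤ 2 * Real.pi * ∫ x in (-Real.pi)..Real.pi, f u x ^ 2 := by
  have h := (Equiv.neg ℤ).hasSum_iff.2 (hasSum_sq_norm_integral_exp hf)
  have h1 : (2 * Real.pi * ∫ x in (-Real.pi)..Real.pi, ‖(f u x : ℂ)‖ ^ 2)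
      = 2 * Real.pi * ∫ x in (-Real.pi)..Real.pi, f u x ^ 2 := by
    simp only [Complex.norm_real, Real.norm_eq_abs, sq_abs]
  rw [h1] at h
  exact sum_le_hasSum s (fun k _ => sq_nonneg _) h

/-- Parseval's identity requires square integrability, whereas the exponential inequality assumes
only integrability of φ(u, ·); finiteness of ρ_∞ closes the gap. -/
theorem memLp_two_of_rhoInf_lt_top {φ : ℝ → ℝ → ℝ} {u : ℝ} (hu : u ∈ Icc (0 : ℝ) 1)
    (hφ : IntervalIntegrable (φ u) volume (-Real.pi) Real.pi) (hρ : rhoInf φ < ⊤) :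
    MemLp (fun x => (φ u x : ℂ)) 2 (volume.restrict (Ioc (-Real.pi) Real.pi)) := by
  refine memLp_two_of_summable_integral_exp ⟨hφ.1.ofReal, hφ.2.ofReal⟩ ?_
  have h1 : ∑' j : ℤ, ‖fourierCoef φ u j‖ₑ ≤ rhoInf φ :=
    ENNReal.tsum_le_tsum fun j => le_iSup₂_of_le u hu le_rfl
  have h2 : ∑' j : ℤ, ‖fourierCoef φ u j‖ₑ ≠ ⊤ := (h1.trans_lt hρ).ne
  have h3 := ENNReal.summable_toReal h2
  simp only [toReal_enorm] at h3
  exact h3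

theorem rho2n_sq {n : ℕ} (hn : 1 ≤ n) (φ : ℝ → ℝ → ℝ) :
    n * rho2n n φ ^ 2
      = ∑ t ∈ Finset.Icc (1 : ℤ) n, ∫ x in (-Real.pi)..Real.pi, φ ((t : ℝ) / n) x ^ 2 := by
  have h1 : (0 : ℝ) < n := by exact_mod_cast hn
  rw [rho2n, Real.sq_sqrt]
  · field_simp
  · refine mul_nonneg (by positivity) (Finset.sum_nonneg fun t _ => ?_)
    exact intervalIntegral.integral_nonneg neg_pi_lt_pi.le fun x _ => sq_nonneg _

theorem div_mem_Icc {n : ℕ} {t : ℤ} (ht : t ∈ Finset.Icc (1 : ℤ) n) :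
    (t : ℝ) / n ∈ Icc (0 : ℝ) 1 := by
  obtain ⟨h1, h2⟩ := Finset.mem_Icc.1 ht
  have h3 : (0 : ℝ) < t := by exact_mod_cast h1
  have h4 : (t : ℝ) ≤ n := by exact_mod_cast h2
  exact ⟨by positivity, div_le_one_of_le₀ h4 (by positivity)⟩

theorem IsGaussianLocallyStationary.integrable_mul (h : IsGaussianLocallyStationary P κ K X)
    (n : ℕ) (i j : ℤ) (hi1 : 1 ≤ i) (hin : i ≤ n) (hj1 : 1 ≤ j) (hjn : j ≤ n) :
    Integrable (fun ω => X n i ω * X n j ω) P :=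
  (h.memLp hi1 hin).integrable_mul (h.memLp hj1 hjn)

/-- The exponential inequality for a single index function. -/
theorem IsGaussianLocallyStationary.expInequality [IsProbabilityMeasure P] (hκ : 0 < κ)
    (hK : 0 < K) (h : IsGaussianLocallyStationary P κ K X) :
    ExpInequality P X 3 (Real.sqrt (2 * Real.pi) / (4 * (K * ellSum κ) ^ 2)) := by
  intro n φ η hn _ hφi hρ _ hη
  have hρ0 : 0 ≤ rho2n n φ := Real.sqrt_nonneg _
  -- If ρ_{2,n}(φ) = 0, the quotient η / 0 is 0 and the claimed bound is 3.
  rcases hρ0.eq_or_lt with hz | hpos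
  · rw [← hz]
    simp only [div_zero, mul_zero, neg_zero, Real.exp_zero, mul_one]
    exact measureReal_le_one.trans (by norm_num)
  have hσ : 0 < K * ellSum κ := mul_pos hK (ellSum_pos hκ)
  set σ := K * ellSum κ
  have hn0 : (0 : ℝ) < n := by exact_mod_cast hn
  -- A bound for the Frobenius norm of the matrix of the form; the factor 2π comes from Fourier
  -- coefficients without the normalisation 1/(2π).
  set R : ℝ := Real.sqrt (2 * Real.pi * n) * rho2n n φ with hRdef
  have hR : 0 < R := by positivity
  set c : ℤ → ℤ → ℂ := fun t k => fourierCoef φ ((t : ℝ) / n) (-k) with hc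
  have hcc : ∀ t k, c t (-k) = starRingEnd ℂ (c t k) := fun t k => fourierCoef_neg φ _ (-k)
  set M : Matrix (Finset.Icc (1 : ℤ) n) (Finset.Icc (1 : ℤ) n) ℝ := Matrix.of fun i j =>
    (c (((i : ℤ) + j) / 2) (i - j)).re with hM
  have hMsymm : ∀ i j, M i j = M j i := by
    intro i j
    simp only [hM, Matrix.of_apply]
    rw [← neg_sub (i : ℤ) j, hcc, Complex.conj_re, add_comm]
  have hMR : ∑ i, ∑ j, M i j ^ 2 ≤ R ^ 2 := by
    calc ∑ i, ∑ j, M i j ^ 2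
        ≤ ∑ i : Finset.Icc (1 : ℤ) n, ∑ j : Finset.Icc (1 : ℤ) n,
          ‖c (((i : ℤ) + j) / 2) (i - j)‖ ^ 2 := by
          refine Finset.sum_le_sum fun i _ => Finset.sum_le_sum fun j _ => ?_
          rw [← sq_abs]
          exact pow_le_pow_left₀ (abs_nonneg _) (Complex.abs_re_le_norm _) 2
      _ = ∑ t ∈ Finset.Icc (1 : ℤ) n, ∑ k ∈ lags n t, ‖c t k‖ ^ 2 := by
          rw [sum_lags n fun t k => ‖c t k‖ ^ 2,
            Finset.sum_coe_sort (Finset.Icc (1 : ℤ) n) fun i =>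
              ∑ j : Finset.Icc (1 : ℤ) n, ‖c ((i + j) / 2) (i - j)‖ ^ 2]
          refine Finset.sum_congr rfl fun i _ => ?_
          rw [Finset.sum_coe_sort (Finset.Icc (1 : ℤ) n) fun j =>
            ‖c ((i + j) / 2) (i - j)‖ ^ 2]
      _ ≤ ∑ t ∈ Finset.Icc (1 : ℤ) n,
          2 * Real.pi * ∫ x in (-Real.pi)..Real.pi, φ ((t : ℝ) / n) x ^ 2 :=
          Finset.sum_le_sum fun t ht => sum_sq_norm_fourierCoef_le
            (memLp_two_of_rhoInf_lt_top (div_mem_Icc ht) (hφi _ (div_mem_Icc ht)) hρ) _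
      _ = R ^ 2 := by
          rw [← Finset.mul_sum, ← rho2n_sq hn, hRdef, mul_pow, Real.sq_sqrt (by positivity)]
          ring
  have hquad := measureReal_abs_gaussian_quadratic_ge_le (h.gaussian n)
    (fun i => h.integral_eq_zero hκ (Finset.mem_Icc.1 i.2).1 (Finset.mem_Icc.1 i.2).2) hσ
    (h.integral_sq_sum_le hκ n) hMsymm hR hMR (2 * Real.pi * Real.sqrt n * η)
  have hset : {ω | η ≤ ‖En P X n φ ω‖} = {ω | 2 * Real.pi * Real.sqrt n * η
      ≤ |∑ i, ∑ j, M i j * (X n (i : ℤ) ω * X n (j : ℤ) ω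
        - ∫ ω', X n (i : ℤ) ω' * X n (j : ℤ) ω' ∂P)|} := by
    ext ω
    have hsum : lagForm n (centredProd P X n ω) c
        = ((∑ i, ∑ j, M i j * (X n (i : ℤ) ω * X n (j : ℤ) ω
          - ∫ ω', X n (i : ℤ) ω' * X n (j : ℤ) ω' ∂P) : ℝ) : ℂ) := by
      rw [lagForm_eq_ofReal n (fun i j => centredProd_comm n ω i j) hcc]
      congr 1
      rw [← Finset.sum_coe_sort]
      refine Finset.sum_congr rfl fun i _ => ?_
      rw [← Finset.sum_coe_sort]
      rfl
    have hs : 0 < 2 * Real.pi * Real.sqrt n := by positivity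
    simp only [mem_ofPred_eq]
    rw [En_eq_lagForm hn (h.integrable_mul n) fun t ht => hφi _ (div_mem_Icc ht), hsum, norm_mul,
      Complex.norm_real, Complex.norm_real, Real.norm_eq_abs, Real.norm_eq_abs,
      abs_of_pos (by positivity), one_div_mul_eq_div, le_div_iff₀ hs, mul_comm]
  rw [hset]
  refine hquad.trans (le_of_eq ?_)
  congr 3
  have h2 : Real.sqrt (2 * Real.pi * n) = Real.sqrt (2 * Real.pi) * Real.sqrt n :=
    Real.sqrt_mul (by positivity) _
  have h3 : 2 * Real.pi = Real.sqrt (2 * Real.pi) * Real.sqrt (2 * Real.pi) :=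
    (Real.mul_self_sqrt (by positivity)).symm
  rw [hRdef, h2]
  nth_rewrite 1 [h3]
  have h4 : 0 < Real.sqrt n := Real.sqrt_pos.2 hn0
  have h5 : 0 < Real.sqrt (2 * Real.pi) := by positivity
  field_simp

end Stationary

end EmpSpectral

end

noncomputable section

namespace EmpSpectral

/-! ### The events `B_n` -/

section Events

variable {Ω : Type*} [MeasurableSpace Ω] {P : Measure Ω} {κ K : ℝ} {X : ℕ → ℤ → Ω → ℝ}

/-- The event that all `X_{t,n}²` are at most `4 σ² log n`. -/
def boundedEvent (X : ℕ → ℤ → Ω → ℝ) (σ : ℝ) (n : ℕ) : Set Ω :=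
  ⋂ t ∈ Finset.Icc (1 : ℤ) n, {ω | |X n t ω| < 2 * σ * Real.sqrt (Real.log n)}

theorem IsGaussianLocallyStationary.measurableSet_boundedEvent
    (h : IsGaussianLocallyStationary P κ K X) (σ : ℝ) (n : ℕ) :
    MeasurableSet (boundedEvent X σ n) :=
  Finset.measurableSet_biInter _ fun t _ =>
    measurableSet_lt (h.measurable n t).abs measurable_const

theorem IsGaussianLocallyStationary.tendsto_measure_boundedEvent [IsProbabilityMeasure P]
    (h : IsGaussianLocallyStationary P κ K X) (hκ : 0 < κ) (hK : 0 < K) :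
    Tendsto (fun n => P (boundedEvent X (K * ellSum κ) n)) atTop (𝓝 1) := by
  have hσ : 0 < K * ellSum κ := mul_pos hK (ellSum_pos hκ)
  set σ := K * ellSum κ with hσdef
  have hcompl : ∀ n : ℕ, 1 ≤ n → P.real (boundedEvent X σ n)ᶜ ≤ 2 / n := by
    intro n hn
    have hn0 : (0 : ℝ) < n := by exact_mod_cast hn
    have hlog : 0 ≤ Real.log n := Real.log_natCast_nonneg n
    have hsub : (boundedEvent X σ n)ᶜ
        ⊆ ⋃ t ∈ Finset.Icc (1 : ℤ) n, {ω | 2 * σ * Real.sqrt (Real.log n) ≤ |X n t ω|} := by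
      intro ω hω
      simpa [boundedEvent] using hω
    calc P.real (boundedEvent X σ n)ᶜ
        ≤ ∑ t ∈ Finset.Icc (1 : ℤ) n, P.real {ω | 2 * σ * Real.sqrt (Real.log n) ≤ |X n t ω|} :=
          (measureReal_mono hsub (measure_ne_top P _)).trans (measureReal_biUnion_finset_le _ _)
      _ ≤ ∑ t ∈ Finset.Icc (1 : ℤ) n, 2 * ((n : ℝ) ^ 2)⁻¹ := by
          refine Finset.sum_le_sum fun t ht => ?_
          obtain ⟨h1, h2⟩ := Finset.mem_Icc.1 ht
          -- At the threshold 2σ√(log n) the Gaussian tail is 2 exp(-2 log n) = 2n⁻², and a union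
          -- over n indices leaves 2/n.
          refine (h.measureReal_abs_ge_le hκ hK h1 h2 (by positivity)).trans (le_of_eq ?_)
          rw [← hσdef, mul_pow, Real.sq_sqrt hlog]
          have h3 : -((2 * σ) ^ 2 * Real.log n / (2 * σ ^ 2)) = -(Real.log ((n : ℝ) ^ 2)) := by
            rw [Real.log_pow]
            push_cast
            field_simp
          rw [h3, Real.exp_neg, Real.exp_log (by positivity)]
      _ = 2 / n := by
          rw [Finset.sum_const, Int.card_Icc, nsmul_eq_mul]
          simp
          field_simp
  have hreal : Tendsto (fun n => P.real (boundedEvent X σ n)) atTop (𝓝 1) := by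
    have h1 : Tendsto (fun n : ℕ => 1 - 2 / (n : ℝ)) atTop (𝓝 1) := by
      simpa using (tendsto_const_div_atTop_nhds_zero_nat (2 : ℝ)).const_sub 1
    refine tendsto_of_tendsto_of_tendsto_of_le_of_le' h1 tendsto_const_nhds ?_
      (Eventually.of_forall fun n => measureReal_le_one)
    filter_upwards [eventually_ge_atTop 1] with n hn
    have h2 := hcompl n hn
    rw [probReal_compl_eq_one_sub (h.measurableSet_boundedEvent σ n)] at h2
    linarith
  have h3 := ENNReal.tendsto_ofReal hreal
  rw [ENNReal.ofReal_one] at h3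
  exact h3.congr fun n => ofReal_measureReal

theorem IsGaussianLocallyStationary.abs_centredProd_le [IsProbabilityMeasure P]
    (h : IsGaussianLocallyStationary P κ K X) (hκ : 0 < κ) (hK : 0 < K) {n : ℕ} (hn : 2 ≤ n)
    {ω : Ω} (hω : ω ∈ boundedEvent X (K * ellSum κ) n) {i j : ℤ} (hi1 : 1 ≤ i) (hin : i ≤ n)
    (hj1 : 1 ≤ j) (hjn : j ≤ n) :
    |centredProd P X n ω i j| ≤ 6 * (K * ellSum κ) ^ 2 * Real.log n := by
  have hσ : 0 < K * ellSum κ := mul_pos hK (ellSum_pos hκ)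
  have hE := h.abs_integral_mul_le hκ hi1 hin hj1 hjn
  set σ := K * ellSum κ
  -- This absorbs the mean: 4σ² log n + σ² ≤ 6σ² log n. It is where n ≥ 2 is needed.
  have hlog : 1 / 2 ≤ Real.log n := by
    have h1 : Real.log 2 ≤ Real.log n := Real.log_le_log (by norm_num) (by exact_mod_cast hn)
    linarith [Real.log_two_gt_d9]
  have hX : ∀ t : ℤ, 1 ≤ t → t ≤ n → |X n t ω| ≤ 2 * σ * Real.sqrt (Real.log n) := by
    intro t h1 h2
    simp only [boundedEvent, mem_iInter] at hω
    exact (hω t (Finset.mem_Icc.2 ⟨h1, h2⟩)).le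
  have hprod : |X n i ω * X n j ω| ≤ 4 * σ ^ 2 * Real.log n := by
    rw [abs_mul]
    calc _ ≤ (2 * σ * Real.sqrt (Real.log n)) * (2 * σ * Real.sqrt (Real.log n)) :=
          mul_le_mul (hX i hi1 hin) (hX j hj1 hjn) (abs_nonneg _) (by positivity)
      _ = 4 * σ ^ 2 * (Real.sqrt (Real.log n) * Real.sqrt (Real.log n)) := by ring
      _ = _ := by rw [Real.mul_self_sqrt (by linarith)]
  rw [centredProd]
  refine (abs_sub _ _).trans ?_
  nlinarith [sq_nonneg σ]

end Events

/-! ### Step functions in time with values in the trigonometric polynomials -/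

/-- The index function which equals `(2π)⁻¹ ∑_{|k| ≤ n} c(t, k) exp(i k x)` on
`((t - 1) / n, t / n]`. -/
def stepIndex (n : ℕ) (c : ℤ → ℤ → ℂ) (u x : ℝ) : ℝ :=
  ((2 * Real.pi : ℂ)⁻¹ *
    ∑ k ∈ Finset.Icc (-(n : ℤ)) n, c ⌈u * n⌉ k * Complex.exp (Complex.I * x * k)).re

theorem ofReal_stepIndex {n : ℕ} {c : ℤ → ℤ → ℂ} (hc : ∀ t k, c t (-k) = starRingEnd ℂ (c t k))
    (u x : ℝ) :
    (stepIndex n c u x : ℂ) = (2 * Real.pi : ℂ)⁻¹ *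
      ∑ k ∈ Finset.Icc (-(n : ℤ)) n, c ⌈u * n⌉ k * Complex.exp (Complex.I * x * k) := by
  rw [stepIndex, ← Complex.conj_eq_iff_re, map_mul, map_sum]
  congr 1
  · rw [map_inv₀, map_mul, Complex.conj_ofReal, map_ofNat]
  · refine Finset.sum_bij' (fun k _ => -k) (fun k _ => -k) ?_ ?_ ?_ ?_ ?_
    · intro k hk
      rw [Finset.mem_Icc] at hk ⊢
      omega
    · intro k hk
      rw [Finset.mem_Icc] at hk ⊢
      omega
    · exact fun k _ => neg_neg k
    · exact fun k _ => neg_neg k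
    · intro k _
      rw [hc, map_mul, ← Complex.exp_conj, map_mul, map_mul, Complex.conj_I, Complex.conj_ofReal,
        map_intCast]
      congr 2
      push_cast
      ring

theorem continuous_stepIndex (n : ℕ) (c : ℤ → ℤ → ℂ) (u : ℝ) : Continuous (stepIndex n c u) := by
  unfold stepIndex
  fun_prop

theorem isIndexFunction_stepIndex (n : ℕ) (c : ℤ → ℤ → ℂ) : IsIndexFunction (stepIndex n c) := by
  have h : Measurable (Function.uncurry (stepIndex n c)) := by
    unfold stepIndex Function.uncurry
    have h1 : ∀ k : ℤ, Measurable fun p : ℝ × ℝ => c ⌈p.1 * n⌉ k := fun k =>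
      (Measurable.of_discrete (f := fun t : ℤ => c t k)).comp
        (Int.measurable_ceil.comp (measurable_fst.mul_const _))
    fun_prop
  exact h.comp measurable_subtype_coe

theorem fourierCoef_stepIndex {n : ℕ} {c : ℤ → ℤ → ℂ}
    (hc : ∀ t k, c t (-k) = starRingEnd ℂ (c t k)) (u : ℝ) (j : ℤ) :
    fourierCoef (stepIndex n c) u (-j)
      = if j ∈ Finset.Icc (-(n : ℤ)) n then c ⌈u * n⌉ j else 0 := by
  rw [fourierCoef]
  have h1 : ∀ x : ℝ, (stepIndex n c u x : ℂ) * Complex.exp (Complex.I * x * ((-j : ℤ) : ℂ))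
      = ∑ k ∈ Finset.Icc (-(n : ℤ)) n, (2 * Real.pi : ℂ)⁻¹ * c ⌈u * n⌉ k *
        Complex.exp (Complex.I * x * ((k - j : ℤ) : ℂ)) := by
    intro x
    rw [ofReal_stepIndex hc, Finset.mul_sum, Finset.sum_mul]
    refine Finset.sum_congr rfl fun k _ => ?_
    rw [← mul_assoc, mul_assoc, ← Complex.exp_add]
    congr 2
    push_cast
    ring
  simp_rw [h1]
  rw [intervalIntegral.integral_finsetSum fun k _ => Continuous.intervalIntegrable (by fun_prop) _ _]
  simp_rw [intervalIntegral.integral_const_mul, integral_exp_I_mul_intCast, sub_eq_zero]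
  have hpi : (Real.pi : ℂ) ≠ 0 := by exact_mod_cast Real.pi_ne_zero
  simp only [mul_ite, mul_zero, Finset.sum_ite_eq']
  split_ifs
  · field_simp
  · rfl

/-- For n ≥ 1 the value 0 is taken only at u = 0. Suprema and variations over [0, 1] see that point,
so the coefficient bounds range over 0, …, n although the process uses only 1, …, n. -/
theorem ceil_mul_mem_Icc {n : ℕ} {u : ℝ} (hu : u ∈ Icc (0 : ℝ) 1) :
    ⌈u * n⌉ ∈ Finset.Icc (0 : ℤ) n := by
  rw [Finset.mem_Icc]
  refine ⟨Int.ceil_nonneg (mul_nonneg hu.1 (by positivity)), Int.ceil_le.2 ?_⟩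
  push_cast
  nlinarith [hu.2, (Nat.cast_nonneg n : (0 : ℝ) ≤ n)]

/-- An upper bound for all coefficients of `stepIndex n c`. -/
def coefSum (n : ℕ) (c : ℤ → ℤ → ℂ) : ℝ≥0 :=
  ∑ t ∈ Finset.Icc (0 : ℤ) n, ∑ k ∈ Finset.Icc (-(n : ℤ)) n, ‖c t k‖₊

theorem nnnorm_ite_le_coefSum {n : ℕ} (c : ℤ → ℤ → ℂ) {t : ℤ} (ht : t ∈ Finset.Icc (0 : ℤ) n)
    (j : ℤ) : ‖if j ∈ Finset.Icc (-(n : ℤ)) n then c t j else 0‖₊ ≤ coefSum n c := by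
  split_ifs with hj
  · have h1 : ‖c t j‖₊ ≤ ∑ k ∈ Finset.Icc (-(n : ℤ)) n, ‖c t k‖₊ :=
      Finset.single_le_sum (f := fun k => ‖c t k‖₊) (fun _ _ => zero_le) hj
    exact h1.trans (Finset.single_le_sum
      (f := fun t => ∑ k ∈ Finset.Icc (-(n : ℤ)) n, ‖c t k‖₊) (fun _ _ => zero_le) ht)
  · simp

theorem rhoInf_stepIndex_lt_top {n : ℕ} {c : ℤ → ℤ → ℂ}
    (hc : ∀ t k, c t (-k) = starRingEnd ℂ (c t k)) : rhoInf (stepIndex n c) < ⊤ := by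
  rw [rhoInf, ← (Equiv.neg ℤ).tsum_eq, tsum_eq_sum (s := Finset.Icc (-(n : ℤ)) n)]
  · refine ENNReal.sum_lt_top.2 fun j _ => ?_
    refine lt_of_le_of_lt (iSup₂_le fun u hu => ?_) (ENNReal.coe_lt_top (r := coefSum n c))
    rw [Equiv.neg_apply, fourierCoef_stepIndex hc, enorm_eq_nnnorm, ENNReal.coe_le_coe]
    exact nnnorm_ite_le_coefSum c (ceil_mul_mem_Icc hu) j
  · intro j hj
    simp [fourierCoef_stepIndex hc, hj]

/-- Each Fourier coefficient factors through the monotone integer-valued map u ↦ ⌈un⌉, whose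
variation is n. On {0, …, n} the outer map is Lipschitz with constant 2S, since distinct integers
are at distance at least 1 and all values are bounded by S. -/
theorem vTilde_stepIndex_lt_top {n : ℕ} {c : ℤ → ℤ → ℂ}
    (hc : ∀ t k, c t (-k) = starRingEnd ℂ (c t k)) : vTilde (stepIndex n c) < ⊤ := by
  set S := coefSum n c
  refine lt_of_le_of_lt (b := (2 * S : ℝ≥0) * ENNReal.ofReal n) (iSup_le fun j' => ?_)
    (ENNReal.mul_lt_top ENNReal.coe_lt_top ENNReal.ofReal_lt_top)
  obtain ⟨j, rfl⟩ : ∃ j, j' = -j := ⟨-j', (neg_neg j').symm⟩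
  set g : ℤ → ℂ := fun t => if j ∈ Finset.Icc (-(n : ℤ)) n then c t j else 0 with hg
  set T : Set ℝ := (fun t : ℤ => (t : ℝ)) '' (Finset.Icc (0 : ℤ) n)
  have hlip : LipschitzOnWith (2 * S) (fun x : ℝ => g ⌊x⌋) T := by
    refine LipschitzOnWith.of_dist_le_mul ?_
    rintro _ ⟨s, hs, rfl⟩ _ ⟨t, ht, rfl⟩
    simp only [Int.floor_intCast]
    rcases eq_or_ne s t with rfl | hst
    · simp
    · have h1 : (1 : ℝ) ≤ dist (s : ℝ) (t : ℝ) := by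
        rw [Real.dist_eq]
        exact_mod_cast Int.one_le_abs (sub_ne_zero.2 hst)
      have h2 : ‖g s‖ ≤ S := by exact_mod_cast nnnorm_ite_le_coefSum c hs j
      have h3 : ‖g t‖ ≤ S := by exact_mod_cast nnnorm_ite_le_coefSum c ht j
      have h4 := dist_le_norm_add_norm (g s) (g t)
      have h5 : (0 : ℝ) ≤ S := S.2
      push_cast
      nlinarith
  have hmaps : MapsTo (fun u : ℝ => ((⌈u * n⌉ : ℤ) : ℝ)) (Icc (0 : ℝ) 1) T := fun u hu =>
    ⟨_, ceil_mul_mem_Icc hu, rfl⟩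
  have hcomp : (fun u => fourierCoef (stepIndex n c) u (-j))
      = (fun x : ℝ => g ⌊x⌋) ∘ fun u : ℝ => ((⌈u * n⌉ : ℤ) : ℝ) := by
    ext u
    rw [fourierCoef_stepIndex hc]
    simp only [Function.comp_apply, Int.floor_intCast, hg]
  rw [hcomp]
  refine (hlip.comp_eVariationOn_le hmaps).trans ?_
  gcongr
  have hmono : MonotoneOn (fun u : ℝ => ((⌈u * n⌉ : ℤ) : ℝ)) (Icc (0 : ℝ) 1) := by
    intro u _ v _ huv
    have : u * n ≤ v * n := mul_le_mul_of_nonneg_right huv (Nat.cast_nonneg n)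
    exact Int.cast_le.2 (Int.ceil_mono this)
  have := (hmono.eVariationOn_eq (left_mem_Icc.2 zero_le_one) (right_mem_Icc.2 zero_le_one)).le
  simpa using this

theorem ceil_div_mul {n : ℕ} (hn : 1 ≤ n) (t : ℤ) : ⌈(t : ℝ) / n * n⌉ = t := by
  have h1 : (n : ℝ) ≠ 0 := by positivity
  rw [div_mul_cancel₀ _ h1, Int.ceil_intCast]

theorem rho2n_stepIndex_sq {n : ℕ} (hn : 1 ≤ n) {c : ℤ → ℤ → ℂ}
    (hc : ∀ t k, c t (-k) = starRingEnd ℂ (c t k)) :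
    2 * Real.pi * n * rho2n n (stepIndex n c) ^ 2
      = ∑ t ∈ Finset.Icc (1 : ℤ) n, ∑ k ∈ Finset.Icc (-(n : ℤ)) n, ‖c t k‖ ^ 2 := by
  rw [mul_assoc, rho2n_sq hn, Finset.mul_sum]
  refine Finset.sum_congr rfl fun t _ => ?_
  set f : ℝ → ℂ := fun x => (stepIndex n c ((t : ℝ) / n) x : ℂ) with hf
  have hfc : Continuous f := Complex.continuous_ofReal.comp (continuous_stepIndex n c _)
  have hmem : MemLp f 2 (volume.restrict (Ioc (-Real.pi) Real.pi)) := by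
    refine (memLp_two_iff_integrable_sq_norm hfc.aestronglyMeasurable).2 ?_
    exact (((hfc.norm).pow 2).intervalIntegrable (-Real.pi) Real.pi).1
  have h1 := (Equiv.neg ℤ).hasSum_iff.2 (hasSum_sq_norm_integral_exp hmem)
  have h2 : (2 * Real.pi * ∫ x in (-Real.pi)..Real.pi, ‖f x‖ ^ 2)
      = 2 * Real.pi * ∫ x in (-Real.pi)..Real.pi, stepIndex n c ((t : ℝ) / n) x ^ 2 := by
    simp only [hf, Complex.norm_real, Real.norm_eq_abs, sq_abs]
  rw [h2] at h1
  have h3 : HasSum (fun j : ℤ => ‖fourierCoef (stepIndex n c) ((t : ℝ) / n) (-j)‖ ^ 2)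
    (2 * Real.pi * ∫ x in (-Real.pi)..Real.pi, stepIndex n c ((t : ℝ) / n) x ^ 2) := h1
  simp_rw [fourierCoef_stepIndex hc, ceil_div_mul hn] at h3
  refine h3.unique ?_
  have h4 := hasSum_sum_of_ne_finset_zero (L := SummationFilter.unconditional ℤ)
    (f := fun j : ℤ => ‖if j ∈ Finset.Icc (-(n : ℤ)) n then c t j else 0‖ ^ 2)
    (s := Finset.Icc (-(n : ℤ)) n) (fun j hj => by simp [hj])
  convert h4 using 1
  exact Finset.sum_congr rfl fun j hj => by rw [if_pos hj]

/-! ### The process indexed by coefficient arrays -/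

section CoefProcess

variable {Ω : Type*} [MeasurableSpace Ω] {P : Measure Ω} {κ K : ℝ} {X : ℕ → ℤ → Ω → ℝ}

/-- The centred quadratic form with coefficients `c`, normalised as the empirical process. -/
def coefSeries (P : Measure Ω) (X : ℕ → ℤ → Ω → ℝ) (n : ℕ) (c : ℤ → ℤ → ℂ) (ω : Ω) : ℂ :=
  ((1 / (2 * Real.pi * Real.sqrt n) : ℝ) : ℂ) * lagForm n (centredProd P X n ω) c

theorem coefSeries_sub (n : ℕ) (c d : ℤ → ℤ → ℂ) (ω : Ω) :
    coefSeries P X n (fun t k => c t k - d t k) ω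
      = coefSeries P X n c ω - coefSeries P X n d ω := by
  rw [coefSeries, lagForm_sub, mul_sub]
  rfl

theorem norm_coefSeries_le {n : ℕ} {ω : Ω} {b : ℝ} (hb : 0 ≤ b)
    (hZ : ∀ i j : ℤ, 1 ≤ i → i ≤ n → 1 ≤ j → j ≤ n → |centredProd P X n ω i j| ≤ b)
    (c : ℤ → ℤ → ℂ) :
    ‖coefSeries P X n c ω‖ ≤ b / Real.sqrt n *
      ∑ t ∈ Finset.Icc (1 : ℤ) n, ∑ k ∈ lags n t, ‖c t k‖ := by
  have hS : 0 ≤ ∑ t ∈ Finset.Icc (1 : ℤ) n, ∑ k ∈ lags n t, ‖c t k‖ := by positivity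
  rw [coefSeries, norm_mul, Complex.norm_real, Real.norm_eq_abs, abs_of_nonneg (by positivity)]
  calc _ ≤ 1 / (2 * Real.pi * Real.sqrt n) *
        (b * ∑ t ∈ Finset.Icc (1 : ℤ) n, ∑ k ∈ lags n t, ‖c t k‖) :=
        mul_le_mul_of_nonneg_left (norm_lagForm_le hZ c) (by positivity)
    _ = (1 / (2 * Real.pi)) * (b / Real.sqrt n *
        ∑ t ∈ Finset.Icc (1 : ℤ) n, ∑ k ∈ lags n t, ‖c t k‖) := by
        rw [one_div, mul_inv, one_div, div_eq_mul_inv]; ring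
    _ ≤ 1 * (b / Real.sqrt n * ∑ t ∈ Finset.Icc (1 : ℤ) n, ∑ k ∈ lags n t, ‖c t k‖) := by
        gcongr
        rw [div_le_one (by positivity)]
        linarith [Real.pi_gt_three]
    _ = _ := one_mul _

/-- Cauchy-Schwarz over the n² pairs (i, j). -/
theorem sum_lags_norm_le {n : ℕ} (c : ℤ → ℤ → ℂ) {r : ℝ} (hr : 0 ≤ r)
    (hcr : ∑ t ∈ Finset.Icc (1 : ℤ) n, ∑ k ∈ Finset.Icc (-(n : ℤ)) n, ‖c t k‖ ^ 2
      ≤ 2 * Real.pi * n * r ^ 2) :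
    ∑ t ∈ Finset.Icc (1 : ℤ) n, ∑ k ∈ lags n t, ‖c t k‖
      ≤ Real.sqrt (2 * Real.pi) * (n * Real.sqrt n) * r := by
  have hsq : (∑ t ∈ Finset.Icc (1 : ℤ) n, ∑ k ∈ lags n t, ‖c t k‖) ^ 2
      ≤ (Real.sqrt (2 * Real.pi) * (n * Real.sqrt n) * r) ^ 2 := by
    have hle : ∑ t ∈ Finset.Icc (1 : ℤ) n, ∑ k ∈ lags n t, ‖c t k‖ ^ 2
        ≤ 2 * Real.pi * n * r ^ 2 := by
      refine le_trans (Finset.sum_le_sum fun t _ => ?_) hcr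
      exact Finset.sum_le_sum_of_subset_of_nonneg (Finset.filter_subset _ _)
        fun _ _ _ => sq_nonneg _
    rw [sum_lags n fun t k => ‖c t k‖, ← Finset.sum_product']
    rw [sum_lags n fun t k => ‖c t k‖ ^ 2, ← Finset.sum_product'] at hle
    refine sq_sum_le_card_mul_sum_sq.trans ?_
    rw [Finset.card_product, Int.card_Icc]
    simp only [add_sub_cancel_right, Int.toNat_natCast]
    push_cast
    calc _ ≤ (n : ℝ) * n * (2 * Real.pi * n * r ^ 2) := by gcongr
      _ = (2 * Real.pi) * (n ^ 2 * n) * r ^ 2 := by ring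
      _ = _ := by
        rw [mul_pow, mul_pow, mul_pow, Real.sq_sqrt (by positivity),
          Real.sq_sqrt (Nat.cast_nonneg n)]
  exact le_of_sq_le_sq hsq (by positivity)

/-- A Hermitian coefficient array is realised by a genuine index function, to which `ExpInequality`
applies. All lags lie in [-n, n], so the truncation of the trigonometric polynomial loses nothing.
-/
theorem En_stepIndex {n : ℕ} (hn : 1 ≤ n) (h : IsGaussianLocallyStationary P κ K X)
    {c : ℤ → ℤ → ℂ} (hc : ∀ t k, c t (-k) = starRingEnd ℂ (c t k)) (ω : Ω) :
    En P X n (stepIndex n c) ω = coefSeries P X n c ω := by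
  rw [En_eq_lagForm hn (h.integrable_mul n)
    fun t _ => (continuous_stepIndex n c _).intervalIntegrable _ _, coefSeries]
  congr 1
  refine lagForm_congr _ fun t _ k hk => ?_
  rw [fourierCoef_stepIndex hc, ceil_div_mul hn, if_pos (Finset.mem_filter.1 hk).1]

/-- The exponential inequality, in terms of coefficients. -/
theorem measureReal_coefSeries_ge_le (h : IsGaussianLocallyStationary P κ K X) {c₁ c₂ : ℝ}
    (hc₁ : 0 < c₁) (hc₂ : 0 < c₂) (hexp : ExpInequality P X c₁ c₂) {n : ℕ} (hn : 1 ≤ n)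
    {c : ℤ → ℤ → ℂ} (hc : ∀ t k, c t (-k) = starRingEnd ℂ (c t k)) {r η : ℝ} (hr : 0 ≤ r)
    (hη : 0 < η)
    (hcr : ∑ t ∈ Finset.Icc (1 : ℤ) n, ∑ k ∈ Finset.Icc (-(n : ℤ)) n, ‖c t k‖ ^ 2
      ≤ 2 * Real.pi * n * r ^ 2) :
    P.real {ω | η ≤ ‖coefSeries P X n c ω‖} ≤ c₁ * Real.exp (-(c₂ * (η / r))) := by
  have hn0 : (0 : ℝ) < n := by exact_mod_cast hn
  have hsq := rho2n_stepIndex_sq hn hc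
  have hρ0 : 0 ≤ rho2n n (stepIndex n c) := Real.sqrt_nonneg _
  -- With ρ_{2,n} = 0 the assumed inequality gives only the bound c₁, because η / 0 = 0. In this
  -- case all coefficients in the form vanish and the event is empty.
  rcases hρ0.eq_or_lt with hz | hpos
  · rw [← hz] at hsq
    have hzero : ∀ ω, coefSeries P X n c ω = 0 := by
      intro ω
      have h1 : lagForm n (centredProd P X n ω) c
          = lagForm n (centredProd P X n ω) fun _ _ => 0 := by
        refine lagForm_congr _ fun t ht k hk => ?_
        have h2 : ∀ t ∈ Finset.Icc (1 : ℤ) n,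
            0 ≤ ∑ k ∈ Finset.Icc (-(n : ℤ)) n, ‖c t k‖ ^ 2 := fun t _ => by positivity
        have h3 := (Finset.sum_eq_zero_iff_of_nonneg h2).1 (by rw [← hsq]; ring) t ht
        have h4 := (Finset.sum_eq_zero_iff_of_nonneg fun k _ => sq_nonneg _).1 h3 k
          (Finset.mem_filter.1 hk).1
        simpa using h4
      rw [coefSeries, h1]
      simp [lagForm]
    have hempty : {ω | η ≤ ‖coefSeries P X n c ω‖} = ∅ := by
      ext ω
      simp [hzero ω, hη]
    rw [hempty, measureReal_empty]
    positivity
  · have hρr : rho2n n (stepIndex n c) ≤ r := by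
      rw [← hsq] at hcr
      exact le_of_sq_le_sq (le_of_mul_le_mul_left hcr (by positivity)) hr
    have h1 := hexp n (stepIndex n c) η hn (isIndexFunction_stepIndex n c)
      (fun u _ => (continuous_stepIndex n c u).intervalIntegrable _ _)
      (rhoInf_stepIndex_lt_top hc) (vTilde_stepIndex_lt_top hc) hη
    simp_rw [En_stepIndex hn h hc] at h1
    refine h1.trans ?_
    gcongr

end CoefProcess

end EmpSpectral

end

noncomputable section

namespace EmpSpectral

/-! ### Bounded index functions and their averaged Fourier coefficients -/

/-- A bounded measurable function on `[0, 1] × [-π, π]`. -/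
def IsBoundedIndex (φ : ℝ → ℝ → ℝ) : Prop :=
  IsIndexFunction φ ∧ ∃ M : ℝ, ∀ u ∈ Icc (0 : ℝ) 1, ∀ x ∈ Icc (-Real.pi) Real.pi, |φ u x| ≤ M

theorem IsBoundedIndex.sub {φ ψ : ℝ → ℝ → ℝ} (hφ : IsBoundedIndex φ) (hψ : IsBoundedIndex ψ) :
    IsBoundedIndex (φ - ψ) := by
  obtain ⟨hφm, M, hM⟩ := hφ
  obtain ⟨hψm, N, hN⟩ := hψ
  refine ⟨Measurable.sub hφm hψm, M + N, fun u hu x hx => ?_⟩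
  exact (abs_sub _ _).trans (add_le_add (hM u hu x hx) (hN u hu x hx))

/-- The values of φ off the rectangle are arbitrary; measurability in u of integrals over x calls
for a function measurable on the whole plane. -/
theorem IsBoundedIndex.exists_extension {φ : ℝ → ℝ → ℝ} (hφ : IsBoundedIndex φ) :
    ∃ ψ : ℝ → ℝ → ℝ, Measurable (Function.uncurry ψ) ∧ (∃ M : ℝ, ∀ u x, |ψ u x| ≤ M) ∧
      ∀ u ∈ Icc (0 : ℝ) 1, ∀ x ∈ Icc (-Real.pi) Real.pi, ψ u x = φ u x := by
  obtain ⟨hm, M, hM⟩ := hφ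
  set box : Set (ℝ × ℝ) := Icc (0 : ℝ) 1 ×ˢ Icc (-Real.pi) Real.pi
  have hbox : MeasurableSet box := measurableSet_Icc.prod measurableSet_Icc
  obtain ⟨g, hg, hgφ⟩ := (MeasurableEmbedding.subtype_coe hbox).exists_measurable_extend hm
    fun _ => inferInstance
  have hgv : ∀ p ∈ box, g p = φ p.1 p.2 := fun p hp => congrFun hgφ ⟨p, hp⟩
  refine ⟨fun u x => box.indicator g (u, x), hg.indicator hbox, ⟨M, fun u x => ?_⟩,
    fun u hu x hx => ?_⟩
  · by_cases hp : (u, x) ∈ box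
    · simp only [indicator_of_mem hp, hgv _ hp]
      exact hM u hp.1 x hp.2
    · simp only [indicator_of_notMem hp, abs_zero]
      exact (abs_nonneg _).trans (hM 0 ⟨le_rfl, zero_le_one⟩ 0
        ⟨by linarith [Real.pi_pos], Real.pi_pos.le⟩)
  · have hp : (u, x) ∈ box := ⟨hu, hx⟩
    simp only [indicator_of_mem hp, hgv _ hp]

theorem fourierCoef_congr {φ ψ : ℝ → ℝ → ℝ} {u : ℝ}
    (h : ∀ x ∈ Icc (-Real.pi) Real.pi, ψ u x = φ u x) (j : ℤ) :
    fourierCoef ψ u j = fourierCoef φ u j := by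
  refine intervalIntegral.integral_congr fun x hx => ?_
  rw [uIcc_of_le neg_pi_lt_pi.le] at hx
  simp only [h x hx]

theorem norm_fourierCoef_le {ψ : ℝ → ℝ → ℝ} {M : ℝ} {u : ℝ} (hM : ∀ x, |ψ u x| ≤ M) (j : ℤ) :
    ‖fourierCoef ψ u j‖ ≤ M * (2 * Real.pi) := by
  have h1 := intervalIntegral.norm_integral_le_of_norm_le_const (a := -Real.pi) (b := Real.pi)
    (f := fun x : ℝ => (ψ u x : ℂ) * Complex.exp (Complex.I * x * j)) (C := M) fun x _ => by
      rw [norm_mul, norm_exp_I_mul_intCast, mul_one, Complex.norm_real]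
      exact hM x
  rwa [sub_neg_eq_add, ← two_mul, abs_of_pos (by positivity)] at h1

theorem measurable_fourierCoef {ψ : ℝ → ℝ → ℝ} (hψ : Measurable (Function.uncurry ψ)) (j : ℤ) :
    Measurable fun u => fourierCoef ψ u j := by
  have h1 : StronglyMeasurable fun p : ℝ × ℝ =>
      (ψ p.1 p.2 : ℂ) * Complex.exp (Complex.I * p.2 * j) := by
    refine Measurable.stronglyMeasurable ?_
    have : Measurable fun p : ℝ × ℝ => ψ p.1 p.2 := hψ
    fun_prop
  simp only [fourierCoef, intervalIntegral.integral_of_le neg_pi_lt_pi.le]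
  exact h1.integral_prod_right'.measurable

/-- The energy `∫ φ(u, x)² dx`. -/
def energy (φ : ℝ → ℝ → ℝ) (u : ℝ) : ℝ := ∫ x in (-Real.pi)..Real.pi, φ u x ^ 2

theorem energy_congr {φ ψ : ℝ → ℝ → ℝ} {u : ℝ}
    (h : ∀ x ∈ Icc (-Real.pi) Real.pi, ψ u x = φ u x) : energy ψ u = energy φ u := by
  refine intervalIntegral.integral_congr fun x hx => ?_
  rw [uIcc_of_le neg_pi_lt_pi.le] at hx
  simp only [h x hx]

theorem energy_nonneg (φ : ℝ → ℝ → ℝ) (u : ℝ) : 0 ≤ energy φ u :=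
  intervalIntegral.integral_nonneg neg_pi_lt_pi.le fun _ _ => sq_nonneg _

theorem rho2_sq (φ : ℝ → ℝ → ℝ) : rho2 φ ^ 2 = ∫ u in (0 : ℝ)..1, energy φ u :=
  Real.sq_sqrt (intervalIntegral.integral_nonneg zero_le_one fun u _ => energy_nonneg φ u)

namespace IsBoundedIndex

variable {φ : ℝ → ℝ → ℝ}

theorem memLp_two (hφ : IsBoundedIndex φ) {u : ℝ} (hu : u ∈ Icc (0 : ℝ) 1) :
    MemLp (fun x => (φ u x : ℂ)) 2 (volume.restrict (Ioc (-Real.pi) Real.pi)) := by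
  obtain ⟨ψ, hψ, ⟨M, hM⟩, heq⟩ := hφ.exists_extension
  have h1 : MemLp (fun x => (ψ u x : ℂ)) 2 (volume.restrict (Ioc (-Real.pi) Real.pi)) := by
    refine MemLp.of_bound (Measurable.aestronglyMeasurable ?_) M (ae_of_all _ fun x => ?_)
    · exact Complex.measurable_ofReal.comp (hψ.comp measurable_prodMk_left)
    · rw [Complex.norm_real]
      exact hM u x
  refine h1.ae_eq ?_
  rw [EventuallyEq, ae_restrict_iff' measurableSet_Ioc]
  exact ae_of_all _ fun x hx => by rw [heq u hu x (Ioc_subset_Icc_self hx)]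

theorem intervalIntegrable (hφ : IsBoundedIndex φ) {u : ℝ} (hu : u ∈ Icc (0 : ℝ) 1) :
    IntervalIntegrable (φ u) volume (-Real.pi) Real.pi := by
  have h1 := (hφ.memLp_two hu).integrable (by norm_num)
  rw [intervalIntegrable_iff_integrableOn_Ioc_of_le neg_pi_lt_pi.le]
  have h2 := h1.re
  simp only [RCLike.re_to_complex, Complex.ofReal_re] at h2
  exact h2

theorem integrableOn_fourierCoef (hφ : IsBoundedIndex φ) (j : ℤ) :
    IntegrableOn (fun u => fourierCoef φ u j) (Icc 0 1) := by
  obtain ⟨ψ, hψ, ⟨M, hM⟩, heq⟩ := hφ.exists_extension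
  have h1 : IntegrableOn (fun u => fourierCoef ψ u j) (Icc 0 1) :=
    Integrable.of_bound (measurable_fourierCoef hψ j).aestronglyMeasurable (M * (2 * Real.pi))
      (ae_of_all _ fun u => norm_fourierCoef_le (hM u) j)
  exact h1.congr_fun (fun u hu => fourierCoef_congr (heq u hu) j) measurableSet_Icc

theorem integrableOn_sq_norm_fourierCoef (hφ : IsBoundedIndex φ) (j : ℤ) :
    IntegrableOn (fun u => ‖fourierCoef φ u j‖ ^ 2) (Icc 0 1) := by
  obtain ⟨ψ, hψ, ⟨M, hM⟩, heq⟩ := hφ.exists_extension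
  have h1 : IntegrableOn (fun u => ‖fourierCoef ψ u j‖ ^ 2) (Icc 0 1) := by
    refine Integrable.of_bound ((measurable_fourierCoef hψ j).norm.pow_const 2).aestronglyMeasurable
      ((M * (2 * Real.pi)) ^ 2) (ae_of_all _ fun u => ?_)
    rw [norm_pow, norm_norm]
    exact pow_le_pow_left₀ (norm_nonneg _) (norm_fourierCoef_le (hM u) j) 2
  refine h1.congr_fun (fun u hu => ?_) measurableSet_Icc
  simp only [fourierCoef_congr (heq u hu) j]

theorem integrableOn_energy (hφ : IsBoundedIndex φ) : IntegrableOn (energy φ) (Icc 0 1) := by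
  obtain ⟨ψ, hψ, ⟨M, hM⟩, heq⟩ := hφ.exists_extension
  have hm : Measurable (energy ψ) := by
    have h1 : StronglyMeasurable fun p : ℝ × ℝ => ψ p.1 p.2 ^ 2 :=
      (Measurable.pow_const (f := Function.uncurry ψ) hψ 2).stronglyMeasurable
    have h2 : energy ψ = fun u => ∫ x in Ioc (-Real.pi) Real.pi, ψ u x ^ 2 := by
      ext u
      rw [energy, intervalIntegral.integral_of_le neg_pi_lt_pi.le]
    rw [h2]
    exact h1.integral_prod_right'.measurable
  have h1 : IntegrableOn (energy ψ) (Icc 0 1) := by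
    refine Integrable.of_bound hm.aestronglyMeasurable (M ^ 2 * |Real.pi - -Real.pi|)
      (ae_of_all _ fun u => ?_)
    refine intervalIntegral.norm_integral_le_of_norm_le_const fun x _ => ?_
    rw [norm_pow, Real.norm_eq_abs]
    exact pow_le_pow_left₀ (abs_nonneg _) (hM u x) 2
  exact h1.congr_fun (fun u hu => energy_congr (heq u hu)) measurableSet_Icc

theorem fourierCoef_sub {ψ : ℝ → ℝ → ℝ} (hφ : IsBoundedIndex φ) (hψ : IsBoundedIndex ψ) {u : ℝ}
    (hu : u ∈ Icc (0 : ℝ) 1) (j : ℤ) :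
    fourierCoef (φ - ψ) u j = fourierCoef φ u j - fourierCoef ψ u j := by
  have h1 := hφ.intervalIntegrable hu
  have h2 := hψ.intervalIntegrable hu
  simp only [fourierCoef, Pi.sub_apply, Complex.ofReal_sub, sub_mul]
  exact intervalIntegral.integral_sub (intervalIntegrable_mul_exp ⟨h1.1.ofReal, h1.2.ofReal⟩ j)
    (intervalIntegrable_mul_exp ⟨h2.1.ofReal, h2.2.ofReal⟩ j)

end IsBoundedIndex

/-- The average over `u ∈ ((t - 1) / n, t / n]` of the Fourier coefficient of order `-k`. -/
def avgCoef (n : ℕ) (φ : ℝ → ℝ → ℝ) (t k : ℤ) : ℂ :=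
  (n : ℂ) * ∫ u in ((t - 1 : ℝ) / n)..((t : ℝ) / n), fourierCoef φ u (-k)

theorem avgCoef_neg (n : ℕ) (φ : ℝ → ℝ → ℝ) (t k : ℤ) :
    avgCoef n φ t (-k) = starRingEnd ℂ (avgCoef n φ t k) := by
  have hle : (t - 1 : ℝ) / n ≤ (t : ℝ) / n := by gcongr; linarith
  rw [avgCoef, avgCoef, map_mul, intervalIntegral.integral_of_le hle,
    intervalIntegral.integral_of_le hle, ← integral_conj]
  congr 1
  · simp
  · simp_rw [fourierCoef_neg φ _ (-k)]

theorem cell_subset {n : ℕ} {t : ℤ} (ht : t ∈ Finset.Icc (1 : ℤ) n) :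
    Icc ((t - 1 : ℝ) / n) ((t : ℝ) / n) ⊆ Icc (0 : ℝ) 1 := by
  refine Icc_subset_Icc ?_ (div_mem_Icc ht).2
  have h1 : (1 : ℝ) ≤ t := by exact_mod_cast (Finset.mem_Icc.1 ht).1
  have : (0 : ℝ) ≤ t - 1 := by linarith
  positivity

theorem cell_le (n : ℕ) (t : ℤ) : (t - 1 : ℝ) / n ≤ (t : ℝ) / n := by
  gcongr
  linarith

theorem intervalIntegrable_cell {E : Type*} [NormedAddCommGroup E] {f : ℝ → E}
    (hf : IntegrableOn f (Icc 0 1)) {n : ℕ} {t : ℤ} (ht : t ∈ Finset.Icc (1 : ℤ) n) :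
    IntervalIntegrable f volume ((t - 1 : ℝ) / n) ((t : ℝ) / n) := by
  rw [intervalIntegrable_iff_integrableOn_Icc_of_le (cell_le n t)]
  exact hf.mono_set (cell_subset ht)

theorem avgCoef_sub {n : ℕ} {φ ψ : ℝ → ℝ → ℝ} (hφ : IsBoundedIndex φ) (hψ : IsBoundedIndex ψ)
    {t : ℤ} (ht : t ∈ Finset.Icc (1 : ℤ) n) (k : ℤ) :
    avgCoef n (φ - ψ) t k = avgCoef n φ t k - avgCoef n ψ t k := by
  rw [avgCoef, avgCoef, avgCoef, ← mul_sub, ← intervalIntegral.integral_sub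
    (intervalIntegrable_cell (hφ.integrableOn_fourierCoef _) ht)
    (intervalIntegrable_cell (hψ.integrableOn_fourierCoef _) ht)]
  congr 1
  refine intervalIntegral.integral_congr fun u hu => ?_
  rw [uIcc_of_le (cell_le n t)] at hu
  exact hφ.fourierCoef_sub hψ (cell_subset ht hu) _

theorem sq_intervalIntegral_le {f : ℝ → ℝ} {a b : ℝ} (hab : a ≤ b)
    (hf : IntervalIntegrable f volume a b)
    (hf2 : IntervalIntegrable (fun x => f x ^ 2) volume a b) :
    (∫ x in a..b, f x) ^ 2 ≤ (b - a) * ∫ x in a..b, f x ^ 2 := by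
  rcases hab.eq_or_lt with rfl | hlt
  · simp
  set I := ∫ x in a..b, f x
  have h0 : 0 ≤ ∫ x in a..b, ((b - a) * f x - I) ^ 2 :=
    intervalIntegral.integral_nonneg hab fun x _ => sq_nonneg _
  have h1 : ∀ x, ((b - a) * f x - I) ^ 2
      = (b - a) ^ 2 * f x ^ 2 - 2 * (b - a) * I * f x + I ^ 2 := fun x => by ring
  simp_rw [h1] at h0
  rw [intervalIntegral.integral_add ((hf2.const_mul _).sub (hf.const_mul _))
    intervalIntegrable_const, intervalIntegral.integral_sub (hf2.const_mul _) (hf.const_mul _),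
    intervalIntegral.integral_const_mul, intervalIntegral.integral_const_mul,
    intervalIntegral.integral_const, smul_eq_mul] at h0
  have h2 : 0 < b - a := sub_pos.2 hlt
  have h3 : 0 ≤ (b - a) * ((b - a) * (∫ x in a..b, f x ^ 2) - I ^ 2) := by
    calc 0 ≤ _ := h0
      _ = _ := by simp only [I]; ring
  have := nonneg_of_mul_nonneg_right h3 h2
  linarith

theorem sum_Icc_one_eq_sum_range {M : Type*} [AddCommMonoid M] (n : ℕ) (f : ℤ → M) :
    ∑ t ∈ Finset.Icc (1 : ℤ) n, f t = ∑ i ∈ Finset.range n, f (i + 1) := by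
  refine Finset.sum_bij' (fun t _ => (t - 1).toNat) (fun i _ => (i : ℤ) + 1) ?_ ?_ ?_ ?_ ?_
  · intro t ht
    rw [Finset.mem_Icc] at ht
    rw [Finset.mem_range]
    omega
  · intro i hi
    rw [Finset.mem_range] at hi
    rw [Finset.mem_Icc]
    omega
  · intro t ht
    rw [Finset.mem_Icc] at ht
    omega
  · intro i _
    simp
  · intro t ht
    rw [Finset.mem_Icc] at ht
    congr 1
    omega

theorem sum_integral_cell {f : ℝ → ℝ} (hf : IntegrableOn f (Icc 0 1)) {n : ℕ} (hn : 1 ≤ n) :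
    ∑ t ∈ Finset.Icc (1 : ℤ) n, ∫ u in ((t - 1 : ℝ) / n)..((t : ℝ) / n), f u
      = ∫ u in (0 : ℝ)..1, f u := by
  have hn0 : (n : ℝ) ≠ 0 := by positivity
  rw [sum_Icc_one_eq_sum_range]
  have h1 := intervalIntegral.sum_integral_adjacent_intervals (μ := volume) (f := f)
    (a := fun i : ℕ => (i : ℝ) / n) (n := n) fun i hi => by
      have := intervalIntegrable_cell hf (n := n) (t := (i : ℤ) + 1)
        (Finset.mem_Icc.2 ⟨by omega, by omega⟩)
      simpa using this
  simp only [Nat.cast_zero, zero_div, div_self hn0] at h1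
  rw [← h1]
  refine Finset.sum_congr rfl fun i _ => ?_
  push_cast
  rw [add_sub_cancel_right]

/-- This is the purpose of averaging. Cauchy-Schwarz on a cell of length 1/n bounds |average|² by
the average of |φ̂|², and Bessel's inequality at each u bounds the sum over k by 2π times the
energy. The cells then add up to ρ₂², with no discretisation error. -/
theorem sum_sq_norm_avgCoef_le {φ : ℝ → ℝ → ℝ} (hφ : IsBoundedIndex φ) {n : ℕ} (hn : 1 ≤ n) :
    ∑ t ∈ Finset.Icc (1 : ℤ) n, ∑ k ∈ Finset.Icc (-(n : ℤ)) n, ‖avgCoef n φ t k‖ ^ 2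
      ≤ 2 * Real.pi * n * rho2 φ ^ 2 := by
  have hn0 : (0 : ℝ) < n := by exact_mod_cast hn
  rw [rho2_sq, ← sum_integral_cell hφ.integrableOn_energy hn, Finset.mul_sum]
  refine Finset.sum_le_sum fun t ht => ?_
  have hk : ∀ k : ℤ, ‖avgCoef n φ t k‖ ^ 2
      ≤ n * ∫ u in ((t - 1 : ℝ) / n)..((t : ℝ) / n), ‖fourierCoef φ u (-k)‖ ^ 2 := by
    intro k
    have h1 : ‖∫ u in ((t - 1 : ℝ) / n)..((t : ℝ) / n), fourierCoef φ u (-k)‖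
        ≤ ∫ u in ((t - 1 : ℝ) / n)..((t : ℝ) / n), ‖fourierCoef φ u (-k)‖ :=
      intervalIntegral.norm_integral_le_integral_norm (cell_le n t)
    have h2 := sq_intervalIntegral_le (cell_le n t)
      (intervalIntegrable_cell (hφ.integrableOn_fourierCoef (-k)).norm ht)
      (intervalIntegrable_cell (hφ.integrableOn_sq_norm_fourierCoef (-k)) ht)
    have h3 : (t : ℝ) / n - (t - 1) / n = 1 / n := by ring
    rw [h3] at h2
    rw [avgCoef, norm_mul, mul_pow, Complex.norm_natCast]
    calc _ ≤ (n : ℝ) ^ 2 * (∫ u in ((t - 1 : ℝ) / n)..((t : ℝ) / n), ‖fourierCoef φ u (-k)‖) ^ 2 := by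
          gcongr
      _ ≤ (n : ℝ) ^ 2 *
          (1 / n * ∫ u in ((t - 1 : ℝ) / n)..((t : ℝ) / n), ‖fourierCoef φ u (-k)‖ ^ 2) := by
          gcongr
      _ = _ := by field_simp
  refine (Finset.sum_le_sum fun k _ => hk k).trans ?_
  rw [← Finset.mul_sum, ← intervalIntegral.integral_finsetSum fun k _ =>
    intervalIntegrable_cell (hφ.integrableOn_sq_norm_fourierCoef (-k)) ht]
  have h4 : ∫ u in ((t - 1 : ℝ) / n)..((t : ℝ) / n),
      ∑ k ∈ Finset.Icc (-(n : ℤ)) n, ‖fourierCoef φ u (-k)‖ ^ 2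
      ≤ ∫ u in ((t - 1 : ℝ) / n)..((t : ℝ) / n), 2 * Real.pi * energy φ u := by
    refine intervalIntegral.integral_mono_on (cell_le n t) ?_ ?_ fun u hu => ?_
    · exact ⟨integrable_finsetSum _ fun k _ =>
          (intervalIntegrable_cell (hφ.integrableOn_sq_norm_fourierCoef (-k)) ht).1,
        integrable_finsetSum _ fun k _ =>
          (intervalIntegrable_cell (hφ.integrableOn_sq_norm_fourierCoef (-k)) ht).2⟩
    · exact (intervalIntegrable_cell hφ.integrableOn_energy ht).const_mul _
    · exact sum_sq_norm_fourierCoef_le (hφ.memLp_two (cell_subset ht hu)) _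
  rw [intervalIntegral.integral_const_mul] at h4
  calc _ ≤ (n : ℝ) * (2 * Real.pi * ∫ u in ((t - 1 : ℝ) / n)..((t : ℝ) / n), energy φ u) := by
        gcongr
    _ = _ := by ring

theorem sum_eVariationOn_cell_le {E : Type*} [PseudoEMetricSpace E] (f : ℝ → E) {n : ℕ}
    (hn : 1 ≤ n) :
    ∑ t ∈ Finset.Icc (1 : ℤ) n, eVariationOn f (Icc ((t - 1 : ℝ) / n) ((t : ℝ) / n))
      ≤ eVariationOn f (Icc 0 1) := by
  have hn0 : (n : ℝ) ≠ 0 := by positivity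
  rw [sum_Icc_one_eq_sum_range]
  have h : ∀ m : ℕ, ∑ i ∈ Finset.range m,
      eVariationOn f (Icc (((((i : ℤ) + 1 : ℤ) : ℝ) - 1) / n) ((((i : ℤ) + 1 : ℤ) : ℝ) / n))
      ≤ eVariationOn f (Icc 0 ((m : ℝ) / n)) := by
    intro m
    induction m with
    | zero => simp
    | succ m ih =>
      rw [Finset.sum_range_succ]
      have h1 : ((((m : ℤ) + 1 : ℤ) : ℝ) - 1) / n = (m : ℝ) / n := by push_cast; ring
      have h2 : ((((m : ℤ) + 1 : ℤ)) : ℝ) / n = ((m + 1 : ℕ) : ℝ) / n := by push_cast; ring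
      rw [h1, h2]
      have h3 := eVariationOn.Icc_add_Icc f (s := univ) (a := 0) (b := (m : ℝ) / n)
        (c := ((m + 1 : ℕ) : ℝ) / n) (by positivity) (by gcongr; simp) (mem_univ _)
      simp only [univ_inter] at h3
      rw [← h3]
      gcongr
  have := h n
  rwa [div_self hn0] at this

/-- The difference is the mean over the cell of φ̂(t/n) - φ̂(u), and each such increment is bounded
by the variation over the cell. -/
theorem enorm_sub_avgCoef_le {φ : ℝ → ℝ → ℝ} (hφ : IsBoundedIndex φ) {n : ℕ} (hn : 1 ≤ n) {t : ℤ}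
    (ht : t ∈ Finset.Icc (1 : ℤ) n) (k : ℤ) :
    ‖fourierCoef φ ((t : ℝ) / n) (-k) - avgCoef n φ t k‖ₑ
      ≤ eVariationOn (fun u => fourierCoef φ u (-k)) (Icc ((t - 1 : ℝ) / n) ((t : ℝ) / n)) := by
  have hn0 : (0 : ℝ) < n := by exact_mod_cast hn
  set f : ℝ → ℂ := fun u => fourierCoef φ u (-k) with hf
  rcases eq_or_ne (eVariationOn f (Icc ((t - 1 : ℝ) / n) ((t : ℝ) / n))) ⊤ with htop | htop
  · rw [htop]
    exact le_top
  set v := (eVariationOn f (Icc ((t - 1 : ℝ) / n) ((t : ℝ) / n))).toReal with hv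
  have hlen : (t : ℝ) / n - (t - 1) / n = 1 / n := by ring
  have h1 : fourierCoef φ ((t : ℝ) / n) (-k) - avgCoef n φ t k
      = (n : ℂ) * ∫ u in ((t - 1 : ℝ) / n)..((t : ℝ) / n), (f ((t : ℝ) / n) - f u) := by
    rw [intervalIntegral.integral_sub intervalIntegrable_const
      (intervalIntegrable_cell (hφ.integrableOn_fourierCoef _) ht),
      intervalIntegral.integral_const, hlen, mul_sub, avgCoef, Complex.real_smul]
    congr 1
    have : (n : ℂ) ≠ 0 := by exact_mod_cast hn0.ne'
    push_cast
    field_simp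
    rfl
  have h2 : ‖∫ u in ((t - 1 : ℝ) / n)..((t : ℝ) / n), (f ((t : ℝ) / n) - f u)‖ ≤ v * |1 / (n : ℝ)| := by
    rw [← hlen]
    refine intervalIntegral.norm_integral_le_of_norm_le_const fun u hu => ?_
    rw [uIoc_of_le (cell_le n t)] at hu
    have h3 := eVariationOn.edist_le f (right_mem_Icc.2 (cell_le n t)) (Ioc_subset_Icc_self hu)
    rw [← dist_eq_norm, dist_edist]
    exact ENNReal.toReal_mono htop h3
  have h4 : ‖fourierCoef φ ((t : ℝ) / n) (-k) - avgCoef n φ t k‖ ≤ v := by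
    rw [h1, norm_mul, Complex.norm_natCast]
    calc _ ≤ (n : ℝ) * (v * |1 / (n : ℝ)|) := by gcongr
      _ = v := by
        rw [abs_of_pos (by positivity)]
        field_simp
  rw [← ofReal_norm]
  exact ENNReal.ofReal_le_of_le_toReal h4

/-- For fixed k the variations over the cells sum to at most the variation over [0, 1]; summing over
k gives v_Σ, independently of n. -/
theorem sum_norm_sub_avgCoef_le {φ : ℝ → ℝ → ℝ} (hφ : IsBoundedIndex φ) {n : ℕ} (hn : 1 ≤ n)
    {vS : ℝ≥0} (hv : vSigma φ ≤ vS) :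
    ∑ t ∈ Finset.Icc (1 : ℤ) n, ∑ k ∈ lags n t,
      ‖fourierCoef φ ((t : ℝ) / n) (-k) - avgCoef n φ t k‖ ≤ vS := by
  have h1 : ∑ t ∈ Finset.Icc (1 : ℤ) n, ∑ k ∈ lags n t,
      ‖fourierCoef φ ((t : ℝ) / n) (-k) - avgCoef n φ t k‖ₑ ≤ vS := by
    calc _ ≤ ∑ t ∈ Finset.Icc (1 : ℤ) n, ∑ k ∈ Finset.Icc (-(n : ℤ)) n,
          ‖fourierCoef φ ((t : ℝ) / n) (-k) - avgCoef n φ t k‖ₑ :=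
          Finset.sum_le_sum fun t _ =>
            Finset.sum_le_sum_of_subset (Finset.filter_subset _ _)
      _ ≤ ∑ t ∈ Finset.Icc (1 : ℤ) n, ∑ k ∈ Finset.Icc (-(n : ℤ)) n,
          eVariationOn (fun u => fourierCoef φ u (-k))
            (Icc ((t - 1 : ℝ) / n) ((t : ℝ) / n)) :=
          Finset.sum_le_sum fun t ht => Finset.sum_le_sum fun k _ =>
            enorm_sub_avgCoef_le hφ hn ht k
      _ = ∑ k ∈ Finset.Icc (-(n : ℤ)) n, ∑ t ∈ Finset.Icc (1 : ℤ) n,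
          eVariationOn (fun u => fourierCoef φ u (-k))
            (Icc ((t - 1 : ℝ) / n) ((t : ℝ) / n)) := Finset.sum_comm
      _ ≤ ∑ k ∈ Finset.Icc (-(n : ℤ)) n,
          eVariationOn (fun u => fourierCoef φ u (-k)) (Icc 0 1) :=
          Finset.sum_le_sum fun k _ => sum_eVariationOn_cell_le _ hn
      _ ≤ ∑' k : ℤ, eVariationOn (fun u => fourierCoef φ u (-k)) (Icc 0 1) :=
          ENNReal.sum_le_tsum _
      _ = vSigma φ := (Equiv.neg ℤ).tsum_eq
          fun k => eVariationOn (fun u => fourierCoef φ u k) (Icc 0 1)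
      _ ≤ vS := hv
  have h2 : (∑ t ∈ Finset.Icc (1 : ℤ) n, ∑ k ∈ lags n t,
      ‖fourierCoef φ ((t : ℝ) / n) (-k) - avgCoef n φ t k‖₊) ≤ vS := by
    have h3 : ((∑ t ∈ Finset.Icc (1 : ℤ) n, ∑ k ∈ lags n t,
      ‖fourierCoef φ ((t : ℝ) / n) (-k) - avgCoef n φ t k‖₊ : ℝ≥0) : ℝ≥0∞) ≤ vS := by
      push_cast
      exact h1
    exact ENNReal.coe_le_coe.1 h3
  have h3 := NNReal.coe_le_coe.2 h2
  push_cast at h3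
  exact h3

/-! ### The empirical process at time-averaged coefficients -/

section Stationary

variable {Ω : Type*} [MeasurableSpace Ω] {P : Measure Ω} {κ K : ℝ} {X : ℕ → ℤ → Ω → ℝ}

/-- The empirical process evaluated at the time-averaged version of `φ`. -/
def avgSeries (P : Measure Ω) (X : ℕ → ℤ → Ω → ℝ) (n : ℕ) (φ : ℝ → ℝ → ℝ) (ω : Ω) : ℂ :=
  coefSeries P X n (avgCoef n φ) ω

theorem avgSeries_sub {φ ψ : ℝ → ℝ → ℝ} (hφ : IsBoundedIndex φ) (hψ : IsBoundedIndex ψ) (n : ℕ)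
    (ω : Ω) : avgSeries P X n (φ - ψ) ω = avgSeries P X n φ ω - avgSeries P X n ψ ω := by
  rw [avgSeries, avgSeries, avgSeries, ← coefSeries_sub, coefSeries, coefSeries]
  congr 1
  exact lagForm_congr _ fun t ht k _ => avgCoef_sub hφ hψ ht k

theorem measureReal_avgSeries_ge_le (h : IsGaussianLocallyStationary P κ K X) {c₁ c₂ : ℝ}
    (hc₁ : 0 < c₁) (hc₂ : 0 < c₂) (hexp : ExpInequality P X c₁ c₂) {n : ℕ} (hn : 1 ≤ n)
    {φ : ℝ → ℝ → ℝ} (hφ : IsBoundedIndex φ) {r η : ℝ} (hr : rho2 φ ≤ r) (hη : 0 < η) :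
    P.real {ω | η ≤ ‖avgSeries P X n φ ω‖} ≤ c₁ * Real.exp (-(c₂ * (η / r))) := by
  have hρ0 : 0 ≤ rho2 φ := Real.sqrt_nonneg _
  refine measureReal_coefSeries_ge_le h hc₁ hc₂ hexp hn (avgCoef_neg n φ) (hρ0.trans hr) hη
    ((sum_sq_norm_avgCoef_le hφ hn).trans ?_)
  gcongr

theorem IsGaussianLocallyStationary.norm_avgSeries_le [IsProbabilityMeasure P]
    (h : IsGaussianLocallyStationary P κ K X) (hκ : 0 < κ) (hK : 0 < K) {n : ℕ} (hn : 2 ≤ n)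
    {ω : Ω} (hω : ω ∈ boundedEvent X (K * ellSum κ) n) {φ : ℝ → ℝ → ℝ} (hφ : IsBoundedIndex φ) :
    ‖avgSeries P X n φ ω‖ ≤ 18 * (K * ellSum κ) ^ 2 * n * Real.log n * rho2 φ := by
  have hlog : 0 ≤ Real.log n := Real.log_natCast_nonneg n
  have hρ0 : 0 ≤ rho2 φ := Real.sqrt_nonneg _
  have hn0 : (0 : ℝ) < n := by positivity
  have h1 := norm_coefSeries_le (b := 6 * (K * ellSum κ) ^ 2 * Real.log n) (by positivity)
    (fun i j a b c d => h.abs_centredProd_le hκ hK hn hω a b c d) (avgCoef n φ)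
  have h2 := sum_lags_norm_le _ hρ0 (sum_sq_norm_avgCoef_le hφ (by omega : 1 ≤ n))
  -- Together with the constant 6 from the bound on the centred products this yields 18 = 6 · 3.
  have h3 : Real.sqrt (2 * Real.pi) ≤ 3 := by
    rw [Real.sqrt_le_left (by norm_num)]
    linarith [Real.pi_le_four]
  have h4 : 0 < Real.sqrt n := Real.sqrt_pos.2 hn0
  calc _ ≤ _ := h1
    _ ≤ 6 * (K * ellSum κ) ^ 2 * Real.log n / Real.sqrt n *
        (3 * (n * Real.sqrt n) * rho2 φ) := by
        refine mul_le_mul_of_nonneg_left (h2.trans ?_) (by positivity)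
        gcongr
    _ = _ := by field_simp; ring

theorem IsGaussianLocallyStationary.norm_En_sub_avgSeries_le [IsProbabilityMeasure P]
    (h : IsGaussianLocallyStationary P κ K X) (hκ : 0 < κ) (hK : 0 < K) {n : ℕ} (hn : 2 ≤ n)
    {ω : Ω} (hω : ω ∈ boundedEvent X (K * ellSum κ) n) {φ : ℝ → ℝ → ℝ} (hφ : IsBoundedIndex φ)
    {vS : ℝ≥0} (hv : vSigma φ ≤ vS) :
    ‖En P X n φ ω - avgSeries P X n φ ω‖
      ≤ 6 * (K * ellSum κ) ^ 2 * vS * (Real.log n / Real.sqrt n) := by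
  have hlog : 0 ≤ Real.log n := Real.log_natCast_nonneg n
  have hn1 : 1 ≤ n := by omega
  rw [En_eq_lagForm hn1 (h.integrable_mul n)
    fun t ht => hφ.intervalIntegrable (div_mem_Icc ht), avgSeries, ← coefSeries, ← coefSeries_sub]
  refine (norm_coefSeries_le (b := 6 * (K * ellSum κ) ^ 2 * Real.log n) (by positivity)
    (fun i j a b c d => h.abs_centredProd_le hκ hK hn hω a b c d) _).trans ?_
  calc _ ≤ 6 * (K * ellSum κ) ^ 2 * Real.log n / Real.sqrt n * vS :=
        mul_le_mul_of_nonneg_left (sum_norm_sub_avgCoef_le hφ hn1 hv) (by positivity)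
    _ = _ := by ring

end Stationary

end EmpSpectral

end

noncomputable section

namespace EmpSpectral

/-! ### Chaining -/

/-- A real majorant makes the entropy finite, so admissible cardinalities exist, and the least one
is attained by well-ordering. -/
theorem exists_net {Φ : Set (ℝ → ℝ → ℝ)} {r h : ℝ} (hr : metricEntropy r Φ ≤ (h : EReal)) :
    ∃ m : ℕ, 1 ≤ m ∧ (m : ℝ) ≤ Real.exp h ∧ ∃ c : Fin m → ℝ → ℝ → ℝ,
      (∀ i, c i ∈ Φ) ∧ ∀ φ ∈ Φ, ∃ i, rho2 (φ - c i) < r := by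
  classical
  set S : Set ℕ := {m : ℕ | 1 ≤ m ∧ ∃ c : Fin m → ℝ → ℝ → ℝ,
    (∀ i, c i ∈ Φ) ∧ ∀ φ ∈ Φ, ∃ i, rho2 (φ - c i) < r} with hS
  have hcov : coveringNumber r Φ = ⨅ m ∈ S, (m : ℕ∞) := rfl
  have hne : S.Nonempty := by
    by_contra hemp
    rw [Set.not_nonempty_iff_eq_empty] at hemp
    rw [metricEntropy, hcov, hemp] at hr
    simp at hr
  have hle : ((sInf S : ℕ) : ℕ∞) ≤ coveringNumber r Φ := by
    rw [hcov]
    exact le_iInf₂ fun m hm => by exact_mod_cast Nat.sInf_le hm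
  obtain ⟨h1, c, hc⟩ := Nat.sInf_mem hne
  refine ⟨sInf S, h1, ?_, c, hc⟩
  have h2 : ENNReal.log ((sInf S : ℕ) : ℝ≥0∞) ≤ (h : EReal) := by
    refine le_trans (ENNReal.log_monotone ?_) hr
    have := ENat.toENNReal_mono hle
    simpa using this
  have h3 := EReal.exp_monotone h2
  rw [ENNReal.exp_log, EReal.exp_coe] at h3
  have h4 := ENNReal.toReal_mono ENNReal.ofReal_ne_top h3
  rwa [ENNReal.toReal_ofReal (Real.exp_pos _).le, ENNReal.toReal_natCast] at h4

theorem measureReal_iUnion_fin_le {Ω : Type*} [MeasurableSpace Ω] {P : Measure Ω} {m : ℕ} {E : Fin m → Set Ω} 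
    {b p : ℝ} (hm : (m : ℝ) ≤ b)
    (hp : 0 ≤ p) (h : ∀ i, P.real (E i) ≤ p) : P.real (⋃ i, E i) ≤ b * p := by
  calc P.real (⋃ i, E i) ≤ ∑ i, P.real (E i) := measureReal_iUnion_fintype_le _
    _ ≤ ∑ _i : Fin m, p := Finset.sum_le_sum fun i _ => h i
    _ = m * p := by simp
    _ ≤ b * p := by gcongr

section Chain

variable {T Ω : Type*} [MeasurableSpace Ω] {P : Measure Ω} [IsProbabilityMeasure P]
  {G : T → Ω → ℂ} {d : T → T → ℝ} {Φ : Set T} {c₁ c₂ τ : ℝ}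

/-- The chaining bound along finite nets `c j` of mesh `r j`, for the points of the last net. -/
theorem measureReal_net_ge_le (hc₁ : 0 < c₁)
    (hG : ∀ φ ∈ Φ, ∀ x > 0, P.real {ω | x ≤ ‖G φ ω‖} ≤ c₁ * Real.exp (-(c₂ * (x / τ))))
    (hinc : ∀ φ ∈ Φ, ∀ ψ ∈ Φ, ∀ r, d φ ψ ≤ r → ∀ x > 0,
      P.real {ω | x ≤ ‖G φ ω - G ψ ω‖} ≤ c₁ * Real.exp (-(c₂ * (x / r))))
    {m : ℕ → ℕ} {b r y : ℕ → ℝ} (hm : ∀ j, (m j : ℝ) ≤ b j) (hy : ∀ j, 0 < y j)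
    (c : ∀ j, Fin (m j) → T) (hc : ∀ j i, c j i ∈ Φ)
    (hcov : ∀ j, ∀ φ ∈ Φ, ∃ i, d φ (c j i) < r j) (J : ℕ) :
    P.real (⋃ i, {ω | ∑ j ∈ Finset.range (J + 1), y j ≤ ‖G (c J i) ω‖})
      ≤ b 0 * (c₁ * Real.exp (-(c₂ * (y 0 / τ))))
        + ∑ j ∈ Finset.range J, b (j + 1) * (c₁ * Real.exp (-(c₂ * (y (j + 1) / r j)))) := by
  induction J with
  | zero =>
    simp only [zero_add, Finset.sum_range_one, Finset.range_zero, Finset.sum_empty, add_zero]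
    exact measureReal_iUnion_fin_le (hm 0) (by positivity) fun i => hG _ (hc 0 i) _ (hy 0)
  | succ J ih =>
    -- Each point of the finer net is linked to a single point of the coarser one. The number of
    -- links at this level is thus the size of the finer net, not the product of the two sizes.
    choose π hπ using fun i => hcov J (c (J + 1) i) (hc (J + 1) i)
    have hsub : (⋃ i, {ω | ∑ j ∈ Finset.range (J + 1 + 1), y j ≤ ‖G (c (J + 1) i) ω‖})
        ⊆ (⋃ i, {ω | ∑ j ∈ Finset.range (J + 1), y j ≤ ‖G (c J i) ω‖})
          ∪ ⋃ i, {ω | y (J + 1) ≤ ‖G (c (J + 1) i) ω - G (c J (π i)) ω‖} := by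
      intro ω hω
      obtain ⟨i, hi⟩ := mem_iUnion.1 hω
      simp only [mem_ofPred_eq] at hi
      rw [Finset.sum_range_succ] at hi
      rcases le_or_gt (∑ j ∈ Finset.range (J + 1), y j) ‖G (c J (π i)) ω‖ with h | h
      · exact Or.inl (mem_iUnion.2 ⟨π i, h⟩)
      · refine Or.inr (mem_iUnion.2 ⟨i, ?_⟩)
        have := norm_le_norm_add_norm_sub' (G (c (J + 1) i) ω) (G (c J (π i)) ω)
        simp only [mem_ofPred_eq]
        linarith
    refine (measureReal_mono hsub (measure_ne_top P _)).trans
      ((measureReal_union_le _ _).trans ?_)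
    rw [Finset.sum_range_succ (fun j => b (j + 1) * (c₁ * Real.exp (-(c₂ * (y (j + 1) / r j))))) J, ← add_assoc]
    refine add_le_add ih ?_
    exact measureReal_iUnion_fin_le (hm _) (by positivity) fun i =>
      hinc _ (hc _ _) _ (hc _ _) _ (hπ i).le _ (hy _)

/-- The chaining bound for the whole class, on an event where the increments are Lipschitz. -/
theorem measureReal_exists_gt_le {B : Set Ω} {D : ℝ} (hD : 0 ≤ D)
    (hB : ∀ ω ∈ B, ∀ φ ∈ Φ, ∀ ψ ∈ Φ, ‖G φ ω - G ψ ω‖ ≤ D * d φ ψ) (hc₁ : 0 < c₁)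
    (hG : ∀ φ ∈ Φ, ∀ x > 0, P.real {ω | x ≤ ‖G φ ω‖} ≤ c₁ * Real.exp (-(c₂ * (x / τ))))
    (hinc : ∀ φ ∈ Φ, ∀ ψ ∈ Φ, ∀ r, d φ ψ ≤ r → ∀ x > 0,
      P.real {ω | x ≤ ‖G φ ω - G ψ ω‖} ≤ c₁ * Real.exp (-(c₂ * (x / r))))
    {b r y : ℕ → ℝ} (hy : ∀ j, 0 < y j)
    (hnet : ∀ j, ∃ m : ℕ, (m : ℝ) ≤ b j ∧ ∃ c : Fin m → T,
      (∀ i, c i ∈ Φ) ∧ ∀ φ ∈ Φ, ∃ i, d φ (c i) < r j) (J : ℕ) :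
    P.real {ω | ω ∈ B ∧ ∃ φ ∈ Φ, D * r J + ∑ j ∈ Finset.range (J + 1), y j ≤ ‖G φ ω‖}
      ≤ b 0 * (c₁ * Real.exp (-(c₂ * (y 0 / τ))))
        + ∑ j ∈ Finset.range J, b (j + 1) * (c₁ * Real.exp (-(c₂ * (y (j + 1) / r j)))) := by
  choose m hm c hc hcov using hnet
  refine le_trans (measureReal_mono ?_ (measure_ne_top P _))
    (measureReal_net_ge_le hc₁ hG hinc hm hy c hc hcov J)
  rintro ω ⟨hω, φ, hφ, hge⟩
  obtain ⟨i, hi⟩ := hcov J φ hφ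
  refine mem_iUnion.2 ⟨i, ?_⟩
  have h1 := norm_le_norm_add_norm_sub' (G φ ω) (G (c J i) ω)
  have h2 := hB ω hω φ hφ _ (hc J i)
  have h3 : D * d φ (c J i) ≤ D * r J := mul_le_mul_of_nonneg_left hi.le hD
  simp only [mem_ofPred_eq]
  linarith

end Chain

/-! ### Dyadic sums against the entropy integral -/

section EntropyIntegral

variable {H : ℝ → ℝ} {α : ℝ}

theorem intervalIntegrable_of_continuousOn_Ioi (hH : ContinuousOn H (Ioi 0)) {a b : ℝ} (ha : 0 < a)
    (hb : 0 < b) : IntervalIntegrable H volume a b :=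
  (hH.mono fun _ hx => (lt_min ha hb).trans_le hx.1).intervalIntegrable

theorem integral_le_integral_of_lower_le (hH : ContinuousOn H (Ioi 0)) (h0 : ∀ x > 0, 0 ≤ H x)
    {a b c : ℝ} (ha : 0 < a) (hab : a ≤ b) (hbc : b ≤ c) :
    ∫ x in b..c, H x ≤ ∫ x in a..c, H x := by
  have hb := ha.trans_le hab
  rw [← intervalIntegral.integral_add_adjacent_intervals
    (intervalIntegrable_of_continuousOn_Ioi hH ha hb)
    (intervalIntegrable_of_continuousOn_Ioi hH hb (hb.trans_le hbc))]
  have := intervalIntegral.integral_nonneg (μ := volume) (f := H) hab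
    fun x hx => h0 x (ha.trans_le hx.1)
  linarith

theorem half_mul_le_integral (hH : ContinuousOn H (Ioi 0)) (hanti : AntitoneOn H (Ioi 0)) {x : ℝ}
    (hx : 0 < x) : x / 2 * H x ≤ ∫ s in (x / 2)..x, H s := by
  have hx2 : 0 < x / 2 := by positivity
  have h1 := intervalIntegral.integral_mono_on (μ := volume) (f := fun _ => H x) (g := H)
    (half_le_self hx.le) (by simp) (intervalIntegrable_of_continuousOn_Ioi hH hx2 hx)
    fun s hs => hanti (hx2.trans_le hs.1) hx hs.2
  rw [intervalIntegral.integral_const, smul_eq_mul, sub_half] at h1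
  exact h1

/-- By monotonicity x H(x) is at most 2 ∫ H over [x/2, x], and for dyadic x these intervals do not
overlap. -/
theorem sum_dyadic_le_integral (hH : ContinuousOn H (Ioi 0)) (hanti : AntitoneOn H (Ioi 0))
    (h0 : ∀ x > 0, 0 ≤ H x) (hα : 0 < α) (J : ℕ) :
    ∑ j ∈ Finset.range J, α / 2 ^ (j + 1) * H (α / 2 ^ (j + 1))
      ≤ 2 * ∫ s in (α / 2 ^ (J + 1))..α, H s := by
  induction J with
  | zero =>
    have := intervalIntegral.integral_nonneg (μ := volume) (f := H) (half_le_self hα.le)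
      fun x hx => h0 x ((half_pos hα).trans_le hx.1)
    simpa using this
  | succ J ih =>
    have hr : 0 < α / 2 ^ (J + 1) := by positivity
    have hr' : α / 2 ^ (J + 1 + 1) = α / 2 ^ (J + 1) / 2 := by rw [pow_succ _ (J + 1)]; field_simp
    rw [Finset.sum_range_succ, hr', ← intervalIntegral.integral_add_adjacent_intervals
      (intervalIntegrable_of_continuousOn_Ioi hH (half_pos hr) hr)
      (intervalIntegrable_of_continuousOn_Ioi hH hr hα)]
    have := half_mul_le_integral hH hanti hr
    linarith

theorem sum_mul_half_pow_le (J : ℕ) :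
    ∑ j ∈ Finset.range J, ((j : ℝ) + 1) / 2 ^ (j + 1) ≤ 2 := by
  have h : ∀ J : ℕ, ∑ j ∈ Finset.range J, ((j : ℝ) + 1) / 2 ^ (j + 1)
      = 2 - ((J : ℝ) + 2) / 2 ^ J := by
    intro J
    induction J with
    | zero => simp
    | succ J ih =>
      rw [Finset.sum_range_succ, ih, pow_succ]
      push_cast
      field_simp
      ring
  rw [h]
  have : (0 : ℝ) ≤ ((J : ℝ) + 2) / 2 ^ J := by positivity
  linarith

theorem sum_half_pow_succ_le (J : ℕ) : ∑ j ∈ Finset.range J, (1 : ℝ) / 2 ^ (j + 1) ≤ 1 := by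
  have h : ∀ J : ℕ, ∑ j ∈ Finset.range J, (1 : ℝ) / 2 ^ (j + 1) = 1 - 1 / 2 ^ J := by
    intro J
    induction J with
    | zero => simp
    | succ J ih =>
      rw [Finset.sum_range_succ, ih, pow_succ]
      field_simp
      ring
  rw [h]
  have : (0 : ℝ) ≤ 1 / 2 ^ J := by positivity
  linarith

theorem exists_dyadic_le {δ : ℝ} (hδ : 0 < δ) (h : δ ≤ α) :
    ∃ J : ℕ, α / 2 ^ J ≤ δ ∧ δ / 2 ≤ α / 2 ^ J := by
  classical
  have hex : ∃ J : ℕ, α / 2 ^ J ≤ δ := by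
    obtain ⟨J, hJ⟩ := pow_unbounded_of_one_lt (α / δ) (one_lt_two : (1 : ℝ) < 2)
    refine ⟨J, ?_⟩
    rw [div_lt_iff₀ hδ] at hJ
    rw [div_le_iff₀ (by positivity)]
    linarith
  -- Minimality of J gives the lower bound: the previous mesh still exceeds δ, unless J = 0, where α
  -- ≥ δ.
  refine ⟨Nat.find hex, Nat.find_spec hex, ?_⟩
  rcases hJ : Nat.find hex with _ | J
  · simp only [pow_zero, div_one]
    linarith
  · have h1 := Nat.find_min hex (m := J) (by omega)
    rw [not_le] at h1
    rw [pow_succ, ← div_div]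
    linarith

end EntropyIntegral

/-- The maximal inequality for a process with exponential increments, in terms of the entropy
integral. -/
theorem measureReal_exists_large_le {T Ω : Type*} [MeasurableSpace Ω] {P : Measure Ω}
    [IsProbabilityMeasure P] {G : T → Ω → ℂ} {d : T → T → ℝ} {Φ : Set T} {B : Set Ω}
    {H : ℝ → ℝ} {c₁ c₂ τ D η α : ℝ} (hD : 0 < D)
    (hB : ∀ ω ∈ B, ∀ φ ∈ Φ, ∀ ψ ∈ Φ, ‖G φ ω - G ψ ω‖ ≤ D * d φ ψ) (hc₁ : 0 < c₁) (hc₂ : 0 < c₂)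
    (hτ : 0 < τ) (hη : 0 < η)
    (hG : ∀ φ ∈ Φ, ∀ x > 0, P.real {ω | x ≤ ‖G φ ω‖} ≤ c₁ * Real.exp (-(c₂ * (x / τ))))
    (hinc : ∀ φ ∈ Φ, ∀ ψ ∈ Φ, ∀ r, d φ ψ ≤ r → ∀ x > 0,
      P.real {ω | x ≤ ‖G φ ω - G ψ ω‖} ≤ c₁ * Real.exp (-(c₂ * (x / r))))
    (hH : ContinuousOn H (Ioi 0)) (hanti : AntitoneOn H (Ioi 0))
    (hnet : ∀ r > 0, ∃ m : ℕ, 1 ≤ m ∧ (m : ℝ) ≤ Real.exp (H r) ∧ ∃ c : Fin m → T,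
      (∀ i, c i ∈ Φ) ∧ ∀ φ ∈ Φ, ∃ i, d φ (c i) < r)
    (hα : 0 < α) (hHα : H α = c₂ / 8 * (η / τ))
    (hcond : α < η / (16 * D) ∨ 2 * (Real.log 2 / c₂) * τ ≤ η ∧
      192 / c₂ * ∫ s in (η / (2 ^ 6 * D))..α, H s ≤ η) :
    P.real {ω | ω ∈ B ∧ ∃ φ ∈ Φ, 9 / 16 * η ≤ ‖G φ ω‖}
      ≤ 3 * c₁ * Real.exp (-(c₂ / 8 * (η / τ))) := by
  have h0 : ∀ x > 0, 0 ≤ H x := fun x hx => by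
    obtain ⟨m, hm, hle, -⟩ := hnet x hx
    have h1 : (1 : ℝ) ≤ m := by exact_mod_cast hm
    exact Real.one_le_exp_iff.1 (h1.trans hle)
  have hlog : 0 < Real.log 2 := Real.log_pos one_lt_two
  set r : ℕ → ℝ := fun j => α / 2 ^ j with hr
  have hrpos : ∀ j, 0 < r j := fun j => by positivity
  have hrle : ∀ j, r j ≤ α := fun j => div_le_self hα.le (one_le_pow₀ one_le_two)
  -- The deviation allotted to each link. For j = 0 the exponent c₂ y₀/τ is 2H(α). For j ≥ 1,
  -- dividing by the coarser mesh r_{j-1} = 2r_j gives the exponent 2H(r_j) + j log 2: one H(r_j)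
  -- cancels the cardinality of the net, the other is at least H(α), and 2^{-j} makes the levels
  -- summable.
  set y : ℕ → ℝ := fun j => if j = 0 then η / 4 else
    2 * r j / c₂ * (2 * H (r j) + j * Real.log 2) with hy
  have hypos : ∀ j, 0 < y j := by
    intro j
    rcases j with _ | j
    · simp only [hy, if_pos]
      positivity
    · have := h0 _ (hrpos (j + 1))
      simp only [hy, Nat.succ_ne_zero, if_false]
      have h1 : 0 < ((j + 1 : ℕ) : ℝ) * Real.log 2 := by positivity
      have h2 := hrpos (j + 1)
      positivity
  have hprob : ∀ J : ℕ, P.real {ω | ω ∈ B ∧ ∃ φ ∈ Φ,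
      D * r J + ∑ j ∈ Finset.range (J + 1), y j ≤ ‖G φ ω‖}
        ≤ 3 * c₁ * Real.exp (-(c₂ / 8 * (η / τ))) := by
    intro J
    refine (measureReal_exists_gt_le hD.le hB hc₁ hG hinc (b := fun j => Real.exp (H (r j)))
      (r := r) hypos (fun j => ?_) J).trans ?_
    · obtain ⟨m, -, h⟩ := hnet _ (hrpos j)
      exact ⟨m, h⟩
    · rw [← hHα]
      have hbase : Real.exp (H (r 0)) * (c₁ * Real.exp (-(c₂ * (y 0 / τ))))
          = c₁ * Real.exp (-H α) := by
        have : r 0 = α := by simp [hr]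
        rw [this, mul_left_comm, ← Real.exp_add]
        congr 2
        simp only [hy, if_pos]
        have : c₂ * (η / 4 / τ) = 2 * (c₂ / 8 * (η / τ)) := by ring
        rw [this, ← hHα]
        ring
      have hstep : ∀ j, Real.exp (H (r (j + 1))) * (c₁ * Real.exp (-(c₂ * (y (j + 1) / r j))))
          ≤ c₁ * Real.exp (-H α) * (1 / 2 ^ (j + 1)) := by
        intro j
        have hexp : c₂ * (y (j + 1) / r j) = 2 * H (r (j + 1)) + (j + 1 : ℕ) * Real.log 2 := by
          simp only [hy, Nat.succ_ne_zero, if_false]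
          have h2 : r j = 2 * r (j + 1) := by
            simp only [hr, pow_succ]
            field_simp
          have h3 := (hrpos (j + 1)).ne'
          rw [h2]
          field_simp
        have hpow : Real.exp (-(((j + 1 : ℕ) : ℝ) * Real.log 2)) = 1 / 2 ^ (j + 1) := by
          rw [Real.exp_neg, Real.exp_nat_mul, Real.exp_log two_pos, one_div]
        rw [hexp, mul_left_comm, ← Real.exp_add, mul_assoc, ← hpow, ← Real.exp_add]
        have := hanti (hrpos (j + 1)) hα (hrle (j + 1))
        refine mul_le_mul_of_nonneg_left (Real.exp_le_exp.2 ?_) hc₁.le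
        linarith
      have hsum := Finset.sum_le_sum (s := Finset.range J) fun j _ => hstep j
      rw [← Finset.mul_sum] at hsum
      have hle := mul_le_mul_of_nonneg_left (sum_half_pow_succ_le J)
        (by positivity : 0 ≤ c₁ * Real.exp (-H α))
      have hpos : 0 < c₁ * Real.exp (-H α) := by positivity
      simp only [hbase]
      linarith
  -- Budget: η/4 for the first net and η/16 for the final Lipschitz step. In the entropy case the
  -- links add η/24 + η/6, for a total of 25η/48 ≤ 9η/16.
  suffices h : ∃ J : ℕ, D * r J + ∑ j ∈ Finset.range (J + 1), y j ≤ 9 / 16 * η by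
    obtain ⟨J, hJ⟩ := h
    refine (measureReal_mono ?_ (measure_ne_top P _)).trans (hprob J)
    rintro ω ⟨hω, φ, hφ, hge⟩
    exact ⟨hω, φ, hφ, hJ.trans hge⟩
  have hmesh : ∀ x, x ≤ η / (16 * D) → D * x ≤ η / 16 := by
    intro x hx
    rw [le_div_iff₀ (by positivity)] at hx ⊢
    linarith
  rcases lt_or_ge α (η / (16 * D)) with hlt | hge
  · refine ⟨0, ?_⟩
    have h1 := hmesh _ ((hrle 0).trans hlt.le)
    simp only [zero_add, Finset.sum_range_one, hy, if_pos]
    linarith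
  · obtain ⟨h47, h48⟩ := hcond.resolve_left hge.not_gt
    have hδ : 0 < η / (16 * D) := by positivity
    have hδ' : 0 < η / (2 ^ 6 * D) := by positivity
    -- The lower limit of the integral is a quarter of the target mesh: one factor 2 because the
    -- last mesh may be half the target, one because the dyadic comparison reaches down to half the
    -- last mesh.
    have hδδ : η / (2 ^ 6 * D) = η / (16 * D) / 4 := by field_simp; norm_num
    obtain ⟨J, hJ, hJ'⟩ := exists_dyadic_le hδ hge
    refine ⟨J, ?_⟩
    set I := ∫ s in (η / (2 ^ 6 * D))..α, H s with hI
    have hI' : I ≤ c₂ * η / 192 := by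
      rw [div_mul_eq_mul_div, div_le_iff₀ hc₂] at h48
      linarith
    have hsumH : ∑ j ∈ Finset.range J, r (j + 1) * H (r (j + 1)) ≤ 2 * I := by
      refine (sum_dyadic_le_integral hH hanti h0 hα J).trans ?_
      have h1 : η / (2 ^ 6 * D) ≤ α / 2 ^ (J + 1) := by
        have h2 : α / 2 ^ (J + 1) = α / 2 ^ J / 2 := by rw [pow_succ, ← div_div]
        rw [hδδ, h2]
        linarith
      have := integral_le_integral_of_lower_le hH h0 hδ' h1 (hrle (J + 1))
      linarith
    have hHI : α / 2 * H α ≤ I := by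
      refine (half_mul_le_integral hH hanti hα).trans ?_
      exact integral_le_integral_of_lower_le hH h0 hδ' (by rw [hδδ]; linarith) (half_le_self hα.le)
    -- The lower bound on η in terms of τ lets the entropy at α dominate log 2, so the terms j log 2
    -- are also paid for by the integral.
    have hlogH : Real.log 2 ≤ 4 * H α := by
      rw [hHα]
      have h1 : Real.log 2 = 2 * (Real.log 2 / c₂) * τ * (c₂ / (2 * τ)) := by field_simp
      have h2 := mul_le_mul_of_nonneg_right h47 (by positivity : 0 ≤ c₂ / (2 * τ))
      calc Real.log 2 ≤ η * (c₂ / (2 * τ)) := by rw [h1]; exact h2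
        _ = 4 * (c₂ / 8 * (η / τ)) := by field_simp; norm_num
    have hsumy : ∑ j ∈ Finset.range J, y (j + 1)
        = 4 / c₂ * ∑ j ∈ Finset.range J, r (j + 1) * H (r (j + 1))
          + 2 / c₂ * (α * Real.log 2) * ∑ j ∈ Finset.range J, ((j : ℝ) + 1) / 2 ^ (j + 1) := by
      rw [Finset.mul_sum, Finset.mul_sum, ← Finset.sum_add_distrib]
      refine Finset.sum_congr rfl fun j _ => ?_
      simp only [hy, Nat.succ_ne_zero, if_false, hr]
      push_cast
      field_simp
      ring
    have h1 : 4 / c₂ * ∑ j ∈ Finset.range J, r (j + 1) * H (r (j + 1)) ≤ η / 24 := by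
      calc _ ≤ 4 / c₂ * (2 * (c₂ * η / 192)) := by
            gcongr
            linarith
        _ = η / 24 := by field_simp; norm_num
    have h2 : 2 / c₂ * (α * Real.log 2) * ∑ j ∈ Finset.range J, ((j : ℝ) + 1) / 2 ^ (j + 1)
        ≤ η / 6 := by
      have h3 : α * Real.log 2 ≤ 8 * (c₂ * η / 192) := by
        have := mul_le_mul_of_nonneg_left hlogH hα.le
        linarith
      calc _ ≤ 2 / c₂ * (8 * (c₂ * η / 192)) * 2 := by
            gcongr
            exact sum_mul_half_pow_le J
        _ = η / 6 := by field_simp; norm_num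
    have hy0 : y 0 = η / 4 := by simp [hy]
    have h5 := hmesh _ hJ
    rw [Finset.sum_range_succ', hsumy, hy0]
    linarith

end EmpSpectral

end

/-! ### The maximal inequality over a bounded class -/

noncomputable section

namespace EmpSpectral

namespace IsBoundedClass

variable {Φ : Set (ℝ → ℝ → ℝ)} {ρI vT vS : ℝ≥0} {φ : ℝ → ℝ → ℝ}

theorem isBoundedIndex (h : IsBoundedClass Φ ρI vT vS) (hφ : φ ∈ Φ) : IsBoundedIndex φ := by
  obtain ⟨m, M, -, -, -, hM⟩ := h.bounds
  exact ⟨h.measurable φ hφ, M, fun u hu x hx => (hM φ hφ u hu x hx).2.le⟩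

theorem vSigma_le_of_mem (h : IsBoundedClass Φ ρI vT vS) (hφ : φ ∈ Φ) : vSigma φ ≤ vS :=
  (le_iSup₂ (f := fun φ (_ : φ ∈ Φ) => vSigma φ) φ hφ).trans h.vSigma_le

end IsBoundedClass

/-- The maximal inequality on the events `boundedEvent X (K * ellSum κ) n`. -/
theorem IsGaussianLocallyStationary.measureReal_iSup_gt_le {Ω : Type*} [MeasurableSpace Ω]
    {P : Measure Ω} [IsProbabilityMeasure P] {κ K : ℝ} {X : ℕ → ℤ → Ω → ℝ}
    (h : IsGaussianLocallyStationary P κ K X) (hκ : 0 < κ) (hK : 0 < K) {L : ℝ} (hL1 : 1 ≤ L)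
    (hL : 18 * (K * ellSum κ) ^ 2 ≤ L) {c₁ c₂ : ℝ} (hc₁ : 0 < c₁) (hc₂ : 0 < c₂)
    (hexp : ExpInequality P X c₁ c₂) {n : ℕ} (hn : 2 ≤ n) {Φ : Set (ℝ → ℝ → ℝ)}
    {ρI vT vS : ℝ≥0} {τ₂ : ℝ} {H : ℝ → ℝ} (hΦ : IsBoundedClass Φ ρI vT vS) (hτ : 0 < τ₂)
    (hρ : ∀ φ ∈ Φ, rho2 φ ≤ τ₂) (hH : IsEntropyMajorant H Φ) {η α : ℝ} (hη : 0 < η)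
    (hα : 0 < α) (hHα : H α = c₂ / 8 * (η / τ₂))
    (h46 : 2 ^ 6 * L * max (max (ρI : ℝ) (vS : ℝ)) 1 * (Real.log n / Real.sqrt n) ≤ η)
    (hcond : α < η / (16 * L * n * Real.log n) ∨ (2 * (Real.log 2 / c₂) * τ₂ ≤ η ∧
      192 / c₂ * ∫ s in (η / (2 ^ 6 * L * n * Real.log n))..α, H s ≤ η)) :
    P.real ({ω | ENNReal.ofReal η < ⨆ φ ∈ Φ, ENNReal.ofReal ‖En P X n φ ω‖}
        ∩ boundedEvent X (K * ellSum κ) n)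
      ≤ 3 * c₁ * Real.exp (-(c₂ / 8 * (η / τ₂))) := by
  have hlog : 0 < Real.log n := Real.log_pos (by exact_mod_cast hn)
  have hn0 : (0 : ℝ) < n := by positivity
  have hL0 : 0 < L := by linarith
  have hL0' : 0 ≤ 18 * (K * ellSum κ) ^ 2 := by positivity
  have hI : ∀ φ ∈ Φ, IsBoundedIndex φ := fun φ hφ => hΦ.isBoundedIndex hφ
  -- By the lower bound on η in terms of log n / √n, passing to the averaged process costs at most
  -- η/64; the remaining 63η/64 exceeds the level 9η/16 reached by chaining.
  have herr : 6 * (K * ellSum κ) ^ 2 * vS * (Real.log n / Real.sqrt n) ≤ η / 64 := by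
    have hv : (vS : ℝ) ≤ max (max (ρI : ℝ) (vS : ℝ)) 1 :=
      (le_max_right _ _).trans (le_max_left _ _)
    calc _ ≤ L * max (max (ρI : ℝ) (vS : ℝ)) 1 * (Real.log n / Real.sqrt n) := by
          gcongr
          linarith
      _ ≤ η / 64 := by
          rw [le_div_iff₀ (by norm_num)]
          linarith
  refine (measureReal_mono ?_ (measure_ne_top P _)).trans
    (measureReal_exists_large_le (G := avgSeries P X n) (d := fun φ ψ => rho2 (φ - ψ)) (Φ := Φ)
      (B := boundedEvent X (K * ellSum κ) n) (D := L * n * Real.log n) (by positivity)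
      ?_ hc₁ hc₂ hτ hη ?_ ?_ hH.continuousOn hH.antitoneOn ?_ hα hHα ?_)
  · rintro ω ⟨hsup, hω⟩
    obtain ⟨φ, hsup⟩ := lt_iSup_iff.1 (mem_ofPred_eq ▸ hsup)
    obtain ⟨hφ, hsup⟩ := lt_iSup_iff.1 hsup
    have h1 := (ENNReal.ofReal_lt_ofReal_iff_of_nonneg hη.le).1 hsup
    have h2 := h.norm_En_sub_avgSeries_le hκ hK hn hω (hI φ hφ) (hΦ.vSigma_le_of_mem hφ)
    have h3 := norm_le_norm_add_norm_sub' (En P X n φ ω) (avgSeries P X n φ ω)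
    exact ⟨hω, φ, hφ, by linarith⟩
  · intro ω hω φ hφ ψ hψ
    rw [← avgSeries_sub (hI φ hφ) (hI ψ hψ)]
    refine (h.norm_avgSeries_le hκ hK hn hω ((hI φ hφ).sub (hI ψ hψ))).trans ?_
    have : 0 ≤ rho2 (φ - ψ) := Real.sqrt_nonneg _
    gcongr
  · exact fun φ hφ x hx =>
      measureReal_avgSeries_ge_le h hc₁ hc₂ hexp (by omega) (hI φ hφ) (hρ φ hφ) hx
  · intro φ hφ ψ hψ r hr x hx
    simp only [← avgSeries_sub (hI φ hφ) (hI ψ hψ)]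
    exact measureReal_avgSeries_ge_le h hc₁ hc₂ hexp (by omega) ((hI φ hφ).sub (hI ψ hψ)) hr hx
  · exact fun r hr => exists_net (hH.entropy_le r hr)
  · simpa only [← mul_assoc] using hcond

end EmpSpectral

end

theorem theorem4p4 (κ K : ℝ) (hκ : 0 < κ) (hK : 0 < K) :
    -- constants `c₁, c₂` of the exponential inequality exist
    (∃ c₁ c₂ : ℝ, 0 < c₁ ∧ 0 < c₂ ∧
      ∀ (Ω : Type u) [MeasurableSpace Ω] (P : Measure Ω) [IsProbabilityMeasure P]
        (X : ℕ → ℤ → Ω → ℝ), EmpSpectral.IsGaussianLocallyStationary P κ K X →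
        EmpSpectral.ExpInequality P X c₁ c₂) ∧
    -- and with all such constants the maximal inequality holds
    ∃ L : ℝ, 1 ≤ L ∧
      ∀ (Ω : Type u) [MeasurableSpace Ω] (P : Measure Ω) [IsProbabilityMeasure P]
        (X : ℕ → ℤ → Ω → ℝ), EmpSpectral.IsGaussianLocallyStationary P κ K X →
        ∃ B : ℕ → Set Ω, (∀ n, MeasurableSet (B n)) ∧ Tendsto (fun n => P (B n)) atTop (𝓝 1) ∧
          ∀ (c₁ c₂ : ℝ), 0 < c₁ → 0 < c₂ → EmpSpectral.ExpInequality P X c₁ c₂ →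
          ∀ (n : ℕ), 2 ≤ n →
          ∀ (Φ : Set (ℝ → ℝ → ℝ)) (ρI vT vS : ℝ≥0) (τ₂ : ℝ) (H : ℝ → ℝ),
            EmpSpectral.IsBoundedClass Φ ρI vT vS →
            0 < τ₂ → (∀ φ ∈ Φ, EmpSpectral.rho2 φ ≤ τ₂) →
            EmpSpectral.IsEntropyMajorant H Φ →
          ∀ (η α : ℝ), 0 < η →
            -- `α` is the value at `c₂ η / (8 τ₂)` of the inverse of `H`
            0 < α → H α = c₂ / 8 * (η / τ₂) →
            2 ^ 6 * L * max (max (ρI : ℝ) (vS : ℝ)) 1 * (Real.log n / Real.sqrt n) ≤ η →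
            (α < η / (16 * L * n * Real.log n) ∨
              (2 * (Real.log 2 / c₂) * τ₂ ≤ η ∧
                192 / c₂ * ∫ s in (η / (2 ^ 6 * L * n * Real.log n))..α, H s ≤ η)) →
            P.real ({ω | ENNReal.ofReal η <
                ⨆ φ ∈ Φ, ENNReal.ofReal ‖EmpSpectral.En P X n φ ω‖} ∩ B n)
              ≤ 3 * c₁ * Real.exp (-(c₂ / 8 * (η / τ₂))) := by
  have hσ : 0 < K * EmpSpectral.ellSum κ := mul_pos hK (EmpSpectral.ellSum_pos hκ)
  refine ⟨⟨3, Real.sqrt (2 * Real.pi) / (4 * (K * EmpSpectral.ellSum κ) ^ 2), by norm_num,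
    by positivity, fun Ω _ P _ X h => h.expInequality hκ hK⟩,
    -- The constant L is the Lipschitz constant of the averaged process up to the factor n log n,
    -- enlarged to be at least 1.
    max 1 (18 * (K * EmpSpectral.ellSum κ) ^ 2), le_max_left _ _, fun Ω _ P _ X h => ?_⟩
  refine ⟨EmpSpectral.boundedEvent X (K * EmpSpectral.ellSum κ),
    fun n => h.measurableSet_boundedEvent _ n, h.tendsto_measure_boundedEvent hκ hK, ?_⟩
  intro c₁ c₂ hc₁ hc₂ hexp n hn Φ ρI vT vS τ₂ H hΦ hτ hρ hH η α hη hα hHα h46 hcond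
  exact h.measureReal_iSup_gt_le hκ hK (le_max_left _ _) (le_max_right _ _) hc₁ hc₂ hexp hn hΦ hτ
    hρ hH hη hα hHα h46 hcond
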